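/- \textbf{Setting.} Let $N=(N-N')+N'$ with $1\le N'\le N$, let $d\ge 1$, and write $u=(u^1,u^2)\in\mathbb R^{N-N'}\times\mathbb R^{N'}$; $M^{\alpha\beta}$ denotes the blocks of a matrix $M$ in this splitting. Let $\mathcal U\subset\mathcal U^*\subset\mathbb R^N$ be open and connected and let $A_0,A_j,B_{jk}$ ($1\le j,k\le d$) be $C^\infty$ real $N\times N$ matrix functions on $\mathcal U^*$, with $A_0$ invertible, $A_0^{12}=0$, and $B_{jk}^{11}=B_{jk}^{12}=B_{jk}^{21}=0$. Put $\overline A(u,\xi)=\sum_j\xi_jA_0^{-1}A_j$, $\overline B(u,\xi)=\sum_{j,k}\xi_j\xi_kA_0^{-1}B_{jk}$. Assume that for some $c>0$ and all $\xi\in\mathbb R^d$: for $u\in\mathcal U^*$ the eigenvalues of $\overline B^{22}(u,\xi)$ satisfy $\mathrm{Re}\,\mu\ge c|\xi|^2$, and the eigenvalues of $\overline A^{11}(u,\xi)$ are real; for $u\in\mathcal U$ the eigenvalues of $i\overline A(u,\xi)+\overline B(u,\xi)$ satisfy $\mathrm{Re}\,\mu\ge c|\xi|^2/(1+|\xi|^2)$;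 $\det A_d^{11}\ne0$ on $\mathcal U^*$ and $\det A_d\neq 0$ on $\mathcal U$. Let $N^1_+$ be the number of positive eigenvalues of $(A_0^{-1}A_d)^{11}(u)$, $u\in\mathcal U^*$, and $N_b=N'+N^1_+$. Consider, on $\{x>0\}$, $x=x_d$, $y=(x_1,\dots,x_{d-1})$, $$A_0(u)\partial_tu+\sum_jA_j(u)\partial_ju-\varepsilon\sum_{j,k}\partial_j(B_{jk}(u)\partial_ku)=0,$$ with boundary conditions at $x=0$ $$\Upsilon_1(u^1)=0,\qquad \Upsilon_2(u^2)=0,\qquad K_d\,\varepsilon\partial_xu^2+\sum_{j<d}K_j(u)\,\varepsilon\partial_ju^2=0,$$ where $\Upsilon_1,\Upsilon_2,K_j$ are smooth, the three groups have $N^1_+$, $N'-N''$, $N''$ components ($0\le N''\le N'$), and on $\mathcal U^*$ the ranks of $\Upsilon_1'$, $\Upsilon_2'$, $K_d$ (a constant matrix) are $N^1_+$, $N'-N''$, $N''$. A \emph{profile} is a $C^\infty$ map $w:[0,\infty)\to\mathcal U^*$ for which there are $\underline u\in\mathcal U$ and $\delta>0$ such that $e^{\delta z}\partial_z^k(w-\underline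 u)$ is bounded on $[0,\infty)$ for every $k\in\mathbb N$. For $\zeta=(\tau,\eta,\gamma)\in\mathbb R\times\mathbb R^{d-1}\times\mathbb R$ let $L(z,\gamma+i\tau,i\eta,\partial_z)u=f$, $z=x/\varepsilon$, be the rescaled Laplace--Fourier transform of the equations linearized at $w(x/\varepsilon)$, written as the first-order system $\partial_zU=\mathcal G(z,\zeta)U+F$ for $U=(u,\partial_zu^2)\in\mathbb C^{N+N'}$, with linearized boundary condition $\Gamma(\zeta)U(0)=g\in\mathbb C^{N_b}$, $$\Gamma(\zeta)(u^1,u^2,u^3)=\Big(\Upsilon_1'(w^1(0))u^1,\ \Upsilon_2'(w^2(0))u^2,\ K_du^3+\sum_{j<d}i\eta_jK_j(w(0))u^2\Big).$$ Let $G(\underline u,\zeta)=\lim_{z\to\infty}\mathcal G(z,\zeta)$. The profile is \emph{transversal} if (i) no nontrivial solution of $\partial_zU=\mathcal G(z,0)U$, $U=(\dot w,\partial_z\dot w^2)$, with $\dot w\to0$ at $+\infty$ satisfies $\Gamma(0)U(0)=0$, and (ii) $U\mapsto\Gamma(0)U(0)$ maps the space of solutions with $\dot w$ bounded onto $\mathbb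 C^{N_b}$. For a matrix $M$, $\mathbb E^-(M)$ is its invariant space associated with the spectrum in $\{\mathrm{Re}\,\mu<0\}$. A \emph{conjugator} is a smooth invertible matrix $\Phi(z,\zeta)$, $z\ge0$, $\zeta$ in a neighborhood of $0$, with $\partial_z\Phi=\mathcal G\Phi-\Phi G(\underline u,\zeta)$ and such that $\Phi,\Phi^{-1}$ converge to $\mathrm{Id}$ as $z\to\infty$ at an exponential rate, uniformly in $\zeta$. A \emph{block reduction} is a smooth invertible matrix $V(\zeta)$, $\zeta$ in a neighborhood of $0$, such that $V^{-1}G(\underline u,\cdot)V=\mathrm{diag}(H,P)$ with $H$ of size $N$ and $P$ of size $N'$, and $V(0)=\begin{pmatrix}\mathrm{Id}&\overline V\\0&\mathrm{Id}\end{pmatrix}$ for some matrix $\overline V$. Given these, put $\widetilde\Gamma(\zeta)=\Gamma(\zeta)\Phi(0,\zeta)$, write $\widetilde\Gamma V=(\Gamma_H,\Gamma_P)$ for its restrictions to $\mathbb C^N\times\{0\}$ and $\{0\}\times\mathbb C^{N'}$, and put $\mathbb F_P(\zeta)=\Gamma_P(\zeta)\mathbb E^-(P(\zeta))$. Given a complement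 $\mathbb F_H$ of $\mathbb F_P(0)$ in $\mathbb C^{N_b}$, let $\Gamma_{red}(\zeta)=\pi_H(\zeta)\Gamma_H(\zeta)$, where, for $\zeta$ small, $\pi_H(\zeta)$ is the projection onto $\mathbb F_H$ along $\mathbb F_P(\zeta)$. \textbf{Theorem.} Suppose that the profile $w$ is transversal. Then conjugators and block reductions exist, and for every choice of a conjugator $\Phi$, a block reduction $V$ and a complement $\mathbb F_H$ of $\mathbb F_P(0)$, the following two statements are equivalent. (a) (Maximal estimates for low frequencies.) There are $C,\rho_0>0$ such that for all $\zeta$ with $\gamma\ge0$, $0<|\zeta|\le\rho_0$, all $\widetilde F\in L^2(\mathbb R_+)$, all $g$ and all solutions $\widetilde U=(\widetilde U^1,\widetilde U^2)\in L^2(\mathbb R_+;\mathbb C^N\times\mathbb C^{N'})$ of $\partial_z\widetilde U=G(\underline u,\zeta)\widetilde U+\widetilde F$, $\widetilde\Gamma(\zeta)\widetilde U(0)=g$, with $\varphi=(\gamma+|\zeta|^2)^{1/2}$, $$\varphi\|\widetilde U^1\|_{L^2}+\|\widetilde U^2\|_{L^2}+|\widetilde U(0)|\le C\big(\varphi^{-1}\|\widetilde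 F\|_{L^2}+|g|\big).$$ (b) (Maximal estimates for the reduced problem.) There are $C,\rho_0>0$ such that for all $\check\zeta=(\check\tau,\check\eta,\check\gamma)$ with $|\check\zeta|=1$, $\check\gamma\ge0$, all $\rho\in(0,\rho_0]$, all $\check f\in L^2(\mathbb R_+)$, all $h$ and all solutions $\check u\in L^2(\mathbb R_+;\mathbb C^N)$ of $\partial_{\check z}\check u=\rho^{-1}H(\rho\check\zeta)\check u+\check f$, $\Gamma_{red}(\rho\check\zeta)\check u(0)=h$, $$(\check\gamma+\rho)^{1/2}\|\check u\|_{L^2}+|\check u(0)|\le C\big((\check\gamma+\rho)^{-1/2}\|\check f\|_{L^2}+|h|\big).$$ -/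

import Mathlib

open scoped ContDiff

noncomputable section

namespace ViscousBoundary

/-- The state space `ℝ^N = ℝ^{N-N'} × ℝ^{N'}`, with `n₁ = N - N'` and `n₂ = N'`. -/
abbrev State (n₁ n₂ : ℕ) : Type := Fin n₁ ⊕ Fin n₂ → ℝ

/-- Index set of the first-order unknown `U = (u¹, u², ∂_z u²) ∈ ℂ^{N+N'}`; the first summand
indexes `U¹ = (u¹, u²) ∈ ℂ^N`, the second one `U² = ∂_z u² ∈ ℂ^{N'}`. -/
abbrev FOIdx (n₁ n₂ : ℕ) : Type := (Fin n₁ ⊕ Fin n₂) ⊕ Fin n₂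

/-- Index set of the boundary data `g = (g¹, g², g³)`. -/
abbrev BdIdx (p q r : ℕ) : Type := Fin p ⊕ (Fin q ⊕ Fin r)

/-- Frequencies `ζ = (τ, η, γ) ∈ ℝ^{d+1}`, `d = m + 1`, with the Euclidean norm. -/
abbrev Freq (m : ℕ) : Type := EuclideanSpace ℝ (Fin m ⊕ Fin 2)

namespace Freq

def eta {m : ℕ} (ζ : Freq m) (j : Fin m) : ℝ := ζ (Sum.inl j)

def tau {m : ℕ} (ζ : Freq m) : ℝ := ζ (Sum.inr 0)

def gamma {m : ℕ} (ζ : Freq m) : ℝ := ζ (Sum.inr 1)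

end Freq

/-- A real matrix regarded as a complex one. -/
def cx {α β : Type*} (M : Matrix α β ℝ) : Matrix α β ℂ := M.map (fun x => (x : ℂ))

/-- Number of positive eigenvalues, with algebraic multiplicity. -/
def posEigenvalues {n : ℕ} (M : Matrix (Fin n) (Fin n) ℝ) : ℕ :=
  M.charpoly.roots.countP (fun μ => 0 < μ)

/-- The Jacobian matrix of `f` at `x`. -/
def jacobian {k n : ℕ} (f : (Fin n → ℝ) → (Fin k → ℝ)) (x : Fin n → ℝ) :
    Matrix (Fin k) (Fin n) ℝ :=
  LinearMap.toMatrix' (fderiv ℝ f x : (Fin n → ℝ) →ₗ[ℝ] (Fin k → ℝ))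

/-- The matrix of the linear map `h ↦ (M'(u) h) v`. -/
def derivMul {n₁ n₂ : ℕ}
    (M : State n₁ n₂ → Matrix (Fin n₁ ⊕ Fin n₂) (Fin n₁ ⊕ Fin n₂) ℝ) (u v : State n₁ n₂) :
    Matrix (Fin n₁ ⊕ Fin n₂) (Fin n₁ ⊕ Fin n₂) ℝ :=
  Matrix.of fun i l => ∑ k, fderiv ℝ (fun u' => M u' i k) u (Pi.single l 1) * v k

/-- Entrywise derivative, on the half line `z ≥ 0`, of a matrix depending on `z`. -/
def dz {α : Type*} (M : ℝ → Matrix α α ℝ) (z : ℝ) : Matrix α α ℝ :=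
  Matrix.of fun i j => derivWithin (fun s => M s i j) (Set.Ici 0) z

/-- The data of the boundary value problem
`A₀(u) ∂_t u + ∑_j A_j(u) ∂_j u - ε ∑_{j,k} ∂_j (B_{jk}(u) ∂_k u) = 0` on `x > 0`,
`Υ₁(u¹) = 0`, `Υ₂(u²) = 0`, `K_d ε ∂_x u² + ∑_{j<d} K_j(u) ε ∂_j u² = 0` on `x = 0`.
The space dimension is `d = m + 1`; the normal variable `x` carries the index `Fin.last m` and
the tangential variables `y_j` the indices `Fin.castSucc j`.  The integers `p, q, r` are
`N¹₊`, `N' - N''`, `N''`. -/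
structure BVP (n₁ n₂ m p q r : ℕ) where
  Ustar : Set (State n₁ n₂)
  Uhyp : Set (State n₁ n₂)
  A0 : State n₁ n₂ → Matrix (Fin n₁ ⊕ Fin n₂) (Fin n₁ ⊕ Fin n₂) ℝ
  A : Fin (m + 1) → State n₁ n₂ → Matrix (Fin n₁ ⊕ Fin n₂) (Fin n₁ ⊕ Fin n₂) ℝ
  B : Fin (m + 1) → Fin (m + 1) → State n₁ n₂ →
    Matrix (Fin n₁ ⊕ Fin n₂) (Fin n₁ ⊕ Fin n₂) ℝ
  Upsilon1 : (Fin n₁ → ℝ) → (Fin p → ℝ)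
  Upsilon2 : (Fin n₂ → ℝ) → (Fin q → ℝ)
  Kd : Matrix (Fin r) (Fin n₂) ℝ
  K : Fin m → State n₁ n₂ → Matrix (Fin r) (Fin n₂) ℝ

variable {n₁ n₂ m p q r : ℕ}

namespace BVP

/-- The normal coefficient `A_d`. -/
def An (S : BVP n₁ n₂ m p q r) (u : State n₁ n₂) :
    Matrix (Fin n₁ ⊕ Fin n₂) (Fin n₁ ⊕ Fin n₂) ℝ := S.A (Fin.last m) u

/-- `Ā(u, ξ) = ∑_j ξ_j A₀(u)⁻¹ A_j(u)`. -/
def Abar (S : BVP n₁ n₂ m p q r) (u : State n₁ n₂) (ξ : EuclideanSpace ℝ (Fin (m + 1))) :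
    Matrix (Fin n₁ ⊕ Fin n₂) (Fin n₁ ⊕ Fin n₂) ℝ :=
  ∑ j, ξ j • ((S.A0 u)⁻¹ * S.A j u)

/-- `B̄(u, ξ) = ∑_{j,k} ξ_j ξ_k A₀(u)⁻¹ B_{jk}(u)`. -/
def Bbar (S : BVP n₁ n₂ m p q r) (u : State n₁ n₂) (ξ : EuclideanSpace ℝ (Fin (m + 1))) :
    Matrix (Fin n₁ ⊕ Fin n₂) (Fin n₁ ⊕ Fin n₂) ℝ :=
  ∑ j, ∑ k, (ξ j * ξ k) • ((S.A0 u)⁻¹ * S.B j k u)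

/-- The standing structural assumptions on the system and on its boundary conditions. -/
structure Admissible (S : BVP n₁ n₂ m p q r) : Prop where
  one_le : 1 ≤ n₂
  dims : q + r = n₂
  isOpen_Ustar : IsOpen S.Ustar
  isConnected_Ustar : IsConnected S.Ustar
  isOpen_Uhyp : IsOpen S.Uhyp
  isConnected_Uhyp : IsConnected S.Uhyp
  Uhyp_subset : S.Uhyp ⊆ S.Ustar
  smooth_A0 : ∀ i j, ContDiffOn ℝ ∞ (fun u => S.A0 u i j) S.Ustar
  smooth_A : ∀ a i j, ContDiffOn ℝ ∞ (fun u => S.A a u i j) S.Ustar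
  smooth_B : ∀ a b i j, ContDiffOn ℝ ∞ (fun u => S.B a b u i j) S.Ustar
  det_A0 : ∀ u ∈ S.Ustar, (S.A0 u).det ≠ 0
  -- block structure
  A0_block : ∀ u ∈ S.Ustar, (S.A0 u).toBlocks₁₂ = 0
  B_block : ∀ a b, ∀ u ∈ S.Ustar,
    S.B a b u = Matrix.fromBlocks 0 0 0 (S.B a b u).toBlocks₂₂
  -- parabolicity of the `(2,2)` block
  parabolic : ∃ c > 0, ∀ u ∈ S.Ustar, ∀ ξ : EuclideanSpace ℝ (Fin (m + 1)),
    ∀ μ ∈ spectrum ℂ (cx (S.Bbar u ξ).toBlocks₂₂), c * ‖ξ‖ ^ 2 ≤ μ.re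
  -- hyperbolicity of the `(1,1)` block
  hyperbolic : ∀ u ∈ S.Ustar, ∀ ξ : EuclideanSpace ℝ (Fin (m + 1)), ξ ≠ 0 →
    ∀ μ ∈ spectrum ℂ (cx (S.Abar u ξ).toBlocks₁₁), μ.im = 0
  -- genuine coupling
  dissipative : ∃ c > 0, ∀ u ∈ S.Uhyp, ∀ ξ : EuclideanSpace ℝ (Fin (m + 1)),
    ∀ μ ∈ spectrum ℂ (Complex.I • cx (S.Abar u ξ) + cx (S.Bbar u ξ)),
      c * (‖ξ‖ ^ 2 / (1 + ‖ξ‖ ^ 2)) ≤ μ.re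
  -- the boundary is noncharacteristic
  noncharacteristic₁₁ : ∀ u ∈ S.Ustar, (S.An u).toBlocks₁₁.det ≠ 0
  noncharacteristic : ∀ u ∈ S.Uhyp, (S.An u).det ≠ 0
  -- boundary conditions: `p` is the number of positive eigenvalues of the `(1,1)` block of `Ā_d`
  card_pos : ∀ u ∈ S.Ustar, posEigenvalues ((S.A0 u)⁻¹ * S.An u).toBlocks₁₁ = p
  smooth_Upsilon1 : ContDiffOn ℝ ∞ S.Upsilon1 ((fun u i => u (Sum.inl i)) '' S.Ustar)
  smooth_Upsilon2 : ContDiffOn ℝ ∞ S.Upsilon2 ((fun u i => u (Sum.inr i)) '' S.Ustar)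
  smooth_K : ∀ a i j, ContDiffOn ℝ ∞ (fun u => S.K a u i j) S.Ustar
  rank_Upsilon1 : ∀ u ∈ S.Ustar, (jacobian S.Upsilon1 (fun i => u (Sum.inl i))).rank = p
  rank_Upsilon2 : ∀ u ∈ S.Ustar, (jacobian S.Upsilon2 (fun i => u (Sum.inr i))).rank = q
  rank_Kd : S.Kd.rank = r

/-- A profile: a smooth map from the closed half line to `𝒰*` which converges, with all its
derivatives, at an exponential rate to an end state `u∞ ∈ 𝒰`. -/
structure IsProfile (S : BVP n₁ n₂ m p q r) (w : ℝ → State n₁ n₂) (uinf : State n₁ n₂) :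
    Prop where
  smooth : ContDiffOn ℝ ∞ w (Set.Ici 0)
  mem_Ustar : ∀ z ≥ 0, w z ∈ S.Ustar
  end_mem : uinf ∈ S.Uhyp
  exp_conv : ∃ δ > 0, ∀ k : ℕ, ∃ C : ℝ, ∀ z ≥ 0,
    Real.exp (δ * z) * ‖iteratedDerivWithin k (fun s => w s - uinf) (Set.Ici 0) z‖ ≤ C

end BVP

/-- The coefficient matrix `𝒢` of the first-order system `∂_z U = 𝒢 U + F` for
`U = (u¹, u², ∂_z u²)` that is equivalent to `-b ∂_z² u + a ∂_z u + e u = f`, when only the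
`(2,2)` block of `b` is nonzero and `a¹¹`, `b²²` are invertible. -/
def firstOrder (b a e : Matrix (Fin n₁ ⊕ Fin n₂) (Fin n₁ ⊕ Fin n₂) ℂ) :
    Matrix (FOIdx n₁ n₂) (FOIdx n₁ n₂) ℂ :=
  Matrix.fromBlocks
    (Matrix.fromBlocks
      (-(a.toBlocks₁₁⁻¹ * e.toBlocks₁₁)) (-(a.toBlocks₁₁⁻¹ * e.toBlocks₁₂)) 0 0)
    (Matrix.fromRows (-(a.toBlocks₁₁⁻¹ * a.toBlocks₁₂)) 1)
    (Matrix.fromCols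
      (b.toBlocks₂₂⁻¹ * (e.toBlocks₂₁ - a.toBlocks₂₁ * a.toBlocks₁₁⁻¹ * e.toBlocks₁₁))
      (b.toBlocks₂₂⁻¹ * (e.toBlocks₂₂ - a.toBlocks₂₁ * a.toBlocks₁₁⁻¹ * e.toBlocks₁₂)))
    (b.toBlocks₂₂⁻¹ * (a.toBlocks₂₂ - a.toBlocks₂₁ * a.toBlocks₁₁⁻¹ * a.toBlocks₁₂))

namespace BVP

/-- The derivative `∂_z w` on the closed half line. -/
def dw (w : ℝ → State n₁ n₂) (z : ℝ) : State n₁ n₂ := derivWithin w (Set.Ici 0) z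

/-- The coefficient `𝒜(z, ζ)` of `∂_z u` in the Laplace-Fourier transform
`L = -B_{dd}(w) ∂_z² + 𝒜 ∂_z + ℳ` of the equations linearized at `w(x/ε)`. -/
def calA (S : BVP n₁ n₂ m p q r) (w : ℝ → State n₁ n₂) (z : ℝ) (ζ : Freq m) :
    Matrix (Fin n₁ ⊕ Fin n₂) (Fin n₁ ⊕ Fin n₂) ℂ :=
  cx (S.An (w z))
    - cx (dz (fun s => S.B (Fin.last m) (Fin.last m) (w s)) z)
    - cx (derivMul (S.B (Fin.last m) (Fin.last m)) (w z) (dw w z))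
    - ∑ j : Fin m, (Complex.I * (ζ.eta j : ℂ)) •
        cx (S.B j.castSucc (Fin.last m) (w z) + S.B (Fin.last m) j.castSucc (w z))

/-- The zero-order coefficient `ℳ(z, ζ)` of the same operator. -/
def calM (S : BVP n₁ n₂ m p q r) (w : ℝ → State n₁ n₂) (z : ℝ) (ζ : Freq m) :
    Matrix (Fin n₁ ⊕ Fin n₂) (Fin n₁ ⊕ Fin n₂) ℂ :=
  ((ζ.gamma : ℂ) + Complex.I * (ζ.tau : ℂ)) • cx (S.A0 (w z))
    + ∑ j : Fin m, (Complex.I * (ζ.eta j : ℂ)) • cx (S.A j.castSucc (w z))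
    + ∑ j : Fin m, ∑ k : Fin m,
        ((ζ.eta j : ℂ) * (ζ.eta k : ℂ)) • cx (S.B j.castSucc k.castSucc (w z))
    + cx (derivMul S.An (w z) (dw w z))
    - ∑ k : Fin m, (Complex.I * (ζ.eta k : ℂ)) •
        cx (dz (fun s => S.B (Fin.last m) k.castSucc (w s)) z)
    - ∑ j : Fin m, (Complex.I * (ζ.eta j : ℂ)) •
        cx (derivMul (S.B j.castSucc (Fin.last m)) (w z) (dw w z))
    - cx (dz (fun s => derivMul (S.B (Fin.last m) (Fin.last m)) (w s) (dw w s)) z)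

/-- The matrix `𝒢(z, ζ)` of the first-order system for `U = (u, ∂_z u²)`. -/
def calG (S : BVP n₁ n₂ m p q r) (w : ℝ → State n₁ n₂) (z : ℝ) (ζ : Freq m) :
    Matrix (FOIdx n₁ n₂) (FOIdx n₁ n₂) ℂ :=
  firstOrder (cx (S.B (Fin.last m) (Fin.last m) (w z))) (S.calA w z ζ) (S.calM w z ζ)

/-- The constant-coefficient matrix `G(u, ζ)`: the matrix of the first-order system for the
equations linearized at the constant state `u`. -/
def endG (S : BVP n₁ n₂ m p q r) (u : State n₁ n₂) (ζ : Freq m) :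
    Matrix (FOIdx n₁ n₂) (FOIdx n₁ n₂) ℂ :=
  firstOrder (cx (S.B (Fin.last m) (Fin.last m) u))
    (cx (S.An u) - ∑ j : Fin m, (Complex.I * (ζ.eta j : ℂ)) •
        cx (S.B j.castSucc (Fin.last m) u + S.B (Fin.last m) j.castSucc u))
    (((ζ.gamma : ℂ) + Complex.I * (ζ.tau : ℂ)) • cx (S.A0 u)
      + ∑ j : Fin m, (Complex.I * (ζ.eta j : ℂ)) • cx (S.A j.castSucc u)
      + ∑ j : Fin m, ∑ k : Fin m,
          ((ζ.eta j : ℂ) * (ζ.eta k : ℂ)) • cx (S.B j.castSucc k.castSucc u))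

/-- The linearized boundary operator `Γ(ζ)`:
`(u¹, u², u³) ↦ (Υ₁'(w¹(0)) u¹, Υ₂'(w²(0)) u², K_d u³ + ∑_j i η_j K_j(w(0)) u²)`. -/
def bdry (S : BVP n₁ n₂ m p q r) (w : ℝ → State n₁ n₂) (ζ : Freq m) :
    Matrix (BdIdx p q r) (FOIdx n₁ n₂) ℂ :=
  Matrix.fromBlocks
    (Matrix.fromCols (cx (jacobian S.Upsilon1 (fun i => w 0 (Sum.inl i)))) 0)
    0
    (Matrix.fromBlocks
      0 (cx (jacobian S.Upsilon2 (fun i => w 0 (Sum.inr i))))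
      0 (∑ j : Fin m, (Complex.I * (ζ.eta j : ℂ)) • cx (S.K j (w 0))))
    (Matrix.fromRows 0 (cx S.Kd))

end BVP

/-- The action of a complex matrix on complex Euclidean vectors. -/
def act {α β : Type*} [Fintype α] [DecidableEq α] [Fintype β] (M : Matrix β α ℂ) :
    EuclideanSpace ℂ α →ₗ[ℂ] EuclideanSpace ℂ β := Matrix.toEuclideanLin M

/-- The component `U¹` of `U = (U¹, U²)`. -/
def comp₁ {α β : Type*} (U : EuclideanSpace ℂ (α ⊕ β)) : EuclideanSpace ℂ α :=
  WithLp.toLp 2 (fun i => U (Sum.inl i))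

/-- The component `U²` of `U = (U¹, U²)`. -/
def comp₂ {α β : Type*} (U : EuclideanSpace ℂ (α ⊕ β)) : EuclideanSpace ℂ β :=
  WithLp.toLp 2 (fun i => U (Sum.inr i))

/-- Lebesgue measure on the half line. -/
def halfLine : MeasureTheory.Measure ℝ := MeasureTheory.volume.restrict (Set.Ioi 0)

/-- The `L²` norm on the half line. -/
def l2norm {α : Type*} [Fintype α] (f : ℝ → EuclideanSpace ℂ α) : ℝ :=
  (MeasureTheory.eLpNorm f 2 halfLine).toReal

/-- `U` is an `L²` solution of `∂_z U = M U + F` on the half line with `F ∈ L²` (hence `U ∈ H¹`,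
and `U` is continuous up to `z = 0`); the equation is written in integrated form. -/
structure IsL2Solution {α : Type*} [Fintype α] [DecidableEq α] (M : Matrix α α ℂ)
    (F U : ℝ → EuclideanSpace ℂ α) : Prop where
  memLp_source : MeasureTheory.MemLp F 2 halfLine
  memLp : MeasureTheory.MemLp U 2 halfLine
  eq : ∀ z ≥ 0, U z = U 0 + ∫ s in (0 : ℝ)..z, (act M (U s) + F s)

/-- `𝔼⁻(M)`: the invariant space associated with the spectrum of `M` in `{Re μ < 0}`. -/
def negSpace {α : Type*} [Fintype α] [DecidableEq α] (M : Matrix α α ℂ) :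
    Submodule ℂ (EuclideanSpace ℂ α) :=
  ⨆ (μ : ℂ) (_ : μ.re < 0), Module.End.maxGenEigenspace (act M) μ

open Classical in
/-- The projection onto `E` along `F` when `E ⊕ F` is the whole space (and `0` otherwise). -/
def projAlong {α : Type*} [Fintype α] (E F : Submodule ℂ (EuclideanSpace ℂ α)) :
    EuclideanSpace ℂ α →ₗ[ℂ] EuclideanSpace ℂ α :=
  if h : IsCompl E F then E.subtype ∘ₗ E.projectionOnto F h else 0

namespace BVP

/-- `U = (ẇ, ∂_z ẇ²)` solves the profile equation linearized at `w`, i.e. the first-order system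
at frequency `ζ = 0`. -/
def IsLayerSolution (S : BVP n₁ n₂ m p q r) (w : ℝ → State n₁ n₂)
    (U : ℝ → EuclideanSpace ℂ (FOIdx n₁ n₂)) : Prop :=
  ∀ z ≥ 0, HasDerivWithinAt U (act (S.calG w z 0) (U z)) (Set.Ici 0) z

/-- Transversality of the profile `w`: (i) no nontrivial solution `ẇ` of the linearized profile
equation tending to zero at infinity satisfies the homogeneous boundary conditions; (ii) the
boundary operator maps the space of bounded solutions `ẇ` onto `ℂ^{N_b}`. -/
structure IsTransversal (S : BVP n₁ n₂ m p q r) (w : ℝ → State n₁ n₂) : Prop where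
  injective : ∀ U, S.IsLayerSolution w U →
    Filter.Tendsto (fun z => comp₁ (U z)) Filter.atTop (nhds 0) →
    act (S.bdry w 0) (U 0) = 0 → ∀ z ≥ 0, U z = 0
  surjective : ∀ g : EuclideanSpace ℂ (BdIdx p q r), ∃ U, S.IsLayerSolution w U ∧
    (∃ C : ℝ, ∀ z ≥ 0, ‖comp₁ (U z)‖ ≤ C) ∧ act (S.bdry w 0) (U 0) = g

/-- `Φ(z, ζ)` is a smooth invertible matrix, defined for `z ≥ 0` and `ζ` near `0`, such that the
substitutions `U = Φ Ũ`, `F = Φ F̃` transform `∂_z U = 𝒢(z, ζ) U + F` into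
`∂_z Ũ = G(u∞, ζ) Ũ + F̃`, that is `∂_z Φ = 𝒢 Φ - Φ G`; moreover `Φ` and `Φ⁻¹` converge to the
identity at an exponential rate as `z → ∞`. -/
def IsConjugator (S : BVP n₁ n₂ m p q r) (w : ℝ → State n₁ n₂) (uinf : State n₁ n₂)
    (Φ : ℝ → Freq m → Matrix (FOIdx n₁ n₂) (FOIdx n₁ n₂) ℂ) : Prop :=
  ∃ ρ > 0,
    (∀ i j, ContDiffOn ℝ ∞ (fun x : ℝ × Freq m => Φ x.1 x.2 i j)
      (Set.Ici 0 ×ˢ Metric.ball 0 ρ)) ∧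
    (∀ z ≥ 0, ∀ ζ ∈ Metric.ball (0 : Freq m) ρ, (Φ z ζ).det ≠ 0) ∧
    (∀ z ≥ 0, ∀ ζ ∈ Metric.ball (0 : Freq m) ρ, ∀ i j,
      HasDerivWithinAt (fun s => Φ s ζ i j)
        ((S.calG w z ζ * Φ z ζ - Φ z ζ * S.endG uinf ζ) i j) (Set.Ici 0) z) ∧
    ∃ θ > 0, ∃ C : ℝ, ∀ z ≥ 0, ∀ ζ ∈ Metric.ball (0 : Freq m) ρ, ∀ i j,
      ‖(Φ z ζ - 1) i j‖ ≤ C * Real.exp (-(θ * z)) ∧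
      ‖((Φ z ζ)⁻¹ - 1) i j‖ ≤ C * Real.exp (-(θ * z))

/-- `V(ζ)` is a smooth invertible matrix, defined for `ζ` near `0`, such that
`V⁻¹ G(u∞, ζ) V` is block diagonal with blocks of size `N` and `N'`, and
`V(0)` is upper triangular with identity diagonal blocks. -/
def IsBlockReduction (S : BVP n₁ n₂ m p q r) (uinf : State n₁ n₂)
    (V : Freq m → Matrix (FOIdx n₁ n₂) (FOIdx n₁ n₂) ℂ) : Prop :=
  (∃ ρ > 0,
    (∀ i j, ContDiffOn ℝ ∞ (fun ζ => V ζ i j) (Metric.ball 0 ρ)) ∧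
    ∀ ζ ∈ Metric.ball (0 : Freq m) ρ, (V ζ).det ≠ 0 ∧
      ((V ζ)⁻¹ * S.endG uinf ζ * V ζ).toBlocks₁₂ = 0 ∧
      ((V ζ)⁻¹ * S.endG uinf ζ * V ζ).toBlocks₂₁ = 0) ∧
  ∃ W, V 0 = Matrix.fromBlocks 1 W 0 1

/-- The hyperbolic block `H(u∞, ζ)` of `V⁻¹ G V`. -/
def blockH (S : BVP n₁ n₂ m p q r) (uinf : State n₁ n₂)
    (V : Freq m → Matrix (FOIdx n₁ n₂) (FOIdx n₁ n₂) ℂ) (ζ : Freq m) :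
    Matrix (Fin n₁ ⊕ Fin n₂) (Fin n₁ ⊕ Fin n₂) ℂ :=
  ((V ζ)⁻¹ * S.endG uinf ζ * V ζ).toBlocks₁₁

/-- The parabolic block `P(u∞, ζ)` of `V⁻¹ G V`. -/
def blockP (S : BVP n₁ n₂ m p q r) (uinf : State n₁ n₂)
    (V : Freq m → Matrix (FOIdx n₁ n₂) (FOIdx n₁ n₂) ℂ) (ζ : Freq m) :
    Matrix (Fin n₂) (Fin n₂) ℂ :=
  ((V ζ)⁻¹ * S.endG uinf ζ * V ζ).toBlocks₂₂

/-- The boundary operator `Γ̃(ζ) = Γ(ζ) Φ(0, ζ)` of the constant-coefficient problem. -/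
def bdryTilde (S : BVP n₁ n₂ m p q r) (w : ℝ → State n₁ n₂)
    (Φ : ℝ → Freq m → Matrix (FOIdx n₁ n₂) (FOIdx n₁ n₂) ℂ) (ζ : Freq m) :
    Matrix (BdIdx p q r) (FOIdx n₁ n₂) ℂ :=
  S.bdry w ζ * Φ 0 ζ

/-- `Γ_H(ζ)`, the restriction of `Γ̃ V` to `ℂ^N × {0}`. -/
def bdryH (S : BVP n₁ n₂ m p q r) (w : ℝ → State n₁ n₂)
    (Φ : ℝ → Freq m → Matrix (FOIdx n₁ n₂) (FOIdx n₁ n₂) ℂ)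
    (V : Freq m → Matrix (FOIdx n₁ n₂) (FOIdx n₁ n₂) ℂ) (ζ : Freq m) :
    Matrix (BdIdx p q r) (Fin n₁ ⊕ Fin n₂) ℂ :=
  (S.bdryTilde w Φ ζ * V ζ).toCols₁

/-- `Γ_P(ζ)`, the restriction of `Γ̃ V` to `{0} × ℂ^{N'}`. -/
def bdryP (S : BVP n₁ n₂ m p q r) (w : ℝ → State n₁ n₂)
    (Φ : ℝ → Freq m → Matrix (FOIdx n₁ n₂) (FOIdx n₁ n₂) ℂ)
    (V : Freq m → Matrix (FOIdx n₁ n₂) (FOIdx n₁ n₂) ℂ) (ζ : Freq m) :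
    Matrix (BdIdx p q r) (Fin n₂) ℂ :=
  (S.bdryTilde w Φ ζ * V ζ).toCols₂

/-- `𝔽_P(ζ) = Γ_P(ζ) 𝔼⁻(P(u∞, ζ))`. -/
def spaceFP (S : BVP n₁ n₂ m p q r) (w : ℝ → State n₁ n₂) (uinf : State n₁ n₂)
    (Φ : ℝ → Freq m → Matrix (FOIdx n₁ n₂) (FOIdx n₁ n₂) ℂ)
    (V : Freq m → Matrix (FOIdx n₁ n₂) (FOIdx n₁ n₂) ℂ) (ζ : Freq m) :
    Submodule ℂ (EuclideanSpace ℂ (BdIdx p q r)) :=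
  (negSpace (S.blockP uinf V ζ)).map (act (S.bdryP w Φ V ζ))

/-- The reduced boundary operator `Γ_red(ζ) = π_H(ζ) Γ_H(ζ)`, where `π_H(ζ)` is the projection
onto `𝔽_H` along `𝔽_P(ζ)`. -/
def bdryRed (S : BVP n₁ n₂ m p q r) (w : ℝ → State n₁ n₂) (uinf : State n₁ n₂)
    (Φ : ℝ → Freq m → Matrix (FOIdx n₁ n₂) (FOIdx n₁ n₂) ℂ)
    (V : Freq m → Matrix (FOIdx n₁ n₂) (FOIdx n₁ n₂) ℂ)
    (FH : Submodule ℂ (EuclideanSpace ℂ (BdIdx p q r))) (ζ : Freq m) :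
    EuclideanSpace ℂ (Fin n₁ ⊕ Fin n₂) →ₗ[ℂ] EuclideanSpace ℂ (BdIdx p q r) :=
  projAlong FH (S.spaceFP w uinf Φ V ζ) ∘ₗ act (S.bdryH w Φ V ζ)

/-- The low-frequency weight `φ = (γ + |ζ|²)^{1/2}`. -/
def weight (ζ : Freq m) : ℝ := Real.sqrt (ζ.gamma + ‖ζ‖ ^ 2)

/-- The maximal estimates, for low frequencies, for the constant-coefficient problem
`∂_z Ũ = G(u∞, ζ) Ũ + F̃`, `Γ̃(ζ) Ũ(0) = g`. -/
def MaximalEstimates (S : BVP n₁ n₂ m p q r) (w : ℝ → State n₁ n₂) (uinf : State n₁ n₂)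
    (Φ : ℝ → Freq m → Matrix (FOIdx n₁ n₂) (FOIdx n₁ n₂) ℂ) : Prop :=
  ∃ C > 0, ∃ ρ₀ > 0, ∀ ζ : Freq m, 0 ≤ ζ.gamma → 0 < ‖ζ‖ → ‖ζ‖ ≤ ρ₀ →
    ∀ (F U : ℝ → EuclideanSpace ℂ (FOIdx n₁ n₂)) (g : EuclideanSpace ℂ (BdIdx p q r)),
      IsL2Solution (S.endG uinf ζ) F U → act (S.bdryTilde w Φ ζ) (U 0) = g →
      weight ζ * l2norm (fun z => comp₁ (U z)) + l2norm (fun z => comp₂ (U z)) + ‖U 0‖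
        ≤ C * ((weight ζ)⁻¹ * l2norm F + ‖g‖)

/-- The maximal estimates for the reduced problem in polar coordinates `ζ = ρ ζ̌`, `|ζ̌| = 1`:
`∂_z u = Ȟ(u∞, ζ̌, ρ) u + f`, `Γ_red(ρ ζ̌) u(0) = h`, where `H(u∞, ρ ζ̌) = ρ Ȟ(u∞, ζ̌, ρ)`. -/
def ReducedMaximalEstimates (S : BVP n₁ n₂ m p q r) (w : ℝ → State n₁ n₂)
    (uinf : State n₁ n₂)
    (Φ : ℝ → Freq m → Matrix (FOIdx n₁ n₂) (FOIdx n₁ n₂) ℂ)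
    (V : Freq m → Matrix (FOIdx n₁ n₂) (FOIdx n₁ n₂) ℂ)
    (FH : Submodule ℂ (EuclideanSpace ℂ (BdIdx p q r))) : Prop :=
  ∃ C > 0, ∃ ρ₀ > 0, ∀ ζ : Freq m, ‖ζ‖ = 1 → 0 ≤ ζ.gamma → ∀ ρ : ℝ, 0 < ρ → ρ ≤ ρ₀ →
    ∀ (f u : ℝ → EuclideanSpace ℂ (Fin n₁ ⊕ Fin n₂)) (h : EuclideanSpace ℂ (BdIdx p q r)),
      IsL2Solution ((ρ⁻¹ : ℂ) • S.blockH uinf V (ρ • ζ)) f u →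
      S.bdryRed w uinf Φ V FH (ρ • ζ) (u 0) = h →
      Real.sqrt (ζ.gamma + ρ) * l2norm u + ‖u 0‖
        ≤ C * ((Real.sqrt (ζ.gamma + ρ))⁻¹ * l2norm f + ‖h‖)

end BVP

end ViscousBoundary

end

open scoped ContDiff
open Filter Topology Set
set_option linter.unusedSectionVars false

noncomputable section

/-! Both existence claims are perturbation theory around ζ = 0. A conjugator is sought as Φ = 1 + Ψ
with Ψ exponentially decaying. Then Ψ solves a linear equation whose principal part is the
commutator with G(u∞, 0) and whose perturbation is small far from the boundary, because the profile
converges exponentially. A Green operator on the line (`exists_green`) turns this into a fixed point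
problem that contracts at ζ = 0, hence is solvable smoothly in ζ nearby (`exists_conjugator_aux`).
Since Φ tends to 1, uniqueness for linear ODEs makes Φ invertible at every z.

At ζ = 0 the matrix G is block upper triangular with diagonal blocks 0 and `endP`. The block `endP`
has no imaginary eigenvalue (`BVP.Admissible.noImagEigenvalue_endP`): an eigenvalue iξ with ξ ≠ 0
would give a kernel of iĀ + B̄ at the normal frequency ξ, against dissipativity, and the eigenvalue
0 would make A_d singular. The spectra of the two blocks are therefore separated, and the inverse
function theorem block diagonalizes every nearby matrix, depending smoothly on it
(`exists_analytic_blockDiagonalization`).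

For the equivalence, the coordinates given by V decouple the system into an equation with matrix H
and one with matrix P, tied together only by the boundary condition Γ_H u_H(0) + Γ_P u_P(0) = g. The
P equation is harmless. A Lyapunov symmetrizer of P(0) is still a symmetrizer of P(ζ) for small ζ,
which gives uniform L² estimates and shows that u_P(0) lies in 𝔼⁻(P(ζ)) up to an error bounded by
the source (`exists_boundary_estimate`). Transversality, transported by the conjugator, says that
Γ_P(0) is injective on 𝔼⁻(P(0)) (`BVP.injective_bdryP`), and this persists quantitatively.
Projecting along 𝔽_P(ζ) thus eliminates u_P, and u_P is recovered from the boundary condition; this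
compares the full and the reduced estimates in both directions (`BoundaryEstimate.full_of_reduced`,
`BoundaryEstimate.reduced_of_full`).

Two points concern the weights. Returning from (u_H, u_P) to (Ũ¹, Ũ²) mixes components that carry
the different weights φ and 1; since V(0) is upper triangular, the dangerous block of V and of V⁻¹
is O(|ζ|), and |ζ| ≤ φ. Finally φ(ρζ̌) = (γ̌ + ρ)^{1/2} ρ^{1/2}, and the factor ρ^{1/2} is exactly
what the change of variable ž = ρz absorbs (`ReducedEstimate.scale`). -/

namespace ViscousBoundary

/-! ### Exponential dichotomies of constant coefficient systems. -/

section Dichotomy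

variable {E : Type*} [NormedAddCommGroup E] [NormedSpace ℂ E]

/-- The flow `e^{tL}` of a bounded operator. -/
def flow (L : E →L[ℂ] E) (t : ℝ) : E →L[ℂ] E := NormedSpace.exp (t • L)

/-- The invariant space associated with the spectrum in `{Re μ < 0}`. -/
def specNeg (L : E →ₗ[ℂ] E) : Submodule ℂ E :=
  ⨆ (μ : ℂ) (_ : μ.re < 0), Module.End.maxGenEigenspace L μ

theorem flow_zero (L : E →L[ℂ] E) : flow L 0 = 1 := by simp [flow]

variable [CompleteSpace E]

theorem hasDerivAt_flow (L : E →L[ℂ] E) (t : ℝ) : HasDerivAt (flow L) (flow L t * L) t := by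
  exact hasDerivAt_exp_smul_const (𝕂 := ℝ) L t

theorem hasDerivAt_flow' (L : E →L[ℂ] E) (t : ℝ) : HasDerivAt (flow L) (L * flow L t) t := by
  exact hasDerivAt_exp_smul_const' (𝕂 := ℝ) L t

theorem flow_commute (L : E →L[ℂ] E) (t : ℝ) : Commute L (flow L t) := by
  have h1 := hasDerivAt_flow L t
  have h2 := hasDerivAt_flow' L t
  exact h2.unique h1

theorem flow_add (L : E →L[ℂ] E) (s t : ℝ) : flow L (s + t) = flow L s * flow L t := by
  let _ : NormedAlgebra ℚ (E →L[ℂ] E) := NormedAlgebra.restrictScalars ℚ ℝ (E →L[ℂ] E)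
  simp only [flow, add_smul]
  exact NormedSpace.exp_add_of_commute (((Commute.refl L).smul_left s).smul_right t)

theorem flow_neg_op (L : E →L[ℂ] E) (t : ℝ) : flow (-L) t = flow L (-t) := by
  simp [flow]

theorem continuous_flow (L : E →L[ℂ] E) : Continuous (flow L) :=
  continuous_iff_continuousAt.2 fun t => (hasDerivAt_flow L t).continuousAt

theorem hasDerivAt_flow_apply (L : E →L[ℂ] E) (v : E) (t : ℝ) :
    HasDerivAt (fun t => flow L t v) (L (flow L t v)) t := by
  have := (hasDerivAt_flow' L t)
  have h2 := ((ContinuousLinearMap.apply ℂ E v).restrictScalars ℝ).hasFDerivAt.comp_hasDerivAt t this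
  exact h2

/-- On generalized eigenvectors the flow grows at most like a polynomial times `e^{t Re μ}`. -/
theorem exists_norm_flow_apply_le (L : E →L[ℂ] E) (μ : ℂ) (k : ℕ) (v : E)
    (hv : (((L : E →ₗ[ℂ] E) - algebraMap ℂ (Module.End ℂ E) μ) ^ k) v = 0) :
    ∃ C, 0 ≤ C ∧ ∀ t ≥ (0 : ℝ), ‖flow L t v‖ ≤ C * (1 + t) ^ k * Real.exp (t * μ.re) := by
  induction k generalizing v with
  | zero =>
    refine ⟨0, le_rfl, fun t _ => ?_⟩
    have : v = 0 := by simpa using hv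
    simp [this]
  | succ k ih =>
    obtain ⟨C, hC, hb⟩ := ih (L v - μ • v) (by
      rw [pow_succ] at hv
      simpa [Module.algebraMap_end_apply] using hv)
    refine ⟨‖v‖ + C, by positivity, fun t ht => ?_⟩
    -- Removing the factor e^{sμ} leaves a curve whose derivative is the same curve built on (L -
    -- μ)v, to which the induction hypothesis applies. The mean value inequality then costs one
    -- power of 1 + t.
    set x : ℝ → E := fun s : ℝ => Complex.exp (-(s * μ)) • flow L s v with hx
    have hder : ∀ s : ℝ, HasDerivAt x (Complex.exp (-(s * μ)) • flow L s (L v - μ • v)) s := by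
      intro s
      have h1 : HasDerivAt (fun s : ℝ => Complex.exp (-(s * μ)))
          (Complex.exp (-(s * μ)) * -(1 * μ)) s :=
        (((Complex.ofRealCLM.hasDerivAt (x := s)).mul_const μ).neg).cexp
      have h2 := hasDerivAt_flow_apply L v s
      have h3 := h1.smul h2
      have hc : L (flow L s v) = flow L s (L v) := by
        have := congrArg (fun T => T v) (flow_commute L s).eq
        simpa using this
      convert! h3 using 1
      rw [hc, map_sub, map_smul, smul_sub, smul_smul]
      rw [sub_eq_add_neg, ← neg_smul]
      ring_nf
    have hn : ∀ s : ℝ, ‖Complex.exp (-(s * μ))‖ = Real.exp (-(s * μ.re)) := by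
      intro s; simp [Complex.norm_exp]
    have hbd : ∀ s ∈ Ico (0 : ℝ) t,
        ‖Complex.exp (-(s * μ)) • flow L s (L v - μ • v)‖ ≤ C * (1 + t) ^ k := by
      intro s hs
      rw [norm_smul, hn]
      calc _ ≤ Real.exp (-(s * μ.re)) * (C * (1 + s) ^ k * Real.exp (s * μ.re)) := by
            gcongr; exact hb s hs.1
        _ = C * (1 + s) ^ k := by
            rw [mul_comm, mul_assoc, ← Real.exp_add]; simp
        _ ≤ _ := by
            have := hs.1
            have := hs.2.le
            gcongr
    have hmv := norm_image_sub_le_of_norm_deriv_le_segment'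
      (fun s hs => (hder s).hasDerivWithinAt) hbd t (right_mem_Icc.2 ht)
    have hx0 : x 0 = v := by simp [hx, flow_zero]
    have hxt : ‖x t‖ = Real.exp (-(t * μ.re)) * ‖flow L t v‖ := by rw [hx, norm_smul, hn]
    have h4 : ‖x t‖ ≤ (‖v‖ + C) * (1 + t) ^ (k + 1) := by
      have : ‖x t‖ ≤ ‖x 0‖ + ‖x t - x 0‖ := by
        have := norm_add_le (x 0) (x t - x 0)
        simpa using this
      rw [hx0] at this hmv
      have h5 : (1 : ℝ) ≤ (1 + t) ^ (k + 1) := one_le_pow₀ (by linarith)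
      calc ‖x t‖ ≤ ‖v‖ + C * (1 + t) ^ k * (t - 0) := by linarith
        _ ≤ ‖v‖ * (1 + t) ^ (k + 1) + C * (1 + t) ^ k * (1 + t) := by
            gcongr
            · exact le_mul_of_one_le_right (norm_nonneg _) h5
            · linarith
        _ = _ := by ring
    calc ‖flow L t v‖ = ‖x t‖ * Real.exp (t * μ.re) := by
          rw [hxt, mul_comm, ← mul_assoc, ← Real.exp_add]; simp
      _ ≤ _ := by gcongr

/-- One term of the exponential series at κ(1 + t) dominates the power, so half of the rate 2κ pays
for the polynomial. -/
theorem exists_pow_mul_exp_le (k : ℕ) {κ : ℝ} (hκ : 0 < κ) :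
    ∃ C, 0 ≤ C ∧ ∀ t ≥ (0 : ℝ), (1 + t) ^ k * Real.exp (-(2 * κ * t)) ≤ C * Real.exp (-(κ * t)) := by
  refine ⟨k.factorial / κ ^ k * Real.exp κ, by positivity, fun t ht => ?_⟩
  have h := Real.pow_div_factorial_le_exp (κ * (1 + t)) (by positivity) k
  have h2 : (1 + t) ^ k ≤ k.factorial / κ ^ k * Real.exp (κ * (1 + t)) := by
    rw [mul_pow, div_le_iff₀ (by positivity)] at h
    rw [div_mul_eq_mul_div, le_div_iff₀ (by positivity)]
    linarith
  calc _ ≤ k.factorial / κ ^ k * Real.exp (κ * (1 + t)) * Real.exp (-(2 * κ * t)) := by gcongr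
    _ = _ := by
      rw [mul_assoc (_ / _), mul_assoc (_ / _) (Real.exp κ), ← Real.exp_add, ← Real.exp_add]
      congr 2
      ring

/-- The operators `Q` for which `e^{tL} Q` decays exponentially. -/
def decaying (L : E →L[ℂ] E) {F : Type*} [NormedAddCommGroup F] [NormedSpace ℂ F] :
    Submodule ℂ (F →L[ℂ] E) where
  carrier := {Q | ∃ κ > 0, ∃ C, 0 ≤ C ∧ ∀ t ≥ (0 : ℝ), ‖(flow L t).comp Q‖ ≤ C * Real.exp (-(κ * t))}
  zero_mem' := ⟨1, one_pos, 0, le_rfl, fun t _ => by simp⟩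
  add_mem' := by
    rintro Q R ⟨κ, hκ, C, hC, h⟩ ⟨κ', hκ', C', hC', h'⟩
    refine ⟨min κ κ', lt_min hκ hκ', C + C', by positivity, fun t ht => ?_⟩
    rw [ContinuousLinearMap.comp_add]
    calc _ ≤ _ := norm_add_le _ _
      _ ≤ C * Real.exp (-(κ * t)) + C' * Real.exp (-(κ' * t)) := add_le_add (h t ht) (h' t ht)
      _ ≤ C * Real.exp (-(min κ κ' * t)) + C' * Real.exp (-(min κ κ' * t)) := by
        gcongr
        · exact min_le_left _ _
        · exact min_le_right _ _
      _ = _ := by ring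
  smul_mem' := by
    rintro c Q ⟨κ, hκ, C, hC, h⟩
    refine ⟨κ, hκ, ‖c‖ * C, by positivity, fun t ht => ?_⟩
    rw [ContinuousLinearMap.comp_smul, norm_smul, mul_assoc]
    gcongr
    exact h t ht

theorem mem_decaying_comp {L : E →L[ℂ] E} {F G : Type*} [NormedAddCommGroup F] [NormedSpace ℂ F]
    [NormedAddCommGroup G] [NormedSpace ℂ G] {Q : F →L[ℂ] E} (hQ : Q ∈ decaying L)
    (R : G →L[ℂ] F) : Q.comp R ∈ decaying L := by
  obtain ⟨κ, hκ, C, hC, h⟩ := hQ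
  refine ⟨κ, hκ, C * ‖R‖, by positivity, fun t ht => ?_⟩
  rw [← ContinuousLinearMap.comp_assoc]
  calc _ ≤ ‖(flow L t).comp Q‖ * ‖R‖ := ContinuousLinearMap.opNorm_comp_le _ _
    _ ≤ C * Real.exp (-(κ * t)) * ‖R‖ := by gcongr; exact h t ht
    _ = _ := by ring

/-- The vector `v`, regarded as an operator `ℂ → E`. -/
abbrev vec (v : E) : ℂ →L[ℂ] E := ContinuousLinearMap.toSpanSingleton ℂ v

/-- Because `decaying L` is a submodule, one generalized eigenspace can be treated at a time; the
submodule structure reconciles the different rates. On the eigenspace of μ, half of the rate |Re μ|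
absorbs the polynomial factor. -/
theorem vec_mem_decaying {L : E →L[ℂ] E} {v : E} (hv : v ∈ specNeg (L : E →ₗ[ℂ] E)) :
    vec v ∈ decaying L := by
  have key : specNeg (L : E →ₗ[ℂ] E) ≤
      (decaying L).comap (ContinuousLinearMap.toSpanSingletonLE ℂ ℂ E).toLinearMap := by
    refine iSup₂_le fun μ hμ v hv => ?_
    rw [Module.End.mem_maxGenEigenspace] at hv
    obtain ⟨k, hk⟩ := hv
    obtain ⟨C, hC, hb⟩ := exists_norm_flow_apply_le L μ k v (by
      exact hk)
    have hκ : 0 < -μ.re / 2 := by linarith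
    obtain ⟨C', hC', hb'⟩ := exists_pow_mul_exp_le k hκ
    refine ⟨-μ.re / 2, hκ, C * C', by positivity, fun t ht => ?_⟩
    have : (flow L t).comp (ContinuousLinearMap.toSpanSingleton ℂ v)
        = ContinuousLinearMap.toSpanSingleton ℂ (flow L t v) := by
      ext; simp
    change ‖(flow L t).comp (ContinuousLinearMap.toSpanSingleton ℂ v)‖ ≤ _
    rw [this, ContinuousLinearMap.norm_toSpanSingleton]
    calc _ ≤ C * (1 + t) ^ k * Real.exp (t * μ.re) := hb t ht
      _ = C * ((1 + t) ^ k * Real.exp (-(2 * (-μ.re / 2) * t))) := by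
        rw [mul_assoc]; ring_nf
      _ ≤ C * (C' * Real.exp (-(-μ.re / 2 * t))) :=
        mul_le_mul_of_nonneg_left (hb' t ht) hC
      _ = _ := by ring
  exact key hv

theorem exists_norm_flow_le_of_mem_specNeg {L : E →L[ℂ] E} {v : E}
    (hv : v ∈ specNeg (L : E →ₗ[ℂ] E)) :
    ∃ κ > 0, ∃ C, 0 ≤ C ∧ ∀ t ≥ (0 : ℝ), ‖flow L t v‖ ≤ C * Real.exp (-(κ * t)) := by
  obtain ⟨κ, hκ, C, hC, h⟩ := vec_mem_decaying hv
  refine ⟨κ, hκ, C, hC, fun t ht => ?_⟩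
  have : (flow L t).comp (vec v) = ContinuousLinearMap.toSpanSingleton ℂ (flow L t v) := by
    ext; simp
  have h2 := h t ht
  rwa [this, ContinuousLinearMap.norm_toSpanSingleton] at h2

/-- In finite dimension Q is a finite sum of rank one operators, which upgrades decay of each
trajectory to decay in operator norm. -/
theorem mem_decaying_of_range_le [FiniteDimensional ℂ E] {L Q : E →L[ℂ] E}
    (hQ : ∀ v, Q v ∈ specNeg (L : E →ₗ[ℂ] E)) : Q ∈ decaying L := by
  let b := Module.finBasis ℂ E
  have : Q = ∑ i, (vec (Q (b i))).comp (LinearMap.toContinuousLinearMap (b.coord i)) := by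
    ext v
    conv_lhs => rw [← b.sum_repr v, map_sum]
    simp
  rw [this]
  exact Submodule.sum_mem _ fun i _ => mem_decaying_comp (vec_mem_decaying (hQ _)) _

theorem maxGenEigenspace_neg (L : E →ₗ[ℂ] E) (μ : ℂ) :
    Module.End.maxGenEigenspace (-L) μ = Module.End.maxGenEigenspace L (-μ) := by
  ext v
  simp only [Module.End.mem_maxGenEigenspace]
  refine exists_congr fun k => ?_
  have : (-L - μ • (1 : Module.End ℂ E)) = -(L - (-μ) • (1 : Module.End ℂ E)) := by
    rw [neg_smul]; abel
  rw [this]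
  rcases Nat.even_or_odd k with h | h
  · rw [h.neg_pow]
  · rw [h.neg_pow, LinearMap.neg_apply, neg_eq_zero]

/-- This identifies `specNeg (-L)` as the unstable space of L, so that one definition serves for
both halves of the dichotomy. -/
theorem specNeg_neg (L : E →ₗ[ℂ] E) :
    specNeg (-L) = ⨆ (μ : ℂ) (_ : 0 < μ.re), Module.End.maxGenEigenspace L μ := by
  apply le_antisymm
  · refine iSup₂_le fun μ hμ => ?_
    rw [maxGenEigenspace_neg]
    exact le_iSup₂_of_le (-μ) (by simpa using hμ) le_rfl
  · refine iSup₂_le fun μ hμ => ?_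
    refine le_iSup₂_of_le (-μ) (by simpa using hμ) ?_
    rw [maxGenEigenspace_neg, neg_neg]

theorem mapsTo_specNeg (L : E →ₗ[ℂ] E) {v : E} (hv : v ∈ specNeg L) : L v ∈ specNeg L := by
  have : specNeg L ≤ (specNeg L).comap L := by
    refine iSup₂_le fun μ hμ v hv => ?_
    refine (le_iSup₂_of_le (f := fun (μ : ℂ) (_ : μ.re < 0) => Module.End.maxGenEigenspace L μ)
      μ hμ le_rfl) ?_
    exact Module.End.mapsTo_maxGenEigenspace_of_comm (Commute.refl L) μ hv
  exact this hv

theorem disjoint_specNeg (L : E →ₗ[ℂ] E) : Disjoint (specNeg L) (specNeg (-L)) := by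
  rw [specNeg_neg]
  have := iSupIndep.disjoint_biSup_biSup (Module.End.independent_maxGenEigenspace L)
    (s := {μ : ℂ | μ.re < 0}) (t := {μ : ℂ | 0 < μ.re}) (by
      rw [Set.disjoint_left]; intro μ h1 h2; simp at h1 h2; linarith)
  exact this

/-- `L` has no purely imaginary eigenvalue. -/
def NoImagEigenvalue (L : E →ₗ[ℂ] E) : Prop := ∀ μ : ℂ, μ.re = 0 → ∀ v, L v = μ • v → v = 0

/-- Over ℂ the generalized eigenspaces span, and those with Re μ = 0 are trivial by hypothesis. -/
theorem isCompl_specNeg [FiniteDimensional ℂ E] {L : E →ₗ[ℂ] E} (hL : NoImagEigenvalue L) :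
    IsCompl (specNeg L) (specNeg (-L)) := by
  refine ⟨disjoint_specNeg L, codisjoint_iff.2 ?_⟩
  rw [eq_top_iff, ← Module.End.iSup_maxGenEigenspace_eq_top L]
  refine iSup_le fun μ => ?_
  rcases lt_trichotomy μ.re 0 with h | h | h
  · exact le_sup_of_le_left (le_iSup₂_of_le μ h le_rfl)
  · have hno : ¬ Module.End.HasEigenvalue L μ := by
      intro he
      obtain ⟨v, hv⟩ := he.exists_hasEigenvector
      exact hv.2 (hL μ h v hv.apply_eq_smul)
    have : Module.End.maxGenEigenspace L μ = ⊥ := by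
      by_contra hne
      apply hno
      have : Module.End.HasUnifEigenvalue L μ ⊤ := hne
      exact this.lt zero_lt_one
    simp [this]
  · rw [specNeg_neg]
    exact le_sup_of_le_right (le_iSup₂_of_le μ h le_rfl)

/-- The projection onto `specNeg L` along `specNeg (-L)`. -/
structure IsDichotomy (L Pm Pp : E →L[ℂ] E) : Prop where
  add : Pm + Pp = 1
  comm_neg : Commute L Pm
  comm_pos : Commute L Pp
  mem_neg : ∀ v, Pm v ∈ specNeg (L : E →ₗ[ℂ] E)
  mem_pos : ∀ v, Pp v ∈ specNeg (-L : E →ₗ[ℂ] E)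
  apply_neg : ∀ v ∈ specNeg (L : E →ₗ[ℂ] E), Pm v = v
  apply_pos : ∀ v ∈ specNeg (-L : E →ₗ[ℂ] E), Pm v = 0
  decay : ∃ κ > 0, ∃ C, 0 ≤ C ∧ ∀ t ≥ (0 : ℝ),
    ‖flow L t * Pm‖ ≤ C * Real.exp (-(κ * t)) ∧ ‖flow L (-t) * Pp‖ ≤ C * Real.exp (-(κ * t))

theorem exists_isDichotomy [FiniteDimensional ℂ E] {L : E →L[ℂ] E}
    (hL : NoImagEigenvalue (L : E →ₗ[ℂ] E)) : ∃ Pm Pp, IsDichotomy L Pm Pp := by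
  have hc := isCompl_specNeg hL
  let Pm : E →L[ℂ] E := LinearMap.toContinuousLinearMap (Submodule.projection _ _ hc)
  have hmn : ∀ v, Pm v ∈ specNeg (L : E →ₗ[ℂ] E) := fun v =>
    Submodule.projection_apply_mem hc v
  have han : ∀ v ∈ specNeg (L : E →ₗ[ℂ] E), Pm v = v := fun v hv =>
    Submodule.projection_apply_left hc ⟨v, hv⟩
  have hap : ∀ v ∈ specNeg (-L : E →ₗ[ℂ] E), Pm v = 0 := fun v hv =>
    (Submodule.projection_apply_eq_zero_iff hc).2 hv
  have hmp : ∀ v, (1 - Pm) v ∈ specNeg (-L : E →ₗ[ℂ] E) := fun v => by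
    rw [← Submodule.projection_apply_eq_zero_iff hc]
    change Pm (v - Pm v) = 0
    rw [map_sub, han _ (hmn v), sub_self]
  have hcomm : Commute L Pm := by
    ext v
    have hv : v = Pm v + (1 - Pm) v := by simp
    have h1 : Pm (L (Pm v)) = L (Pm v) := han _ (mapsTo_specNeg _ (hmn v))
    have h2 : Pm (L ((1 - Pm) v)) = 0 := by
      apply hap
      have := mapsTo_specNeg _ (hmp v)
      simpa using neg_mem this
    calc (L * Pm) v = Pm (L (Pm v)) := by rw [h1]; rfl
      _ = Pm (L (Pm v)) + Pm (L ((1 - Pm) v)) := by rw [h2, add_zero]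
      _ = Pm (L (Pm v + (1 - Pm) v)) := by rw [map_add, map_add]
      _ = (Pm * L) v := by rw [← hv]; rfl
  refine ⟨Pm, 1 - Pm, by simp, hcomm, (Commute.one_right L).sub_right hcomm, hmn, hmp, han, hap, ?_⟩
  obtain ⟨κ, hκ, C, hC, h⟩ := mem_decaying_of_range_le hmn
  -- Backward decay on the unstable space is forward decay for -L.
  obtain ⟨κ', hκ', C', hC', h'⟩ := mem_decaying_of_range_le (L := -L) (Q := 1 - Pm) (by simpa using hmp)
  refine ⟨min κ κ', lt_min hκ hκ', max C C', le_max_of_le_left hC, fun t ht => ⟨?_, ?_⟩⟩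
  · refine (h t ht).trans ?_
    gcongr
    · exact le_max_left _ _
    · exact min_le_left _ _
  · rw [← flow_neg_op]
    refine (h' t ht).trans ?_
    gcongr
    · exact le_max_right _ _
    · exact min_le_right _ _

end Dichotomy

/-! ### A Green operator on the line in a weighted sup norm. -/

section Green

open MeasureTheory BoundedContinuousFunction

/-- The kernel e^{-l|t - s|} has mass at most 1/l on either side of t. Both signs of t are needed,
since the Green operator integrates from 0 in both directions. -/
theorem norm_intervalIntegral_le_of_exp {E : Type*} [NormedAddCommGroup E] [NormedSpace ℝ E]
    {g : ℝ → E} {M l t : ℝ} (hM : 0 ≤ M) (hl : 0 < l)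
    (hg : ∀ s ∈ Set.uIoc 0 t, ‖g s‖ ≤ M * Real.exp (-(l * |t - s|))) :
    ‖∫ s in (0 : ℝ)..t, g s‖ ≤ M / l := by
  rcases le_total 0 t with ht | ht
  · have h1 : ∫ s in (0 : ℝ)..t, M * Real.exp (-(l * (t - s))) = M / l * (1 - Real.exp (-(l * t))) := by
      have hd : ∀ s ∈ Set.uIcc 0 t, HasDerivAt (fun s => M / l * Real.exp (-(l * (t - s))))
          (M * Real.exp (-(l * (t - s)))) s := by
        intro s _
        have := (((((hasDerivAt_id s).const_sub t).const_mul l).neg).exp).const_mul (M / l)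
        convert! this using 1
        simp only [id_eq, Pi.neg_apply]
        field_simp
      rw [intervalIntegral.integral_eq_sub_of_hasDerivAt hd (by
        apply Continuous.intervalIntegrable; fun_prop)]
      simp; ring
    refine (intervalIntegral.norm_integral_le_of_norm_le ht (g := fun s => M * Real.exp (-(l * (t - s))))
      (Eventually.of_forall fun s hs => ?_)
      (by apply Continuous.intervalIntegrable; fun_prop)).trans ?_
    · have := hg s (by rwa [Set.uIoc_of_le ht])
      rwa [abs_of_nonneg (by linarith [hs.2])] at this
    · rw [h1]
      have := Real.exp_pos (-(l * t))
      have : 0 ≤ M / l := by positivity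
      nlinarith
  · have h1 : ∫ s in t..0, M * Real.exp (-(l * (s - t))) = M / l * (1 - Real.exp (l * t)) := by
      have hd : ∀ s ∈ Set.uIcc t 0, HasDerivAt (fun s => -(M / l) * Real.exp (-(l * (s - t))))
          (M * Real.exp (-(l * (s - t)))) s := by
        intro s _
        have := (((((hasDerivAt_id s).sub_const t).const_mul l).neg).exp).const_mul (-(M / l))
        convert! this using 1
        simp only [id_eq, Pi.neg_apply]
        field_simp
      rw [intervalIntegral.integral_eq_sub_of_hasDerivAt hd (by
        apply Continuous.intervalIntegrable; fun_prop)]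
      simp; ring
    rw [intervalIntegral.integral_symm, norm_neg]
    refine (intervalIntegral.norm_integral_le_of_norm_le ht (g := fun s => M * Real.exp (-(l * (s - t))))
      (Eventually.of_forall fun s hs => ?_)
      (by apply Continuous.intervalIntegrable; fun_prop)).trans ?_
    · have := hg s (by rwa [Set.uIoc_of_ge ht])
      rwa [abs_of_nonpos (by linarith [hs.1]), neg_sub] at this
    · rw [h1]
      have := Real.exp_pos (l * t)
      have : 0 ≤ M / l := by positivity
      nlinarith

theorem integrableOn_exp_sub (l t : ℝ) (hl : 0 < l) :
    IntegrableOn (fun s => Real.exp (-(l * (s - t)))) (Set.Ioi t) := by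
  have := (integrableOn_exp_mul_Ioi (a := -l) (by linarith) t).const_mul (Real.exp (l * t))
  refine this.congr (Eventually.of_forall fun s => ?_)
  simp only [← Real.exp_add]
  ring_nf

theorem integral_exp_sub (l t : ℝ) (hl : 0 < l) :
    ∫ s in Set.Ioi t, Real.exp (-(l * (s - t))) = 1 / l := by
  have h : ∀ s, Real.exp (-(l * (s - t))) = Real.exp (l * t) * Real.exp (-l * s) := by
    intro s; rw [← Real.exp_add]; ring_nf
  simp_rw [h]
  rw [integral_const_mul, integral_exp_mul_Ioi (by linarith)]
  rw [neg_div_neg_eq, mul_div_assoc', ← Real.exp_add]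
  simp

variable {E : Type*} [NormedAddCommGroup E] [NormedSpace ℂ E] [CompleteSpace E]

theorem norm_flow_apply_le (L : E →L[ℂ] E) (t : ℝ) (v : E) :
    ‖flow L t v‖ ≤ Real.exp (‖L‖ * |t|) * ‖v‖ := by
  wlog ht : 0 ≤ t generalizing t L
  · have := this (-L) (-t) (by linarith)
    rwa [flow_neg_op, neg_neg, norm_neg, abs_neg] at this
  have := norm_le_gronwallBound_of_norm_deriv_right_le (f := fun t => flow L t v)
    (f' := fun t => L (flow L t v)) (δ := ‖v‖) (K := ‖L‖) (ε := 0) (a := 0) (b := t)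
    (fun s _ => (hasDerivAt_flow_apply L v s).continuousAt.continuousWithinAt)
    (fun s _ => (hasDerivAt_flow_apply L v s).hasDerivWithinAt)
    (by simp [flow_zero]) (fun s _ => by simpa using L.le_opNorm _) t (right_mem_Icc.2 ht)
  rw [gronwallBound_ε0] at this
  rw [abs_of_nonneg ht, mul_comm]
  simpa using this

theorem flow_apply_flow_neg (L : E →L[ℂ] E) (t s : ℝ) (v : E) :
    flow L t (flow L (-s) v) = flow L (t - s) v := by
  rw [sub_eq_add_neg, flow_add]; rfl

/-- A Green operator for `u' = L u + f` on the line: it is bounded in a weighted sup norm, the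
forcing on the negative half line contributes with an arbitrarily small constant. -/
theorem exists_green [FiniteDimensional ℂ E] {L : E →L[ℂ] E}
    (hL : NoImagEigenvalue (L : E →ₗ[ℂ] E)) :
    ∃ a : ℝ, 0 < a ∧ ∀ b : ℝ, 0 < b → ∃ μ > 0, ∃ K : (ℝ →ᵇ E) →L[ℝ] (ℝ →ᵇ E),
      (∀ f t, HasDerivAt (fun t => Real.exp (-(μ * min t 0)) • K f t)
        (L (Real.exp (-(μ * min t 0)) • K f t) + Real.exp (-(μ * min t 0)) • f t) t) ∧
      ∀ f : ℝ →ᵇ E, ∀ M₁ M₂ : ℝ, (∀ t ≥ 0, ‖f t‖ ≤ M₁) → (∀ t, ‖f t‖ ≤ M₂) →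
        ‖K f‖ ≤ a * M₁ + b * M₂ := by
  obtain ⟨Pm, Pp, hP⟩ := exists_isDichotomy hL
  obtain ⟨κ, hκ, C, hC, hdec⟩ := hP.decay
  refine ⟨3 * ((C + 1) / κ), by positivity, fun b hb => ?_⟩
  -- For negative times only the crude bound e^{‖L‖|t|} on the flow is used. A weight growing at
  -- rate ‖L‖ + 1/b leaves the net rate 1/b, whose kernel has mass at most b: this is the
  -- arbitrarily small constant.
  set μ : ℝ := ‖L‖ + 1 / b with hμ
  have hμ0 : 0 < μ := by positivity
  set W : ℝ → ℝ := fun s => Real.exp (-(μ * min s 0)) with hW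
  have hWc : Continuous W := by fun_prop
  have hWpos : ∀ s, 0 < W s := fun s => Real.exp_pos _
  have hW1 : ∀ s ≥ 0, W s = 1 := fun s hs => by simp [hW, min_eq_right hs]
  have hfl := continuous_flow L
  have hm : ∀ (s : ℝ), 0 ≤ s → ∀ v, ‖flow L s (Pm v)‖ ≤ C * Real.exp (-(κ * s)) * ‖v‖ :=
    fun s hs v => ((flow L s * Pm).le_opNorm v).trans (by gcongr; exact (hdec s hs).1)
  have hp : ∀ (s : ℝ), 0 ≤ s → ∀ v, ‖flow L (-s) (Pp v)‖ ≤ C * Real.exp (-(κ * s)) * ‖v‖ :=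
    fun s hs v => ((flow L (-s) * Pp).le_opNorm v).trans (by gcongr; exact (hdec s hs).2)
  have hPpc : ∀ f : ℝ →ᵇ E, Continuous fun s => flow L (-s) (Pp (f s)) := fun f =>
    (hfl.comp continuous_neg).clm_apply (Pp.continuous.comp f.continuous)
  have hint : ∀ f : ℝ →ᵇ E, ∀ t ≥ (0 : ℝ),
      IntegrableOn (fun s => flow L (-s) (Pp (f s))) (Set.Ioi t) := by
    intro f t ht
    have h1 := (integrableOn_exp_sub κ 0 hκ).const_mul (C * ‖f‖)
    have h2 : IntegrableOn (fun s => flow L (-s) (Pp (f s))) (Set.Ioi 0) := by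
      refine Integrable.mono' h1 ((hPpc f).aestronglyMeasurable) ?_
      refine (ae_restrict_iff' measurableSet_Ioi).2 (Eventually.of_forall fun s hs => ?_)
      refine (hp s (le_of_lt hs) (f s)).trans ?_
      rw [sub_zero, mul_right_comm]
      gcongr
      exact f.norm_coe_le_norm s
    exact h2.mono_set (Set.Ioi_subset_Ioi ht)
  -- The initial value -c f cancels the growing part of the solution: for t ≥ 0 its unstable
  -- component becomes minus the integral over (t, ∞), which is bounded.
  set c : (ℝ →ᵇ E) → E := fun f => ∫ s in Set.Ioi (0 : ℝ), flow L (-s) (Pp (f s)) with hc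
  set q : (ℝ →ᵇ E) → ℝ → E := fun f s => flow L (-s) (W s • f s) with hq
  have hqc : ∀ f, Continuous (q f) := fun f =>
    (hfl.comp continuous_neg).clm_apply (hWc.smul f.continuous)
  set u : (ℝ →ᵇ E) → ℝ → E := fun f t => flow L t ((∫ s in (0 : ℝ)..t, q f s) - c f) with hu
  have hder : ∀ f t, HasDerivAt (u f) (L (u f t) + W t • f t) t := by
    intro f t
    have h1 := hasDerivAt_flow' L t
    have h2 : HasDerivAt (fun t => (∫ s in (0 : ℝ)..t, q f s) - c f) (q f t) t :=
      ((hqc f).integral_hasStrictDerivAt 0 t).hasDerivAt.sub_const _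
    have h1' : HasDerivAt (fun t => (flow L t).restrictScalars ℝ)
        ((L * flow L t).restrictScalars ℝ) t := by
      exact ((ContinuousLinearMap.restrictScalarsL ℂ E E ℝ ℝ).hasFDerivAt.comp_hasDerivAt t h1)
    have h3 := h1'.clm_apply h2
    convert! h3 using 1
    simp only [hq, ContinuousLinearMap.coe_restrictScalars', hu]
    rw [flow_apply_flow_neg, sub_self, flow_zero]
    rfl
  have hcb : ∀ (f : ℝ →ᵇ E) (M₁ : ℝ), (∀ t ≥ 0, ‖f t‖ ≤ M₁) → ∀ t ≥ (0 : ℝ),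
      ‖flow L t (∫ s in Set.Ioi t, flow L (-s) (Pp (f s)))‖ ≤ C / κ * M₁ := by
    intro f M₁ h1 t ht
    rw [← ContinuousLinearMap.integral_comp_comm _ (hint f t ht)]
    refine (norm_integral_le_of_norm_le ((integrableOn_exp_sub κ t hκ).const_mul (C * M₁)) ?_).trans ?_
    · refine (ae_restrict_iff' measurableSet_Ioi).2 (Eventually.of_forall fun s hs => ?_)
      rw [flow_apply_flow_neg, ← neg_sub]
      have hs' : t < s := hs
      refine (hp (s - t) (by linarith) (f s)).trans ?_
      rw [mul_right_comm]
      gcongr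
      exact h1 s (by linarith)
    · rw [integral_const_mul, integral_exp_sub _ _ hκ]
      apply le_of_eq; ring
  have hbound : ∀ (f : ℝ →ᵇ E) (M₁ M₂ : ℝ), (∀ t ≥ 0, ‖f t‖ ≤ M₁) → (∀ t, ‖f t‖ ≤ M₂) →
      ∀ t, ‖(W t)⁻¹ • u f t‖ ≤ 3 * ((C + 1) / κ) * M₁ + b * M₂ := by
    intro f M₁ M₂ h1 h2 t
    have hM1 : 0 ≤ M₁ := (norm_nonneg _).trans (h1 0 le_rfl)
    have hM2 : 0 ≤ M₂ := (norm_nonneg _).trans (h2 0)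
    have hCκ : C / κ * M₁ ≤ (C + 1) / κ * M₁ := by gcongr; linarith
    have hCκ0 : 0 ≤ (C + 1) / κ * M₁ := by positivity
    -- For t ≥ 0 the weight is 1, the dichotomy splits the solution into two convergent integrals,
    -- and only values of f on [0, ∞) enter, whence M₁ alone. For t ≤ 0 the flow is not split; the
    -- weight beats its growth, and M₁ enters only through c f.
    rcases le_total 0 t with ht | ht
    · rw [hW1 t ht, inv_one, one_smul]
      have hqi : IntervalIntegrable (fun s => flow L (-s) (Pm (f s))) volume 0 t :=
        ((hfl.comp continuous_neg).clm_apply (Pm.continuous.comp f.continuous)).intervalIntegrable _ _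
      have hpi : IntervalIntegrable (fun s => flow L (-s) (Pp (f s))) volume 0 t :=
        (hPpc f).intervalIntegrable _ _
      have e1 : ∫ s in (0 : ℝ)..t, q f s = (∫ s in (0 : ℝ)..t, flow L (-s) (Pm (f s)))
          + ∫ s in (0 : ℝ)..t, flow L (-s) (Pp (f s)) := by
        rw [← intervalIntegral.integral_add hqi hpi]
        refine intervalIntegral.integral_congr fun s hs => ?_
        rw [Set.uIcc_of_le ht] at hs
        have h3 : Pm (f s) + Pp (f s) = f s := by
          have := congrArg (fun T => T (f s)) hP.add
          simpa using this
        simp only [hq]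
        rw [hW1 s hs.1, one_smul, ← map_add, h3]
      have e2 : c f = (∫ s in (0 : ℝ)..t, flow L (-s) (Pp (f s)))
          + ∫ s in Set.Ioi t, flow L (-s) (Pp (f s)) :=
        (intervalIntegral.integral_interval_add_Ioi (hint f 0 le_rfl) (hint f t ht)).symm
      have e3 : u f t = flow L t (∫ s in (0 : ℝ)..t, flow L (-s) (Pm (f s)))
          - flow L t (∫ s in Set.Ioi t, flow L (-s) (Pp (f s))) := by
        simp only [hu]
        rw [e1, e2, ← map_sub]
        congr 1; abel
      have b1 : ‖flow L t (∫ s in (0 : ℝ)..t, flow L (-s) (Pm (f s)))‖ ≤ C * M₁ / κ := by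
        rw [← ContinuousLinearMap.intervalIntegral_comp_comm _ hqi]
        refine norm_intervalIntegral_le_of_exp (by positivity) hκ fun s hs => ?_
        rw [Set.uIoc_of_le ht] at hs
        rw [flow_apply_flow_neg, abs_of_nonneg (by linarith [hs.2])]
        refine (hm (t - s) (by linarith [hs.2]) (f s)).trans ?_
        rw [mul_right_comm]
        gcongr
        exact h1 s hs.1.le
      rw [e3]
      refine (norm_sub_le _ _).trans ?_
      have b2 := hcb f M₁ h1 t ht
      have : 0 ≤ b * M₂ := by positivity
      have : C * M₁ / κ = C / κ * M₁ := by ring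
      linarith
    · have hWt : (W t)⁻¹ = Real.exp (-(μ * |t|)) := by
        simp only [hW, min_eq_left ht, ← Real.exp_neg, abs_of_nonpos ht]; ring_nf
      have e3 : u f t = (∫ s in (0 : ℝ)..t, flow L t (q f s)) - flow L t (c f) := by
        simp only [hu]
        rw [map_sub, ContinuousLinearMap.intervalIntegral_comp_comm _
          ((hqc f).intervalIntegrable _ _)]
      rw [e3, smul_sub, ← intervalIntegral.integral_smul]
      have b1 : ‖∫ s in (0 : ℝ)..t, (W t)⁻¹ • flow L t (q f s)‖ ≤ M₂ / (1 / b) := by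
        refine norm_intervalIntegral_le_of_exp hM2 (by positivity) fun s hs => ?_
        rw [Set.uIoc_of_ge ht] at hs
        rw [norm_smul, hWt, Real.norm_of_nonneg (Real.exp_pos _).le]
        simp only [hq]
        rw [flow_apply_flow_neg]
        calc _ ≤ Real.exp (-(μ * |t|)) * (Real.exp (‖L‖ * |t - s|) * ‖W s • f s‖) := by
              gcongr; exact norm_flow_apply_le _ _ _
          _ ≤ Real.exp (-(μ * |t|)) * (Real.exp (‖L‖ * |t - s|) * (W s * M₂)) := by
              rw [norm_smul, Real.norm_of_nonneg (hWpos s).le]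
              have := hWpos s
              gcongr
              exact h2 s
          _ = M₂ * (Real.exp (-(μ * |t|)) * (Real.exp (‖L‖ * |t - s|) * W s)) := by ring
          _ = _ := by
              congr 1
              simp only [hW, min_eq_left hs.2, ← Real.exp_add]
              congr 1
              rw [abs_of_nonpos ht, abs_of_nonpos (by linarith [hs.1] : t - s ≤ 0), hμ]
              ring
      have b2 : ‖(W t)⁻¹ • flow L t (c f)‖ ≤ C / κ * M₁ := by
        have h0 := hcb f M₁ h1 0 le_rfl
        rw [flow_zero] at h0
        rw [norm_smul, hWt, Real.norm_of_nonneg (Real.exp_pos _).le]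
        calc _ ≤ Real.exp (-(μ * |t|)) * (Real.exp (‖L‖ * |t|) * ‖c f‖) := by
              gcongr; exact norm_flow_apply_le _ _ _
          _ = Real.exp (-(1 / b * |t|)) * ‖c f‖ := by
              rw [← mul_assoc, ← Real.exp_add, hμ]; ring_nf
          _ ≤ 1 * ‖c f‖ := by
              gcongr
              rw [Real.exp_le_one_iff]
              have : 0 ≤ 1 / b * |t| := by positivity
              linarith
          _ ≤ _ := by simpa using h0
      refine (norm_sub_le _ _).trans ?_
      have : M₂ / (1 / b) = b * M₂ := by field_simp
      linarith
  have hvc : ∀ f, Continuous fun t => (W t)⁻¹ • u f t := fun f =>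
    (hWc.inv₀ fun t => (hWpos t).ne').smul
      (continuous_iff_continuousAt.2 fun t => (hder f t).continuousAt)
  have hunif : ∀ f : ℝ →ᵇ E, ∀ t, ‖(W t)⁻¹ • u f t‖ ≤ (3 * ((C + 1) / κ) + b) * ‖f‖ := fun f t => by
    have := hbound f ‖f‖ ‖f‖ (fun t _ => f.norm_coe_le_norm t) (fun t => f.norm_coe_le_norm t) t
    linarith
  have cadd : ∀ f g, c (f + g) = c f + c g := fun f g => by
    simp only [hc, BoundedContinuousFunction.coe_add, Pi.add_apply, map_add]
    exact integral_add (hint f 0 le_rfl) (hint g 0 le_rfl)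
  have csmul : ∀ (r : ℝ) f, c (r • f) = r • c f := fun r f => by
    simp only [hc, ← integral_smul]
    refine integral_congr_ae (Eventually.of_forall fun s => ?_)
    simp [ContinuousLinearMap.map_smul_of_tower]
  have uadd : ∀ f g t, u (f + g) t = u f t + u g t := fun f g t => by
    simp only [hu, ← map_add]
    congr 1
    have : (∫ s in (0 : ℝ)..t, q (f + g) s) = (∫ s in (0 : ℝ)..t, q f s) + ∫ s in (0 : ℝ)..t, q g s := by
      rw [← intervalIntegral.integral_add ((hqc f).intervalIntegrable _ _)
        ((hqc g).intervalIntegrable _ _)]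
      simp [hq]
    rw [this, cadd]; abel
  have usmul : ∀ (r : ℝ) f t, u (r • f) t = r • u f t := fun r f t => by
    have : (∫ s in (0 : ℝ)..t, q (r • f) s) = r • (∫ s in (0 : ℝ)..t, q f s) := by
      rw [← intervalIntegral.integral_smul]
      refine intervalIntegral.integral_congr fun s _ => ?_
      simp only [hq, BoundedContinuousFunction.coe_smul]
      rw [smul_comm, ContinuousLinearMap.map_smul_of_tower]
    simp only [hu]
    rw [this, csmul, ← smul_sub, ContinuousLinearMap.map_smul_of_tower]
  let K : (ℝ →ᵇ E) →L[ℝ] (ℝ →ᵇ E) := LinearMap.mkContinuous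
    { toFun := fun f => BoundedContinuousFunction.ofNormedAddCommGroup
        (fun t => (W t)⁻¹ • u f t) (hvc f) _ (hunif f)
      map_add' := fun f g => by
        ext t; simp [uadd]
      map_smul' := fun r f => by
        ext t
        simp only [BoundedContinuousFunction.coe_ofNormedAddCommGroup, usmul,
          BoundedContinuousFunction.coe_smul, RingHom.id_apply]
        rw [smul_comm] }
    (3 * ((C + 1) / κ) + b) (fun f => by
      refine BoundedContinuousFunction.norm_ofNormedAddCommGroup_le _ (by positivity) (hunif f))
  have hKu : ∀ f t, W t • K f t = u f t := fun f t => by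
    change W t • ((W t)⁻¹ • u f t) = u f t
    rw [smul_inv_smul₀ (hWpos t).ne']
  refine ⟨μ, hμ0, K, fun f t => ?_, fun f M₁ M₂ h1 h2 => ?_⟩
  · have : (fun t => W t • K f t) = u f := funext (hKu f)
    change HasDerivAt (fun t => W t • K f t) (L (W t • K f t) + W t • f t) t
    rw [this, hKu]
    exact hder f t
  · have hM1 : 0 ≤ M₁ := (norm_nonneg _).trans (h1 0 le_rfl)
    have hM2 : 0 ≤ M₂ := (norm_nonneg _).trans (h2 0)
    rw [BoundedContinuousFunction.norm_le (by positivity)]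
    exact hbound f M₁ M₂ h1 h2

end Green

/-! ### From smoothness in a function space to joint smoothness in (z, ζ). -/

section JointSmoothness

open MeasureTheory BoundedContinuousFunction

variable {V : Type*} [NormedAddCommGroup V] [NormedSpace ℝ V] [CompleteSpace V]
variable {F : Type*} [NormedAddCommGroup F] [NormedSpace ℝ F]
variable {R : ℝ}

/-- The extension to the line of a function on `[0, R]`. -/
abbrev extendI (hR : 0 ≤ R) (f : (Icc (0 : ℝ) R →ᵇ V)) : ℝ → V := Set.IccExtend hR f

theorem continuous_extendI (hR : 0 ≤ R) (f : (Icc (0 : ℝ) R →ᵇ V)) : Continuous (extendI hR f) :=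
  f.continuous.Icc_extend'

theorem norm_extendI_le (hR : 0 ≤ R) (f : (Icc (0 : ℝ) R →ᵇ V)) (s : ℝ) : ‖extendI hR f s‖ ≤ ‖f‖ :=
  f.norm_coe_le_norm _

/-- The primitive `f ↦ ∫₀ᶻ f`, as an operator depending on `z`. -/
def primOp (hR : 0 ≤ R) (z : ℝ) : (Icc (0 : ℝ) R →ᵇ V) →L[ℝ] V :=
  LinearMap.mkContinuous
    { toFun := fun f => ∫ s in (0 : ℝ)..z, extendI hR f s
      map_add' := fun f g => by
        rw [← intervalIntegral.integral_add ((continuous_extendI hR f).intervalIntegrable _ _)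
          ((continuous_extendI hR g).intervalIntegrable _ _)]
        rfl
      map_smul' := fun c f => by
        rw [RingHom.id_apply, ← intervalIntegral.integral_smul]
        rfl } |z| (fun f => by
      have := intervalIntegral.norm_integral_le_of_norm_le_const (a := 0) (b := z)
        (fun s _ => norm_extendI_le hR f s)
      rw [sub_zero, mul_comm] at this
      exact this)

theorem primOp_apply (hR : 0 ≤ R) (z : ℝ) (f : (Icc (0 : ℝ) R →ᵇ V)) :
    primOp hR z f = ∫ s in (0 : ℝ)..z, extendI hR f s := rfl

/-- Integration up to z depends on z in a Lipschitz way for the operator norm. Point evaluation at z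
does not, which is why families are evaluated through their primitives. -/
theorem continuous_primOp (hR : 0 ≤ R) : Continuous (primOp (V := V) hR) := by
  refine (LipschitzWith.of_dist_le_mul (f := primOp (V := V) hR) (K := 1) fun z z' => ?_).continuous
  rw [NNReal.coe_one, one_mul, Real.dist_eq, dist_eq_norm]
  refine ContinuousLinearMap.opNorm_le_bound _ (abs_nonneg _) fun f => ?_
  rw [_root_.sub_apply, primOp_apply, primOp_apply,
    intervalIntegral.integral_interval_sub_left ((continuous_extendI hR f).intervalIntegrable _ _)
      ((continuous_extendI hR f).intervalIntegrable _ _), mul_comm]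
  exact intervalIntegral.norm_integral_le_of_norm_le_const (fun s _ => norm_extendI_le hR f s)

/-- Iterated primitives. -/
def iterPrim (hR : 0 ≤ R) : ℕ → ℝ → ((Icc (0 : ℝ) R →ᵇ V) →L[ℝ] V)
  | 0 => primOp hR
  | n + 1 => fun z => ∫ s in (0 : ℝ)..z, iterPrim hR n s

/-- Each further integration in z gains one derivative of the operator-valued map. -/
theorem contDiff_iterPrim (hR : 0 ≤ R) (n : ℕ) : ContDiff ℝ n (iterPrim (V := V) hR n) := by
  induction n with
  | zero => exact contDiff_zero.2 (continuous_primOp hR)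
  | succ n ih =>
    have hd : ∀ z, HasDerivAt (iterPrim (V := V) hR (n + 1)) (iterPrim hR n z) z := fun z =>
      (ih.continuous.integral_hasStrictDerivAt 0 z).hasDerivAt
    rw [Nat.cast_succ, contDiff_succ_iff_deriv]
    refine ⟨fun z => (hd z).differentiableAt, by simp, ?_⟩
    have : deriv (iterPrim (V := V) hR (n + 1)) = iterPrim hR n := by
      ext1 z
      exact HasDerivAt.deriv (F := (Icc (0 : ℝ) R →ᵇ V) →L[ℝ] V) (hd z)
    rwa [this]

theorem iterPrim_succ_apply (hR : 0 ≤ R) (n : ℕ) (z : ℝ) (f : (Icc (0 : ℝ) R →ᵇ V)) :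
    iterPrim hR (n + 1) z f = ∫ s in (0 : ℝ)..z, iterPrim hR n s f :=
  ContinuousLinearMap.intervalIntegral_apply
    ((contDiff_iterPrim hR n).continuous.intervalIntegrable _ _) f

/-- `c' ζ` is the derivative of `c ζ` on `[0, R]`, for all `ζ ∈ O`. -/
def IsDerivFamily (hR : 0 ≤ R) (O : Set F) (c c' : F → (Icc (0 : ℝ) R →ᵇ V)) : Prop :=
  ∀ ζ ∈ O, ∀ z ∈ Icc 0 R,
    HasDerivWithinAt (extendI hR (c ζ)) (extendI hR (c' ζ) z) (Icc 0 R) z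

/-- Families smooth in the parameter together with `n` derivatives in `z`. -/
def RegFamily (hR : 0 ≤ R) (O : Set F) : ℕ → (F → (Icc (0 : ℝ) R →ᵇ V)) → Prop
  | 0, c => ContDiffOn ℝ ∞ c O
  | n + 1, c => ContDiffOn ℝ ∞ c O ∧ ∃ c', RegFamily hR O n c' ∧ IsDerivFamily hR O c c'

theorem RegFamily.contDiffOn {hR : 0 ≤ R} {O : Set F} {n : ℕ} {c : F → (Icc (0 : ℝ) R →ᵇ V)}
    (h : RegFamily hR O n c) : ContDiffOn ℝ ∞ c O := by
  cases n with
  | zero => exact h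
  | succ n => exact h.1

theorem IsDerivFamily.eq_add_integral {hR : 0 ≤ R} {O : Set F} {c c' : F → (Icc (0 : ℝ) R →ᵇ V)}
    (h : IsDerivFamily hR O c c') {ζ : F} (hζ : ζ ∈ O) {z : ℝ} (hz : z ∈ Icc 0 R) :
    extendI hR (c ζ) z = extendI hR (c ζ) 0 + primOp hR z (c' ζ) := by
  rw [primOp_apply, intervalIntegral.integral_eq_sub_of_hasDeriv_right_of_le hz.1
    (f := extendI hR (c ζ)) (continuous_extendI hR _).continuousOn (fun s hs => ?_)
    ((continuous_extendI hR _).intervalIntegrable _ _)]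
  · abel
  · have hs' : s ∈ Ico 0 R := ⟨hs.1.le, hs.2.trans_le hz.2⟩
    exact ((h ζ hζ s ⟨hs'.1, hs'.2.le⟩).mono_of_mem_nhdsWithin
      (mem_of_superset (Icc_mem_nhdsGT hs'.2) (Icc_subset_Icc_left hs'.1)))

/-- Integrating c(z) = c(0) + ∫₀ᶻ c' repeatedly trades one z-derivative of the family for one more
primitive, up to an explicit monomial in z. -/
theorem iterPrim_taylor {hR : 0 ≤ R} {O : Set F} {c c' : F → (Icc (0 : ℝ) R →ᵇ V)}
    (h : IsDerivFamily hR O c c') {ζ : F} (hζ : ζ ∈ O) (j : ℕ) {z : ℝ} (hz : z ∈ Icc 0 R) :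
    iterPrim hR j z (c ζ) = (z ^ (j + 1) / (j + 1).factorial) • extendI hR (c ζ) 0
      + iterPrim hR (j + 1) z (c' ζ) := by
  induction j generalizing z with
  | zero =>
    have h1 : iterPrim hR 0 z (c ζ) = ∫ s in (0 : ℝ)..z, (extendI hR (c ζ) 0 + primOp hR s (c' ζ)) := by
      refine intervalIntegral.integral_congr fun s hs => ?_
      rw [uIcc_of_le hz.1] at hs
      exact h.eq_add_integral hζ ⟨hs.1, hs.2.trans hz.2⟩
    rw [h1, intervalIntegral.integral_add (by simp)
      (((continuous_primOp hR).clm_apply continuous_const).intervalIntegrable _ _),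
      iterPrim_succ_apply]
    simp [iterPrim]
  | succ j ih =>
    have h1 : iterPrim hR (j + 1) z (c ζ) = ∫ s in (0 : ℝ)..z,
        ((s ^ (j + 1) / (j + 1).factorial) • extendI hR (c ζ) 0 + iterPrim hR (j + 1) s (c' ζ)) := by
      rw [iterPrim_succ_apply]
      refine intervalIntegral.integral_congr fun s hs => ?_
      rw [uIcc_of_le hz.1] at hs
      exact ih ⟨hs.1, hs.2.trans hz.2⟩
    rw [h1, intervalIntegral.integral_add (by apply Continuous.intervalIntegrable; fun_prop)
      (((contDiff_iterPrim hR (j + 1)).continuous.clm_apply continuous_const).intervalIntegrable _ _),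
      ← iterPrim_succ_apply, intervalIntegral.integral_smul_const,
      intervalIntegral.integral_div, integral_pow]
    congr 2
    rw [Nat.factorial_succ (j + 1)]
    push_cast
    field_simp
    simp

theorem contDiffOn_extendI_zero {hR : 0 ≤ R} {O : Set F} {c : F → (Icc (0 : ℝ) R →ᵇ V)}
    (h : ContDiffOn ℝ ∞ c O) : ContDiffOn ℝ ∞ (fun ζ => extendI hR (c ζ) 0) O := by
  let T : (Icc (0 : ℝ) R →ᵇ V) →L[ℝ] V := BoundedContinuousFunction.evalCLM ℝ (Set.projIcc 0 R hR 0)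
  have : ContDiffOn ℝ ∞ (T ∘ c) O := T.contDiff.comp_contDiffOn h
  exact this

/-- The order j + n is invariant under the trade of `iterPrim_taylor`: each of the n derivatives of
c is converted into one more primitive. In the end a C^{j+n} operator family is applied to a family
smooth in ζ. -/
theorem RegFamily.contDiffOn_iterPrim {hR : 0 ≤ R} {O : Set F} {n : ℕ}
    {c : F → (Icc (0 : ℝ) R →ᵇ V)} (h : RegFamily hR O n c) (j : ℕ) :
    ContDiffOn ℝ ((j + n : ℕ) : WithTop ℕ∞) (fun x : ℝ × F => iterPrim hR j x.1 (c x.2))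
      (Icc 0 R ×ˢ O) := by
  induction n generalizing c j with
  | zero =>
    refine ContDiffOn.clm_apply ?_ ?_
    · exact ((contDiff_iterPrim hR j).comp contDiff_fst).contDiffOn
    · refine (h.contDiffOn.of_le (by exact_mod_cast le_top)).comp contDiff_snd.contDiffOn
        fun x hx => hx.2
  | succ n ih =>
    obtain ⟨h0, c', hc', hd⟩ := h
    have e : ∀ x ∈ Icc 0 R ×ˢ O, iterPrim hR j x.1 (c x.2)
        = (x.1 ^ (j + 1) / (j + 1).factorial) • extendI hR (c x.2) 0
          + iterPrim hR (j + 1) x.1 (c' x.2) := fun x hx => iterPrim_taylor hd hx.2 j hx.1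
    refine ContDiffOn.congr ?_ e
    have h2 := ih hc' (j + 1)
    rw [show j + 1 + n = j + (n + 1) by ring] at h2
    refine ContDiffOn.add (ContDiffOn.smul ?_ ?_) h2
    · exact ContDiff.contDiffOn (by fun_prop)
    · have : ContDiffOn ℝ ∞ (fun ζ => extendI hR (c ζ) 0) O :=
        contDiffOn_extendI_zero h0
      exact (this.of_le (by exact_mod_cast le_top)).comp contDiff_snd.contDiffOn fun x hx => hx.2

/-- A family with derivatives of all orders in `z` is jointly smooth. -/
theorem contDiffOn_of_regFamily {hR : 0 ≤ R} {O : Set F} {c : F → (Icc (0 : ℝ) R →ᵇ V)}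
    (h : ∀ n, RegFamily hR O n c) :
    ContDiffOn ℝ ∞ (fun x : ℝ × F => extendI hR (c x.2) x.1) (Icc 0 R ×ˢ O) := by
  rw [contDiffOn_infty]
  intro n
  -- One derivative is spent on writing c as c(0) plus a primitive, so regularity n + 1 is invoked
  -- to get joint smoothness of order n.
  obtain ⟨h0, c', hc', hd⟩ := h (n + 1)
  refine ContDiffOn.congr ?_ (fun x hx => hd.eq_add_integral hx.2 hx.1)
  refine ContDiffOn.add ?_ ?_
  · have : ContDiffOn ℝ ∞ (fun ζ => extendI hR (c ζ) 0) O :=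
      contDiffOn_extendI_zero h0
    exact (this.of_le (by exact_mod_cast le_top)).comp contDiff_snd.contDiffOn fun x hx => hx.2
  · have := hc'.contDiffOn_iterPrim 0
    rwa [zero_add] at this

theorem RegFamily.mono {hR : 0 ≤ R} {O : Set F} {n : ℕ} {c : F → (Icc (0 : ℝ) R →ᵇ V)}
    (h : RegFamily hR O (n + 1) c) : RegFamily hR O n c := by
  induction n generalizing c with
  | zero => exact h.1
  | succ n ih =>
    obtain ⟨h0, c', hc', hd⟩ := h
    exact ⟨h0, c', ih hc', hd⟩

theorem RegFamily.add {hR : 0 ≤ R} {O : Set F} {n : ℕ} {c d : F → (Icc (0 : ℝ) R →ᵇ V)}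
    (hc : RegFamily hR O n c) (hd : RegFamily hR O n d) :
    RegFamily hR O n (fun ζ => c ζ + d ζ) := by
  induction n generalizing c d with
  | zero => exact ContDiffOn.add hc hd
  | succ n ih =>
    obtain ⟨h0, c', hc', hcd⟩ := hc
    obtain ⟨k0, d', hd', hdd⟩ := hd
    exact ⟨h0.add k0, _, ih hc' hd', fun ζ hζ z hz => (hcd ζ hζ z hz).add (hdd ζ hζ z hz)⟩

theorem RegFamily.neg {hR : 0 ≤ R} {O : Set F} {n : ℕ} {c : F → (Icc (0 : ℝ) R →ᵇ V)}
    (hc : RegFamily hR O n c) : RegFamily hR O n (fun ζ => -c ζ) := by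
  induction n generalizing c with
  | zero => exact ContDiffOn.neg hc
  | succ n ih =>
    obtain ⟨h0, c', hc', hcd⟩ := hc
    exact ⟨h0.neg, _, ih hc', fun ζ hζ z hz => (hcd ζ hζ z hz).neg⟩

theorem RegFamily.sub {hR : 0 ≤ R} {O : Set F} {n : ℕ} {c d : F → (Icc (0 : ℝ) R →ᵇ V)}
    (hc : RegFamily hR O n c) (hd : RegFamily hR O n d) :
    RegFamily hR O n (fun ζ => c ζ - d ζ) := by
  simpa [sub_eq_add_neg] using hc.add hd.neg

theorem contDiff_const_continuousMap :
    ContDiff ℝ ∞ (fun v : V => BoundedContinuousFunction.const (Icc (0 : ℝ) R) v) := by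
  let T : V →L[ℝ] (Icc (0 : ℝ) R →ᵇ V) := LinearMap.mkContinuous
    { toFun := fun v => BoundedContinuousFunction.const _ v
      map_add' := fun _ _ => rfl
      map_smul' := fun _ _ => rfl } 1 (fun v => by
        rw [one_mul]
        exact (BoundedContinuousFunction.norm_le (norm_nonneg _)).2 fun _ => le_rfl)
  exact T.contDiff

theorem regFamily_const {hR : 0 ≤ R} {O : Set F} {P : F → V} (hP : ContDiffOn ℝ ∞ P O) (n : ℕ) :
    RegFamily hR O n (fun ζ => BoundedContinuousFunction.const _ (P ζ)) := by
  induction n generalizing P with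
  | zero => exact contDiff_const_continuousMap.comp_contDiffOn hP
  | succ n ih =>
    refine ⟨contDiff_const_continuousMap.comp_contDiffOn hP, _, ih (P := fun _ => 0)
      contDiffOn_const, fun ζ _ z _ => ?_⟩
    exact hasDerivWithinAt_const _ _ _

/-- The restriction to `[0, R]` of a function smooth on `[0, ∞)`. -/
def restrictI {g : ℝ → V} (hg : ContDiffOn ℝ ∞ g (Ici 0)) (R : ℝ) : (Icc (0 : ℝ) R →ᵇ V) :=
  BoundedContinuousFunction.mkOfCompact
    ⟨fun z => g z, hg.continuousOn.comp_continuous continuous_subtype_val fun z => z.2.1⟩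

theorem extendI_restrictI {g : ℝ → V} (hg : ContDiffOn ℝ ∞ g (Ici 0)) (hR : 0 ≤ R) {z : ℝ}
    (hz : z ∈ Icc 0 R) : extendI hR (restrictI hg R) z = g z := by
  rw [extendI, Set.IccExtend_of_mem hR _ hz]; rfl

theorem contDiffOn_derivWithin_Ici {g : ℝ → V} (hg : ContDiffOn ℝ ∞ g (Ici 0)) :
    ContDiffOn ℝ ∞ (derivWithin g (Ici 0)) (Ici 0) :=
  hg.derivWithin (uniqueDiffOn_Ici 0) (by simp)

theorem hasDerivWithinAt_of_contDiffOn_Ici {g : ℝ → V} (hg : ContDiffOn ℝ ∞ g (Ici 0)) {z : ℝ}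
    (hz : 0 ≤ z) : HasDerivWithinAt g (derivWithin g (Ici 0) z) (Ici 0) z :=
  (hg.differentiableOn (by simp) z hz).hasDerivWithinAt

theorem regFamily_restrictI {hR : 0 ≤ R} {O : Set F} {g : ℝ → V} (hg : ContDiffOn ℝ ∞ g (Ici 0))
    (n : ℕ) : RegFamily hR O n (fun _ : F => restrictI hg R) := by
  induction n generalizing g with
  | zero => exact contDiffOn_const
  | succ n ih =>
    refine ⟨contDiffOn_const, _, ih (contDiffOn_derivWithin_Ici hg), fun ζ _ z hz => ?_⟩
    rw [extendI_restrictI _ hR hz]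
    exact ((hasDerivWithinAt_of_contDiffOn_Ici hg hz.1).mono Icc_subset_Ici_self).congr
      (fun s hs => extendI_restrictI hg hR hs) (extendI_restrictI hg hR hz)

variable {𝔸 : Type*} [NormedRing 𝔸] [NormedAlgebra ℝ 𝔸] [CompleteSpace 𝔸]

theorem RegFamily.mul {hR : 0 ≤ R} {O : Set F} {n : ℕ} {c d : F → (Icc (0 : ℝ) R →ᵇ 𝔸)}
    (hc : RegFamily hR O n c) (hd : RegFamily hR O n d) :
    RegFamily hR O n (fun ζ => c ζ * d ζ) := by
  induction n generalizing c d with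
  | zero => exact ContDiffOn.mul hc hd
  | succ n ih =>
    have hc1 := hc.mono
    have hd1 := hd.mono
    obtain ⟨h0, c', hc', hcd⟩ := hc
    obtain ⟨k0, d', hd', hdd⟩ := hd
    exact ⟨h0.mul k0, _, (ih hc' hd1).add (ih hc1 hd'),
      fun ζ hζ z hz => (hcd ζ hζ z hz).mul (hdd ζ hζ z hz)⟩

theorem RegFamily.sum {ι : Type*} (s : Finset ι) {hR : 0 ≤ R} {O : Set F} {n : ℕ}
    {c : ι → F → (Icc (0 : ℝ) R →ᵇ V)} (hc : ∀ i, RegFamily hR O n (c i)) :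
    RegFamily hR O n (fun ζ => ∑ i ∈ s, c i ζ) := by
  classical
  induction s using Finset.induction_on with
  | empty =>
    exact regFamily_const (P := fun _ : F => (0 : V)) contDiffOn_const n
  | insert i s hi ih =>
    simp_rw [Finset.sum_insert hi]
    exact (hc i).add ih

end JointSmoothness

/-! ### The fixed point problem for the conjugator. -/

section Conjugator

open MeasureTheory BoundedContinuousFunction

variable {𝔸 : Type*} [NormedRing 𝔸] [NormedAlgebra ℂ 𝔸] [FiniteDimensional ℂ 𝔸]
variable {F : Type*} [NormedAddCommGroup F] [NormedSpace ℝ F]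

/-- There are arbitrarily small shifts of `L` without purely imaginary eigenvalues. -/
theorem exists_shift_noImagEigenvalue (L : 𝔸 →ₗ[ℂ] 𝔸) {δ : ℝ} (hδ : 0 < δ) :
    ∃ θ : ℝ, 0 < θ ∧ θ < δ ∧ NoImagEigenvalue (L + (θ : ℂ) • LinearMap.id) := by
  have hfin : {x : ℝ | ∃ μ : ℂ, Module.End.HasEigenvalue L μ ∧ x = -μ.re}.Finite := by
    refine (Set.Finite.image (fun μ : ℂ => -μ.re)
      (Module.End.finite_hasEigenvalue (f := L))).subset ?_
    rintro x ⟨μ, hμ, rfl⟩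
    exact ⟨μ, hμ, rfl⟩
  obtain ⟨θ, hθ, hn⟩ := (Ioo_infinite hδ).exists_notMem_finite hfin
  refine ⟨θ, hθ.1, hθ.2, fun μ hμ v hv => ?_⟩
  by_contra hv0
  refine hn ⟨μ - θ, ?_, by simp [hμ]⟩
  refine Module.End.hasEigenvalue_of_hasEigenvector (x := v)
    ⟨Module.End.mem_eigenspace_iff.2 ?_, hv0⟩
  rw [sub_smul, ← hv]
  simp

theorem contDiff_const_bcf {α V : Type*} [TopologicalSpace α] [NormedAddCommGroup V]
    [NormedSpace ℝ V] : ContDiff ℝ ∞ (fun v : V => BoundedContinuousFunction.const α v) := by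
  let T : V →L[ℝ] (α →ᵇ V) := LinearMap.mkContinuous
    { toFun := fun v => BoundedContinuousFunction.const _ v
      map_add' := fun _ _ => rfl
      map_smul' := fun _ _ => rfl } 1 (fun v => by
        rw [one_mul]
        exact (BoundedContinuousFunction.norm_le (norm_nonneg _)).2 fun _ => le_rfl)
  exact T.contDiff

/-- The solution is (1 - T ζ)⁻¹ k ζ. Contraction is needed at ζ = 0 only: the units of the Banach
algebra of operators are open and inversion is smooth there. -/
theorem exists_contDiffOn_fixedPoint {X : Type*} [NormedAddCommGroup X] [NormedSpace ℝ X]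
    [CompleteSpace X] {T : F → X →L[ℝ] X} (hT : ContDiff ℝ ∞ T) (hT0 : ‖T 0‖ < 1) {k : F → X}
    (hk : ContDiff ℝ ∞ k) :
    ∃ ρ > 0, ∃ y : F → X, ContDiffOn ℝ ∞ y (Metric.ball 0 ρ) ∧
      ∀ ζ ∈ Metric.ball (0 : F) ρ, y ζ = T ζ (y ζ) + k ζ ∧ ‖y ζ‖ ≤ ‖y 0‖ + 1 := by
  let U : F → (X →L[ℝ] X) := fun ζ => 1 - T ζ
  have hU : ContDiff ℝ ∞ U := contDiff_const.sub hT
  have hU0 : IsUnit (U 0) := (Units.oneSub (T 0) hT0).isUnit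
  let y : F → X := fun ζ => Ring.inverse (U ζ) (k ζ)
  have hyc : ∀ ζ, IsUnit (U ζ) → ContDiffAt ℝ ∞ y ζ := by
    rintro ζ ⟨u, hu⟩
    have h0 := contDiffAt_ringInverse (R := X →L[ℝ] X) ℝ (n := ∞) u
    rw [hu] at h0
    have h1 : ContDiffAt ℝ ∞ (fun ζ => Ring.inverse (U ζ)) ζ := h0.comp ζ hU.contDiffAt
    exact h1.clm_apply hk.contDiffAt
  have hev : ∀ᶠ ζ in 𝓝 (0 : F), IsUnit (U ζ) ∧ ‖y ζ‖ < ‖y 0‖ + 1 := by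
    have h1 : {x : X →L[ℝ] X | IsUnit x} ∈ 𝓝 (U 0) := Units.isOpen.mem_nhds hU0
    have h2 : ∀ᶠ ζ in 𝓝 (0 : F), IsUnit (U ζ) := hU.continuous.continuousAt h1
    exact h2.and ((hyc 0 hU0).continuousAt.norm.eventually (gt_mem_nhds (by linarith)))
  obtain ⟨ρ, hρ, hball⟩ := Metric.eventually_nhds_iff_ball.1 hev
  refine ⟨ρ, hρ, y, fun ζ hζ => (hyc ζ (hball ζ hζ).1).contDiffWithinAt, fun ζ hζ =>
    ⟨?_, (hball ζ hζ).2.le⟩⟩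
  have h1 : U ζ (y ζ) = k ζ := by
    have := congrArg (fun T => T (k ζ)) (Ring.mul_inverse_cancel _ (hball ζ hζ).1)
    exact this
  have h2 : U ζ (y ζ) = y ζ - T ζ (y ζ) := rfl
  rw [← h1, h2]; abel

variable {ι : Type*} [Fintype ι]

/-- Existence of a conjugator, up to invertibility. -/
theorem exists_conjugator_aux (P : ι → F → 𝔸) (hP : ∀ i, ContDiff ℝ ∞ (P i)) (g : ι → ℝ → 𝔸)
    (hg : ∀ i, ContDiffOn ℝ ∞ (g i) (Ici 0)) (ginf : ι → 𝔸) {δ : ℝ} (hδ : 0 < δ)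
    (hdec : ∀ i, ∃ C, ∀ z ≥ 0, ‖g i z - ginf i‖ ≤ C * Real.exp (-(δ * z))) :
    ∃ ρ > 0, ∃ Φ : ℝ → F → 𝔸,
      ContDiffOn ℝ ∞ (fun x : ℝ × F => Φ x.1 x.2) (Ici 0 ×ˢ Metric.ball 0 ρ) ∧
      (∀ z ≥ 0, ∀ ζ ∈ Metric.ball (0 : F) ρ, HasDerivWithinAt (fun s => Φ s ζ)
        ((∑ i, P i ζ * g i z) * Φ z ζ - Φ z ζ * ∑ i, P i ζ * ginf i) (Ici 0) z) ∧
      ∃ θ > 0, ∃ C : ℝ, ∀ z ≥ 0, ∀ ζ ∈ Metric.ball (0 : F) ρ,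
        ‖Φ z ζ - 1‖ ≤ C * Real.exp (-(θ * z)) := by
  have hcs : CompleteSpace 𝔸 := FiniteDimensional.complete ℂ 𝔸
  set G : F → 𝔸 := fun ζ => ∑ i, P i ζ * ginf i with hG
  have hGs : ContDiff ℝ ∞ G := ContDiff.sum fun i _ => (hP i).mul contDiff_const
  -- With Φ = 1 + Ψ the equation reads Ψ' = [G, Ψ] + (𝒢 - G)Ψ + (𝒢 - G). Its principal part at ζ = 0
  -- is the commutator with G(0), which always has the eigenvalue 0 on a nontrivial algebra.
  let L0 : 𝔸 →L[ℂ] 𝔸 := ContinuousLinearMap.mul ℂ 𝔸 (G 0) - (ContinuousLinearMap.mul ℂ 𝔸).flip (G 0)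
  -- Writing Ψ = e^{-θt} v adds θ to the commutator. This removes imaginary eigenvalues and provides
  -- the decay of Ψ; since θ < δ, the forcing e^{θt}(𝒢 - G) still decays.
  obtain ⟨θ, hθ, hθδ, hno⟩ := exists_shift_noImagEigenvalue (L0 : 𝔸 →ₗ[ℂ] 𝔸) hδ
  let L : 𝔸 →L[ℂ] 𝔸 := L0 + (θ : ℂ) • ContinuousLinearMap.id ℂ 𝔸
  have hLapp : ∀ v, L v = G 0 * v - v * G 0 + θ • v := fun v => by
    simp [L, L0]
  obtain ⟨a, ha, hgreen⟩ := exists_green (L := L) hno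
  choose C hC using hdec
  set C0 : ℝ := ∑ i, ‖P i 0‖ * |C i| with hC0
  have hC0n : 0 ≤ C0 := by positivity
  -- the shift making the perturbation small
  obtain ⟨Z, hZ0, hZ⟩ : ∃ Z : ℝ, 0 ≤ Z ∧ a * (C0 * Real.exp (-(δ * Z))) ≤ 1 / 4 := by
    have : Tendsto (fun Z : ℝ => a * (C0 * Real.exp (-(δ * Z)))) atTop (𝓝 (a * (C0 * 0))) := by
      refine ((Real.tendsto_exp_neg_atTop_nhds_zero.comp
        (tendsto_id.const_mul_atTop hδ)).const_mul C0).const_mul a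
    rw [mul_zero, mul_zero] at this
    obtain ⟨Z, h1, h2⟩ := ((this.eventually (gt_mem_nhds (by norm_num : (0 : ℝ) < 1 / 4))).and
      (eventually_ge_atTop 0)).exists
    exact ⟨Z, h2, h1.le⟩
  -- After the shift t = z - Z the perturbation is at most C0 e^{-δZ} for t ≥ 0, contributing at
  -- most 1/4 to the norm of the fixed point map. For t < 0 it is only bounded by C0, and this
  -- choice of b makes the second contribution at most 1/4 as well.
  obtain ⟨μ, hμ, K, hK, hKb⟩ := hgreen (1 / (4 * (C0 + 1))) (by positivity)
  set W : ℝ → ℝ := fun t => Real.exp (-(μ * min t 0)) with hW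
  have hWc : Continuous W := by fun_prop
  have hWpos : ∀ t, 0 < W t := fun t => Real.exp_pos _
  -- The maximum freezes the coefficients at z = 0 for t < -Z, so that the problem lives on the
  -- whole line. Only t ≥ -Z, that is z ≥ 0, matters in the end.
  have hE : ∀ i t, ‖g i (max (t + Z) 0) - ginf i‖ ≤ |C i| * Real.exp (-(δ * max (t + Z) 0)) :=
    fun i t => (hC i _ (le_max_right _ _)).trans (by gcongr; exact le_abs_self _)
  have hgc : ∀ i, Continuous fun t => g i (max (t + Z) 0) - ginf i := fun i =>
    ((hg i).continuousOn.comp_continuous (by fun_prop) fun t => Set.mem_Ici.2 (le_max_right _ _)).sub continuous_const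
  let E : ι → (ℝ →ᵇ 𝔸) := fun i => BoundedContinuousFunction.ofNormedAddCommGroup
    (fun t => g i (max (t + Z) 0) - ginf i) (hgc i) |C i| (fun t => by
      refine (hE i t).trans ?_
      refine mul_le_of_le_one_right (abs_nonneg _) ?_
      rw [Real.exp_le_one_iff]
      have : 0 ≤ δ * max (t + Z) 0 := by positivity
      linarith)
  have hWinv : ∀ t, (W t)⁻¹ * Real.exp (θ * t) ≤ Real.exp (δ * max (t + Z) 0) := by
    intro t
    simp only [hW, ← Real.exp_neg, ← Real.exp_add]
    refine Real.exp_le_exp.2 ?_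
    rcases le_total t 0 with ht | ht
    · rw [min_eq_left ht]
      have : 0 ≤ δ * max (t + Z) 0 := by positivity
      nlinarith
    · rw [min_eq_right ht]
      have : t ≤ max (t + Z) 0 := le_max_of_le_left (by linarith)
      nlinarith
  let k : ι → (ℝ →ᵇ 𝔸) := fun i => BoundedContinuousFunction.ofNormedAddCommGroup
    (fun t => ((W t)⁻¹ * Real.exp (θ * t)) • (g i (max (t + Z) 0) - ginf i))
    (((hWc.inv₀ fun t => (hWpos t).ne').mul (by fun_prop)).smul (hgc i)) |C i| (fun t => by
      have h0 : 0 ≤ (W t)⁻¹ * Real.exp (θ * t) := by have := hWpos t; positivity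
      rw [norm_smul, Real.norm_of_nonneg h0]
      calc _ ≤ Real.exp (δ * max (t + Z) 0) * (|C i| * Real.exp (-(δ * max (t + Z) 0))) := by
            gcongr
            · exact hWinv t
            · exact hE i t
        _ = |C i| := by
            rw [mul_comm, mul_assoc, ← Real.exp_add]; simp)
  let cst : 𝔸 → (ℝ →ᵇ 𝔸) := fun v => BoundedContinuousFunction.const ℝ v
  have hcst : ContDiff ℝ ∞ cst := contDiff_const_bcf
  let Eh : F → (ℝ →ᵇ 𝔸) := fun ζ => ∑ i, cst (P i ζ) * E i
  let kh : F → (ℝ →ᵇ 𝔸) := fun ζ => ∑ i, cst (P i ζ) * k i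
  have hEh : ContDiff ℝ ∞ Eh := ContDiff.sum fun i _ => (hcst.comp (hP i)).mul contDiff_const
  have hkh : ContDiff ℝ ∞ kh := ContDiff.sum fun i _ => (hcst.comp (hP i)).mul contDiff_const
  have hEh_app : ∀ ζ t, Eh ζ t = ∑ i, P i ζ * (g i (max (t + Z) 0) - ginf i) := fun ζ t => by
    simp only [Eh, BoundedContinuousFunction.coe_sum, Finset.sum_apply]
    rfl
  have hkh_app : ∀ ζ t, kh ζ t = ((W t)⁻¹ * Real.exp (θ * t)) • Eh ζ t := fun ζ t => by
    rw [hEh_app]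
    simp only [kh, BoundedContinuousFunction.coe_sum, Finset.sum_apply, Finset.smul_sum,
      ← mul_smul_comm]
    rfl
  let M := ContinuousLinearMap.mul ℝ (ℝ →ᵇ 𝔸)
  -- N collects (𝒢 - G)y and the commutator of G(ζ) - G(0) with y. The latter vanishes at ζ = 0, so
  -- smallness is required of 𝒢 - G alone.
  let N : F → ((ℝ →ᵇ 𝔸) →L[ℝ] (ℝ →ᵇ 𝔸)) := fun ζ =>
    M (Eh ζ + cst (G ζ - G 0)) - M.flip (cst (G ζ - G 0))
  have hdG : ContDiff ℝ ∞ fun ζ => cst (G ζ - G 0) := hcst.comp (hGs.sub contDiff_const)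
  have hN : ContDiff ℝ ∞ N := by
    have h1 : ContDiff ℝ ∞ fun ζ => M (Eh ζ + cst (G ζ - G 0)) := M.contDiff.comp (hEh.add hdG)
    have h2 : ContDiff ℝ ∞ fun ζ => M.flip (cst (G ζ - G 0)) := M.flip.contDiff.comp hdG
    exact h1.sub h2
  have hNapp : ∀ ζ y t, N ζ y t = (Eh ζ t + (G ζ - G 0)) * y t - y t * (G ζ - G 0) :=
    fun ζ y t => rfl
  have hT0 : ‖K.comp (N 0)‖ < 1 := by
    refine lt_of_le_of_lt (ContinuousLinearMap.opNorm_le_bound _ (M := 1 / 2) (by norm_num)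
      fun y => ?_) (by norm_num)
    have hn0 : ∀ t, ‖N 0 y t‖ ≤ C0 * Real.exp (-(δ * max (t + Z) 0)) * ‖y‖ := by
      intro t
      rw [hNapp, sub_self, add_zero, mul_zero, sub_zero, hEh_app]
      refine (norm_mul_le _ _).trans ?_
      gcongr
      · rw [hC0, Finset.sum_mul]
        refine (norm_sum_le _ _).trans (Finset.sum_le_sum fun i _ => ?_)
        refine (norm_mul_le _ _).trans ?_
        rw [mul_assoc]
        gcongr
        exact hE i t
      · exact y.norm_coe_le_norm t
    refine (hKb (N 0 y) (C0 * Real.exp (-(δ * Z)) * ‖y‖) (C0 * ‖y‖) (fun t ht => ?_)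
      (fun t => ?_)).trans ?_
    · refine (hn0 t).trans ?_
      gcongr
      exact le_max_of_le_left (by linarith)
    · refine (hn0 t).trans ?_
      gcongr
      refine mul_le_of_le_one_right hC0n ?_
      rw [Real.exp_le_one_iff]
      have : 0 ≤ δ * max (t + Z) 0 := by positivity
      linarith
    · have h1 : 1 / (4 * (C0 + 1)) * C0 ≤ 1 / 4 := by
        rw [div_mul_eq_mul_div, div_le_iff₀ (by positivity)]; linarith
      have hy := norm_nonneg y
      nlinarith
  obtain ⟨ρ, hρ, y, hys, hfy⟩ := exists_contDiffOn_fixedPoint (T := fun ζ => K.comp (N ζ))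
    (contDiff_const.clm_comp hN) hT0 (k := fun ζ => K (kh ζ)) (K.contDiff.comp hkh)
  have hfix : ∀ ζ ∈ Metric.ball (0 : F) ρ, y ζ = K (N ζ (y ζ) + kh ζ) := by
    intro ζ hζ
    rw [map_add]
    exact (hfy ζ hζ).1
  -- The weight, the factor e^{-θt} and the shift by Z are undone.
  let Ψ : ℝ → F → 𝔸 := fun z ζ => (Real.exp (-(θ * (z - Z))) * W (z - Z)) • y ζ (z - Z)
  have hder : ∀ z ≥ 0, ∀ ζ ∈ Metric.ball (0 : F) ρ, HasDerivAt (fun s => Ψ s ζ)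
      ((∑ i, P i ζ * g i z) * Ψ z ζ - Ψ z ζ * G ζ + ((∑ i, P i ζ * g i z) - G ζ)) z := by
    intro z hz ζ hζ
    have h1 := hK (N ζ (y ζ) + kh ζ) (z - Z)
    rw [← hfix ζ hζ] at h1
    have h1' : HasDerivAt (fun s : ℝ => W (s - Z) • y ζ (s - Z)) _ z :=
      HasDerivAt.comp_sub_const z Z h1
    have h2 : HasDerivAt (fun s : ℝ => Real.exp (-(θ * (s - Z))))
        (Real.exp (-(θ * (z - Z))) * -(θ * 1)) z :=
      ((((hasDerivAt_id z).sub_const Z).const_mul θ).neg).exp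
    have h3 := h2.smul h1'
    have hfun : (fun s => Ψ s ζ)
        = fun s => Real.exp (-(θ * (s - Z))) • (W (s - Z) • y ζ (s - Z)) := by
      funext s; simp only [Ψ, smul_smul]
    rw [hfun]
    convert! h3 using 1
    have hEhz : Eh ζ (z - Z) = (∑ i, P i ζ * g i z) - G ζ := by
      rw [hEh_app, sub_add_cancel, max_eq_left hz, hG, ← Finset.sum_sub_distrib]
      exact Finset.sum_congr rfl fun i _ => mul_sub _ _ _
    change _ = Real.exp (-(θ * (z - Z))) • (L (W (z - Z) • y ζ (z - Z))
      + W (z - Z) • (N ζ (y ζ) (z - Z) + kh ζ (z - Z)))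
      + (Real.exp (-(θ * (z - Z))) * -(θ * 1)) • (W (z - Z) • y ζ (z - Z))
    rw [hNapp, hkh_app, hLapp, hEhz]
    have hexp : Real.exp (-(θ * (z - Z))) * Real.exp (θ * (z - Z)) = 1 := by
      rw [← Real.exp_add]; simp
    have hWW : W (z - Z) * (W (z - Z))⁻¹ = 1 := mul_inv_cancel₀ (hWpos _).ne'
    have hlast : Real.exp (-(θ * (z - Z))) • W (z - Z) •
        (((W (z - Z))⁻¹ * Real.exp (θ * (z - Z))) • ((∑ i, P i ζ * g i z) - G ζ))
        = (∑ i, P i ζ * g i z) - G ζ := by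
      rw [smul_smul, smul_smul]
      rw [show Real.exp (-(θ * (z - Z))) * W (z - Z) * ((W (z - Z))⁻¹ * Real.exp (θ * (z - Z)))
        = (Real.exp (-(θ * (z - Z))) * Real.exp (θ * (z - Z))) * (W (z - Z) * (W (z - Z))⁻¹) by ring,
        hexp, hWW, mul_one, one_smul]
    rw [smul_add, smul_add, smul_add, smul_add, hlast]
    simp only [Ψ]
    set e := Real.exp (-(θ * (z - Z)))
    set wt := W (z - Z)
    set v := y ζ (z - Z)
    set S := ∑ i, P i ζ * g i z
    simp only [mul_smul_comm, smul_mul_assoc, smul_sub, smul_add, smul_smul, sub_mul, mul_sub,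
      add_mul]
    module
  refine ⟨ρ, hρ, fun z ζ => 1 + Ψ z ζ, ?_, fun z hz ζ hζ => ?_, θ, hθ,
    Real.exp (θ * Z) * Real.exp (μ * Z) * (‖y 0‖ + 1), fun z hz ζ hζ => ?_⟩
  · refine contDiffOn_const.add ?_
    -- joint smoothness on `[0, R]`
    have hloc : ∀ R : ℝ, 0 ≤ R →
        ContDiffOn ℝ ∞ (fun x : ℝ × F => Ψ x.1 x.2) (Icc 0 R ×ˢ Metric.ball 0 ρ) := by
      intro R hR
      let sc : Icc (0 : ℝ) R →ᵇ 𝔸 := BoundedContinuousFunction.mkOfCompact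
        ⟨fun z => (Real.exp (-(θ * ((z : ℝ) - Z))) * W ((z : ℝ) - Z)) • (1 : 𝔸), by fun_prop⟩
      let B : (ℝ →ᵇ 𝔸) →L[ℝ] (Icc (0 : ℝ) R →ᵇ 𝔸) := LinearMap.mkContinuous
        { toFun := fun y => y.compContinuous ⟨fun z : Icc (0 : ℝ) R => (z : ℝ) - Z, by fun_prop⟩
          map_add' := fun _ _ => rfl
          map_smul' := fun _ _ => rfl } 1 (fun y => by
            rw [one_mul]
            exact (BoundedContinuousFunction.norm_le (norm_nonneg _)).2 fun x =>
              y.norm_coe_le_norm _)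
      let c : F → (Icc (0 : ℝ) R →ᵇ 𝔸) := fun ζ => sc * B (y ζ)
      have hcz : ∀ ζ, ∀ z ∈ Icc 0 R, extendI hR (c ζ) z = Ψ z ζ := by
        intro ζ z hz
        rw [extendI, Set.IccExtend_of_mem hR _ hz]
        change ((Real.exp (-(θ * (z - Z))) * W (z - Z)) • (1 : 𝔸)) * (y ζ (z - Z)) = _
        rw [smul_mul_assoc, one_mul]
      have hc : ContDiffOn ℝ ∞ c (Metric.ball 0 ρ) :=
        contDiffOn_const.mul (B.contDiff.comp_contDiffOn hys)
      let Γ : F → (Icc (0 : ℝ) R →ᵇ 𝔸) := fun ζ =>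
        ∑ i, BoundedContinuousFunction.const _ (P i ζ) * restrictI (hg i) R
      let Γi : F → (Icc (0 : ℝ) R →ᵇ 𝔸) := fun ζ => BoundedContinuousFunction.const _ (G ζ)
      have hΓ : ∀ n, RegFamily hR (Metric.ball (0 : F) ρ) n Γ := fun n =>
        RegFamily.sum Finset.univ fun i =>
          (regFamily_const (hP i).contDiffOn n).mul (regFamily_restrictI (hg i) n)
      have hΓi : ∀ n, RegFamily hR (Metric.ball (0 : F) ρ) n Γi := fun n =>
        regFamily_const hGs.contDiffOn n
      have hcd : IsDerivFamily hR (Metric.ball (0 : F) ρ) c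
          (fun ζ => Γ ζ * c ζ - c ζ * Γi ζ + (Γ ζ - Γi ζ)) := by
        intro ζ hζ z hz
        have h1 := (hder z hz.1 ζ hζ).hasDerivWithinAt (s := Icc 0 R)
        have h2 := h1.congr (fun s hs => hcz ζ s hs) (hcz ζ z hz)
        convert! h2 using 1
        have hΓz : extendI hR (Γ ζ) z = ∑ i, P i ζ * g i z := by
          rw [extendI, Set.IccExtend_of_mem hR _ hz]
          simp only [Γ, BoundedContinuousFunction.coe_sum, Finset.sum_apply]
          rfl
        change extendI hR (Γ ζ) z * extendI hR (c ζ) z - extendI hR (c ζ) z * G ζ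
          + (extendI hR (Γ ζ) z - G ζ) = _
        rw [hΓz, hcz ζ z hz]
      -- Bootstrap: the equation expresses the z-derivative of c by products of c with coefficient
      -- families of arbitrary regularity, so n derivatives of c yield n + 1.
      have hreg : ∀ n, RegFamily hR (Metric.ball (0 : F) ρ) n c := by
        intro n
        induction n with
        | zero => exact hc
        | succ n ih =>
          exact ⟨hc, _, (((hΓ n).mul ih).sub (ih.mul (hΓi n))).add ((hΓ n).sub (hΓi n)), hcd⟩
      exact (contDiffOn_of_regFamily hreg).congr fun x hx => (hcz x.2 x.1 hx.1).symm
    intro x hx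
    have h1 := hloc (x.1 + 1) (by have : 0 ≤ x.1 := hx.1; linarith) x
      ⟨⟨hx.1, by linarith⟩, hx.2⟩
    refine h1.mono_of_mem_nhdsWithin ?_
    have : (Iio (x.1 + 1) ×ˢ univ : Set (ℝ × F)) ∈ 𝓝 x :=
      prod_mem_nhds (Iio_mem_nhds (by linarith)) univ_mem
    filter_upwards [self_mem_nhdsWithin, mem_nhdsWithin_of_mem_nhds this] with w hw hw'
    exact ⟨⟨hw.1, le_of_lt hw'.1⟩, hw.2⟩
  · have h1 := ((hder z hz ζ hζ).const_add 1).hasDerivWithinAt (s := Ici 0)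
    convert! h1 using 1
    noncomm_ring
  · rw [add_sub_cancel_left, norm_smul, Real.norm_of_nonneg (by have := hWpos (z - Z); positivity)]
    have h1 : Real.exp (-(θ * (z - Z))) = Real.exp (θ * Z) * Real.exp (-(θ * z)) := by
      rw [← Real.exp_add]; ring_nf
    have h2 : W (z - Z) ≤ Real.exp (μ * Z) := by
      refine Real.exp_le_exp.2 ?_
      have : -Z ≤ min (z - Z) 0 := le_min (by linarith) (by linarith)
      nlinarith
    have h3 : ‖y ζ (z - Z)‖ ≤ ‖y 0‖ + 1 := ((y ζ).norm_coe_le_norm _).trans (hfy ζ hζ).2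
    rw [h1]
    calc _ ≤ Real.exp (θ * Z) * Real.exp (-(θ * z)) * Real.exp (μ * Z) * (‖y 0‖ + 1) := by
          gcongr
      _ = _ := by ring

end Conjugator

/-! ### Invertibility of the conjugator and decay of its inverse. -/

section ConjugatorInverse

variable {𝔸 : Type*} [NormedRing 𝔸] [NormedAlgebra ℂ 𝔸] [FiniteDimensional ℂ 𝔸]

theorem isUnit_of_mul_eq_zero_imp {a : 𝔸} (h : ∀ v, a * v = 0 → v = 0) : IsUnit a := by
  have hinj : Function.Injective (LinearMap.mulLeft ℂ a) := by
    rw [← LinearMap.ker_eq_bot, LinearMap.ker_eq_bot']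
    exact h
  obtain ⟨y, hy⟩ := (LinearMap.injective_iff_surjective.1 hinj) 1
  have hy' : a * y = 1 := hy
  have hy2 : y * a = 1 := by
    have := h (y * a - 1) (by rw [mul_sub, ← mul_assoc, hy', one_mul, mul_one, sub_self])
    exact sub_eq_zero.1 this
  exact ⟨⟨a, y, hy', hy2⟩, rfl⟩

/-- If Φ(z)v = 0, then x(s) = Φ(s) e^{(s-z)G} v satisfies x' = Γx and x(z) = 0, hence vanishes by
Gronwall. For large s the factor Φ(s) is near 1 and invertible, so v = 0. -/
theorem isUnit_of_hasDerivWithinAt {Γ Φ : ℝ → 𝔸} {G : 𝔸} (hΓ : ContinuousOn Γ (Ici 0))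
    (hΦ : ∀ z ≥ 0, HasDerivWithinAt Φ (Γ z * Φ z - Φ z * G) (Ici 0) z)
    (hlim : Tendsto Φ atTop (𝓝 1)) {z : ℝ} (hz : 0 ≤ z) : IsUnit (Φ z) := by
  have hcs : CompleteSpace 𝔸 := FiniteDimensional.complete ℂ 𝔸
  refine isUnit_of_mul_eq_zero_imp fun v hv => ?_
  have hev : ∀ᶠ s in atTop, IsUnit (Φ s) :=
    hlim.eventually (Units.isOpen.mem_nhds (show IsUnit (1 : 𝔸) from isUnit_one))
  obtain ⟨b, hb, hzb⟩ := (hev.and (eventually_ge_atTop z)).exists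
  let x : ℝ → 𝔸 := fun s => Φ s * (NormedSpace.exp ((s - z) • G) * v)
  have hx : ∀ s ≥ 0, HasDerivWithinAt x (Γ s * x s) (Ici 0) s := by
    intro s hs
    have h1 : HasDerivAt (fun s : ℝ => NormedSpace.exp ((s - z) • G))
        (G * NormedSpace.exp ((s - z) • G)) s := by
      exact HasDerivAt.comp_sub_const s z (hasDerivAt_exp_smul_const' (𝕂 := ℝ) G (s - z))
    have h2 := (hΦ s hs).mul (h1.mul_const v).hasDerivWithinAt
    convert! h2 using 1
    simp only [x]
    noncomm_ring
  obtain ⟨K, hK⟩ := isCompact_Icc.exists_bound_of_continuousOn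
    (hΓ.mono (Icc_subset_Ici_self.trans (Ici_subset_Ici.2 hz) : Icc z b ⊆ Ici 0))
  have := norm_le_gronwallBound_of_norm_deriv_right_le (f := x) (f' := fun s => Γ s * x s)
    (δ := 0) (K := K) (ε := 0) (a := z) (b := b)
    (fun s hs => (hx s (hz.trans hs.1)).continuousWithinAt.mono
      (Icc_subset_Ici_self.trans (Ici_subset_Ici.2 hz)))
    (fun s hs => (hx s (hz.trans hs.1)).mono (Ici_subset_Ici.2 (hz.trans hs.1)))
    (by simp [x, hv]) (fun s hs => by
      rw [add_zero]
      refine (norm_mul_le _ _).trans ?_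
      gcongr
      exact hK s ⟨hs.1, hs.2.le⟩) b (right_mem_Icc.2 hzb)
  rw [gronwallBound_ε0, zero_mul, norm_le_zero_iff] at this
  have h3 : NormedSpace.exp ((b - z) • G) * v = 0 := (hb.mul_right_eq_zero).1 this
  let _ : NormedAlgebra ℚ 𝔸 := NormedAlgebra.restrictScalars ℚ ℂ 𝔸
  exact ((NormedSpace.isUnit_exp ((b - z) • G)).mul_right_eq_zero).1 h3

variable {F : Type*} [NormedAddCommGroup F] [NormedSpace ℝ F] [FiniteDimensional ℝ F]
variable {ι : Type*} [Fintype ι]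

/-- Existence of a conjugator for a system with coefficients `∑ Pᵢ(ζ) gᵢ(z)` converging at an
exponential rate. -/
theorem exists_conjugator (P : ι → F → 𝔸) (hP : ∀ i, ContDiff ℝ ∞ (P i)) (g : ι → ℝ → 𝔸)
    (hg : ∀ i, ContDiffOn ℝ ∞ (g i) (Ici 0)) (ginf : ι → 𝔸) {δ : ℝ} (hδ : 0 < δ)
    (hdec : ∀ i, ∃ C, ∀ z ≥ 0, ‖g i z - ginf i‖ ≤ C * Real.exp (-(δ * z))) :
    ∃ ρ > 0, ∃ Φ : ℝ → F → 𝔸,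
      ContDiffOn ℝ ∞ (fun x : ℝ × F => Φ x.1 x.2) (Ici 0 ×ˢ Metric.ball 0 ρ) ∧
      (∀ z ≥ 0, ∀ ζ ∈ Metric.ball (0 : F) ρ, IsUnit (Φ z ζ)) ∧
      (∀ z ≥ 0, ∀ ζ ∈ Metric.ball (0 : F) ρ, HasDerivWithinAt (fun s => Φ s ζ)
        ((∑ i, P i ζ * g i z) * Φ z ζ - Φ z ζ * ∑ i, P i ζ * ginf i) (Ici 0) z) ∧
      ∃ θ > 0, ∃ C : ℝ, ∀ z ≥ 0, ∀ ζ ∈ Metric.ball (0 : F) ρ,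
        ‖Φ z ζ - 1‖ ≤ C * Real.exp (-(θ * z)) ∧
        ‖Ring.inverse (Φ z ζ) - 1‖ ≤ C * Real.exp (-(θ * z)) := by
  have hcs : CompleteSpace 𝔸 := FiniteDimensional.complete ℂ 𝔸
  obtain ⟨ρ, hρ, Φ, hsm, hode, θ, hθ, C, hC⟩ := exists_conjugator_aux P hP g hg ginf hδ hdec
  have hexp0 : Tendsto (fun z : ℝ => C * Real.exp (-(θ * z))) atTop (𝓝 0) := by
    have := (Real.tendsto_exp_neg_atTop_nhds_zero.comp
        (tendsto_id.const_mul_atTop hθ)).const_mul C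
    rwa [mul_zero] at this
  have hunit : ∀ z ≥ 0, ∀ ζ ∈ Metric.ball (0 : F) ρ, IsUnit (Φ z ζ) := by
    intro z hz ζ hζ
    refine isUnit_of_hasDerivWithinAt (Φ := fun s => Φ s ζ) ?_ (fun z hz => hode z hz ζ hζ) ?_ hz
    · exact continuousOn_finsetSum _ fun i _ => continuousOn_const.mul (hg i).continuousOn
    · rw [tendsto_iff_norm_sub_tendsto_zero]
      exact squeeze_zero' (Eventually.of_forall fun _ => norm_nonneg _)
        ((eventually_ge_atTop 0).mono fun s hs => hC s hs ζ hζ) hexp0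
  -- Halving the radius places the parameters in a compact ball on which the inverse can be bounded.
  have hsub : Metric.closedBall (0 : F) (ρ / 2) ⊆ Metric.ball 0 ρ :=
    Metric.closedBall_subset_ball (by linarith)
  obtain ⟨Z, hZs⟩ :=
    (hexp0.eventually (gt_mem_nhds (by norm_num : (0 : ℝ) < 1 / 2))).exists_forall_of_atTop
  have hcomp : IsCompact (Icc 0 Z ×ˢ Metric.closedBall (0 : F) (ρ / 2)) :=
    isCompact_Icc.prod (isCompact_closedBall _ _)
  have hcont : ContinuousOn (fun x : ℝ × F => Ring.inverse (Φ x.1 x.2))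
      (Icc 0 Z ×ˢ Metric.closedBall (0 : F) (ρ / 2)) := by
    intro x hx
    have hxm : x ∈ Ici 0 ×ˢ Metric.ball (0 : F) ρ := ⟨hx.1.1, hsub hx.2⟩
    obtain ⟨u, hu⟩ := hunit x.1 hxm.1 x.2 hxm.2
    have h1 := NormedRing.inverse_continuousAt u
    rw [hu] at h1
    exact h1.comp_continuousWithinAt (f := fun x : ℝ × F => Φ x.1 x.2)
      ((hsm.continuousOn x hxm).mono (prod_mono Icc_subset_Ici_self hsub))
  obtain ⟨B, hB⟩ := hcomp.exists_bound_of_continuousOn hcont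
  have hinv : ∀ z ≥ 0, ∀ ζ ∈ Metric.ball (0 : F) ρ,
      Ring.inverse (Φ z ζ) - 1 = Ring.inverse (Φ z ζ) * (1 - Φ z ζ) := by
    intro z hz ζ hζ
    rw [mul_sub, Ring.inverse_mul_cancel _ (hunit z hz ζ hζ), mul_one]
  -- For z ≤ Z the bound comes from compactness. Beyond Z one has ‖Φ - 1‖ ≤ 1/2, and Φ⁻¹ - 1 = Φ⁻¹(1
  -- - Φ) lets half of ‖Φ⁻¹‖ be absorbed.
  have hbd : ∀ z ≥ 0, ∀ ζ ∈ Metric.ball (0 : F) (ρ / 2),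
      ‖Ring.inverse (Φ z ζ)‖ ≤ max B (2 * ‖(1 : 𝔸)‖) := by
    intro z hz ζ hζ
    have hζ' : ζ ∈ Metric.ball (0 : F) ρ := hsub (Metric.ball_subset_closedBall hζ)
    rcases le_total z Z with h | h
    · exact (hB (z, ζ) ⟨⟨hz, h⟩, Metric.ball_subset_closedBall hζ⟩).trans (le_max_left _ _)
    · refine le_trans ?_ (le_max_right _ _)
      have h1 := hinv z hz ζ hζ'
      have h2 : ‖Ring.inverse (Φ z ζ) - 1‖ ≤ ‖Ring.inverse (Φ z ζ)‖ * (1 / 2) := by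
        rw [h1]
        refine (norm_mul_le _ _).trans ?_
        gcongr
        rw [norm_sub_rev]
        exact (hC z hz ζ hζ').trans (hZs z h).le
      have h3 : ‖Ring.inverse (Φ z ζ)‖ ≤ ‖Ring.inverse (Φ z ζ) - 1‖ + ‖(1 : 𝔸)‖ := by
        simpa using norm_add_le (Ring.inverse (Φ z ζ) - 1) (1 : 𝔸)
      linarith
  have hsub' : Metric.ball (0 : F) (ρ / 2) ⊆ Metric.ball 0 ρ :=
    Metric.ball_subset_ball (by linarith)
  refine ⟨ρ / 2, by linarith, Φ, hsm.mono (prod_mono le_rfl hsub'),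
    fun z hz ζ hζ => hunit z hz ζ (hsub' hζ), fun z hz ζ hζ => hode z hz ζ (hsub' hζ), θ, hθ,
    max C (max B (2 * ‖(1 : 𝔸)‖) * C), fun z hz ζ hζ => ⟨?_, ?_⟩⟩
  · refine (hC z hz ζ (hsub' hζ)).trans ?_
    gcongr
    exact le_max_left _ _
  · rw [hinv z hz ζ (hsub' hζ)]
    calc _ ≤ _ := norm_mul_le _ _
      _ ≤ max B (2 * ‖(1 : 𝔸)‖) * (C * Real.exp (-(θ * z))) := by
        gcongr
        · exact hbd z hz ζ hζ
        · rw [norm_sub_rev]; exact hC z hz ζ (hsub' hζ)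
      _ = max B (2 * ‖(1 : 𝔸)‖) * C * Real.exp (-(θ * z)) := by ring
      _ ≤ _ := by gcongr; exact le_max_right _ _

end ConjugatorInverse

/-! ### Block diagonalization by the inverse function theorem. -/

section BlockDiagonalization

variable {𝔸 : Type*} [NormedRing 𝔸] [NormedAlgebra ℝ 𝔸] [FiniteDimensional ℝ 𝔸]

/-- Smooth block diagonalization near a matrix `D` commuting with the idempotent `e`. -/
theorem exists_analytic_blockDiagonalization {e D : 𝔸} (he : e * e = e) (hD : e * D = D * e)
    (hinj : ∀ h, e * h * e = 0 → (1 - e) * h * (1 - e) = 0 → h * D = D * h → h = 0) :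
    ∃ X : 𝔸 → 𝔸, ContDiffAt ℝ ω X D ∧ X D = 0 ∧
      ∀ᶠ M in 𝓝 D, IsUnit (1 + X M) ∧
        Ring.inverse (1 + X M) * M * (1 + X M) * e = e * (Ring.inverse (1 + X M) * M * (1 + X M)) := by
  have hcs : CompleteSpace 𝔸 := FiniteDimensional.complete ℝ 𝔸
  let mul := ContinuousLinearMap.mul ℝ 𝔸
  -- the block diagonal and off-diagonal parts
  let sand : 𝔸 → 𝔸 → 𝔸 →L[ℝ] 𝔸 := fun a b => (mul a).comp (mul.flip b)
  let dg : 𝔸 →L[ℝ] 𝔸 := sand e e + sand (1 - e) (1 - e)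
  let od : 𝔸 →L[ℝ] 𝔸 := sand e (1 - e) + sand (1 - e) e
  have hdg : ∀ h, dg h = e * (h * e) + (1 - e) * (h * (1 - e)) := fun h => rfl
  have hod : ∀ h, od h = e * (h * (1 - e)) + (1 - e) * (h * e) := fun h => rfl
  have hsum : ∀ h, dg h + od h = h := fun h => by rw [hdg, hod]; noncomm_ring
  have hodD : od D = 0 := by
    rw [hod]
    have h1 : e * (D * (1 - e)) = 0 := by
      rw [← mul_assoc, hD, mul_assoc, mul_sub, mul_one, he, sub_self, mul_zero]
    have h2 : (1 - e) * (D * e) = 0 := by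
      rw [← hD, ← mul_assoc, sub_mul, one_mul, he, sub_self, zero_mul]
    rw [h1, h2, add_zero]
  have hdgD : dg D = D := by
    have := hsum D
    rwa [hodD, add_zero] at this
  have hdgcomm : ∀ h, dg h * e = e * dg h := fun h => by
    have h0 : (1 - e) * e = 0 := by rw [sub_mul, one_mul, he, sub_self]
    have h0' : e * (1 - e) = 0 := by rw [mul_sub, mul_one, he, sub_self]
    rw [hdg, add_mul, mul_add, mul_assoc, mul_assoc, he, mul_assoc (1 - e), mul_assoc h, h0,
      ← mul_assoc e e, he, ← mul_assoc e (1 - e), h0']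
    simp
  -- One unknown Y encodes both the block diagonal form `dg Y` and the conjugating matrix 1 + `od
  -- Y`. Inverting f near D means block diagonalizing all matrices near D.
  let f : 𝔸 → 𝔸 := fun Y => (1 + od Y) * dg Y * Ring.inverse (1 + od Y)
  have hunit1 : (1 : 𝔸) + od D = ((1 : 𝔸ˣ) : 𝔸) := by rw [hodD, add_zero, Units.val_one]
  have hinvC : ContDiffAt ℝ ω (fun Y => Ring.inverse (1 + od Y)) D := by
    have h0 := contDiffAt_ringInverse (R := 𝔸) ℝ (n := ω) (1 : 𝔸ˣ)
    rw [← hunit1] at h0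
    exact h0.comp D (contDiff_const.add od.contDiff).contDiffAt
  have hfC : ContDiffAt ℝ ω f D :=
    (((contDiff_const.add od.contDiff).mul dg.contDiff).contDiffAt).mul hinvC
  have hfD : f D = D := by simp [f, hodD, hdgD]
  -- The derivative of f at D is h ↦ dg h + [od h, D], because `od D = 0` and `dg D = D`.
  let T : 𝔸 →L[ℝ] 𝔸 := dg + ((mul.flip D).comp od - (mul D).comp od)
  have hT : ∀ h, T h = dg h + (od h * D - D * od h) := fun h => rfl
  have hfT : HasFDerivAt f T D := by
    have h1 : HasFDerivAt (fun Y => 1 + od Y) od D := od.hasFDerivAt.const_add 1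
    have h2 : HasFDerivAt dg dg D := dg.hasFDerivAt
    have h3 : HasFDerivAt (fun Y => Ring.inverse (1 + od Y)) (-od) D := by
      have h0 := hasFDerivAt_ringInverse (𝕜 := ℝ) (1 : 𝔸ˣ)
      rw [← hunit1] at h0
      have := h0.comp D h1
      convert! this using 1
      ext h
      simp
    have h4 := (h1.mul' h2).mul' h3
    refine h4.congr_fderiv ?_
    ext h
    simp [hT, hodD, hdgD]
    abel
  -- Since D commutes with e, the commutator of D with an off-diagonal element has no diagonal part.
  -- The two terms of T therefore vanish separately, leaving an off-diagonal element that commutes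
  -- with D, which `hinj` excludes.
  have hTinj : Function.Injective T := by
    rw [injective_iff_map_eq_zero]
    intro h hh
    rw [hT] at hh
    have h0 : (1 - e) * e = 0 := by rw [sub_mul, one_mul, he, sub_self]
    have h0' : e * (1 - e) = 0 := by rw [mul_sub, mul_one, he, sub_self]
    have h1e : (1 - e) * (1 - e) = 1 - e := by rw [mul_sub, mul_one, h0, sub_zero]
    have hD1 : (1 - e) * D = D * (1 - e) := by rw [sub_mul, mul_sub, hD, one_mul, mul_one]
    -- the off-diagonal part of the commutator has no diagonal part
    have k1 : e * od h * e = 0 := by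
      rw [hod, mul_add, add_mul]
      rw [show e * (e * (h * (1 - e))) * e = e * e * h * ((1 - e) * e) by noncomm_ring,
        show e * ((1 - e) * (h * e)) * e = (e * (1 - e)) * h * (e * e) by noncomm_ring, h0, h0']
      simp
    have k2 : (1 - e) * od h * (1 - e) = 0 := by
      rw [hod, mul_add, add_mul]
      rw [show (1 - e) * (e * (h * (1 - e))) * (1 - e)
          = ((1 - e) * e) * h * ((1 - e) * (1 - e)) by simp only [mul_assoc],
        show (1 - e) * ((1 - e) * (h * e)) * (1 - e)
          = ((1 - e) * (1 - e)) * h * (e * (1 - e)) by simp only [mul_assoc], h0, h0']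
      simp
    have k3 : dg (od h * D - D * od h) = 0 := by
      rw [hdg]
      have aux : ∀ p, p * D = D * p → p * od h * p = 0 → p * ((od h * D - D * od h) * p) = 0 := by
        intro p hp h0
        calc _ = p * od h * (D * p) - (p * D) * od h * p := by
              simp only [sub_mul, mul_sub, mul_assoc]
          _ = p * od h * (p * D) - (D * p) * od h * p := by
              congr 1 <;> rw [hp]
          _ = (p * od h * p) * D - D * (p * od h * p) := by simp only [mul_assoc]
          _ = 0 := by rw [h0]; simp
      have a1 := aux e hD k1
      have a2 := aux (1 - e) hD1 k2
      rw [a1, a2, add_zero]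
    have k4 : dg (dg h) = dg h := by
      have : od (dg h) = 0 := by
        rw [hod]
        have := hdgcomm h
        have b1 : e * (dg h * (1 - e)) = 0 := by
          rw [mul_sub, mul_one, this, mul_sub, ← mul_assoc, he, sub_self]
        have b2 : (1 - e) * (dg h * e) = 0 := by
          rw [this, ← mul_assoc, h0, zero_mul]
        rw [b1, b2, add_zero]
      have h5 := hsum (dg h)
      rwa [this, add_zero] at h5
    have k5 : dg h = 0 := by
      have := congrArg dg hh
      rwa [map_add, k3, k4, add_zero, map_zero] at this
    have k6 : od h = h := by have := hsum h; rwa [k5, zero_add] at this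
    rw [k5, zero_add, k6, sub_eq_zero] at hh
    rw [k6] at k1 k2
    exact hinj h k1 k2 hh
  let Te : 𝔸 ≃L[ℝ] 𝔸 := (LinearEquiv.ofInjectiveEndo (T : 𝔸 →ₗ[ℝ] 𝔸) hTinj).toContinuousLinearEquiv
  have hfTe : HasFDerivAt f (Te : 𝔸 →L[ℝ] 𝔸) D := by
    refine hfT.congr_fderiv ?_
    ext h
    rfl
  have hn : (ω : WithTop ℕ∞) ≠ 0 := by simp
  let Y : 𝔸 → 𝔸 := hfC.localInverse hfTe hn
  have hYC : ContDiffAt ℝ ω Y D := by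
    have := hfC.to_localInverse hfTe hn
    rwa [hfD] at this
  have hYD : Y D = D := by
    have := hfC.localInverse_apply_image hfTe hn
    rwa [hfD] at this
  have hYr : ∀ᶠ M in 𝓝 D, f (Y M) = M := by
    have := (hfC.hasStrictFDerivAt' hfTe hn).eventually_right_inverse
    rwa [hfD] at this
  refine ⟨fun M => od (Y M), od.contDiff.contDiffAt.comp D hYC, by change od (Y D) = 0; rw [hYD, hodD], ?_⟩
  have hXu : ∀ᶠ M in 𝓝 D, IsUnit (1 + od (Y M)) := by
    have h1 : ContinuousAt (fun M => 1 + od (Y M)) D :=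
      continuousAt_const.add (od.continuous.continuousAt.comp hYC.continuousAt)
    refine h1.eventually (Units.isOpen.mem_nhds ?_)
    change IsUnit (1 + od (Y D))
    rw [hYD, hunit1]
    exact Units.isUnit _
  filter_upwards [hYr, hXu] with M hM hu
  refine ⟨hu, ?_⟩
  have h1 : Ring.inverse (1 + od (Y M)) * M * (1 + od (Y M)) = dg (Y M) := by
    calc _ = Ring.inverse (1 + od (Y M)) * f (Y M) * (1 + od (Y M)) := by rw [hM]
      _ = (Ring.inverse (1 + od (Y M)) * (1 + od (Y M))) * dg (Y M)
          * (Ring.inverse (1 + od (Y M)) * (1 + od (Y M))) := by simp only [f, mul_assoc]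
      _ = _ := by rw [Ring.inverse_mul_cancel _ hu, one_mul, mul_one]
  rw [h1, hdgcomm]

end BlockDiagonalization

/-! ### Calculus of exponentially converging functions. -/

section ExpConv

variable {V : Type*} [NormedAddCommGroup V] [NormedSpace ℝ V]

/-- Smooth functions on `[0, ∞)` converging at the rate `e^{-δz}`. -/
def ExpConv (δ : ℝ) (g : ℝ → V) (ginf : V) : Prop :=
  ContDiffOn ℝ ∞ g (Ici 0) ∧ ∃ C, ∀ z ≥ 0, ‖g z - ginf‖ ≤ C * Real.exp (-(δ * z))

variable {δ : ℝ}

theorem ExpConv.congr {g g' : ℝ → V} {ginf : V} (h : ExpConv δ g ginf)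
    (he : ∀ z ≥ 0, g' z = g z) : ExpConv δ g' ginf := by
  obtain ⟨h1, C, hC⟩ := h
  exact ⟨h1.congr he, C, fun z hz => by rw [he z hz]; exact hC z hz⟩

theorem expConv_const (c : V) : ExpConv δ (fun _ => c) c :=
  ⟨contDiffOn_const, 0, fun z _ => by simp⟩

theorem ExpConv.add {g h : ℝ → V} {a b : V} (hg : ExpConv δ g a) (hh : ExpConv δ h b) :
    ExpConv δ (fun z => g z + h z) (a + b) := by
  obtain ⟨h1, C, hC⟩ := hg
  obtain ⟨h2, D, hD⟩ := hh
  refine ⟨h1.add h2, C + D, fun z hz => ?_⟩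
  rw [add_sub_add_comm, add_mul]
  exact (norm_add_le _ _).trans (add_le_add (hC z hz) (hD z hz))

theorem ExpConv.clm_comp {W : Type*} [NormedAddCommGroup W] [NormedSpace ℝ W] {g : ℝ → V} {a : V}
    (hg : ExpConv δ g a) (T : V →L[ℝ] W) : ExpConv δ (fun z => T (g z)) (T a) := by
  obtain ⟨h1, C, hC⟩ := hg
  refine ⟨T.contDiff.comp_contDiffOn h1, ‖T‖ * C, fun z hz => ?_⟩
  rw [← map_sub, mul_assoc]
  exact (T.le_opNorm _).trans (by gcongr; exact hC z hz)

theorem ExpConv.mul {𝔸 : Type*} [NormedRing 𝔸] [NormedAlgebra ℝ 𝔸] {g h : ℝ → 𝔸} {a b : 𝔸}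
    (hδ : 0 < δ) (hg : ExpConv δ g a) (hh : ExpConv δ h b) :
    ExpConv δ (fun z => g z * h z) (a * b) := by
  obtain ⟨h1, C, hC⟩ := hg
  obtain ⟨h2, D, hD⟩ := hh
  refine ⟨h1.mul h2, C * (|D| + ‖b‖) + ‖a‖ * D, fun z hz => ?_⟩
  have hC0 : 0 ≤ C * Real.exp (-(δ * z)) := (norm_nonneg _).trans (hC z hz)
  have hb : ‖h z‖ ≤ |D| + ‖b‖ := by
    have h3 : ‖h z‖ ≤ ‖h z - b‖ + ‖b‖ := by simpa using norm_add_le (h z - b) b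
    have h4 : D * Real.exp (-(δ * z)) ≤ |D| := by
      calc _ ≤ |D| * Real.exp (-(δ * z)) := by gcongr; exact le_abs_self _
        _ ≤ |D| * 1 := by
          gcongr
          rw [Real.exp_le_one_iff]
          have : 0 ≤ δ * z := by positivity
          linarith
        _ = |D| := mul_one _
    linarith [hD z hz]
  have e : g z * h z - a * b = (g z - a) * h z + a * (h z - b) := by noncomm_ring
  rw [e]
  calc _ ≤ ‖g z - a‖ * ‖h z‖ + ‖a‖ * ‖h z - b‖ :=
        (norm_add_le _ _).trans (add_le_add (norm_mul_le _ _) (norm_mul_le _ _))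
    _ ≤ (C * Real.exp (-(δ * z))) * (|D| + ‖b‖) + ‖a‖ * (D * Real.exp (-(δ * z))) := by
        gcongr
        · exact hC z hz
        · exact hD z hz
    _ = _ := by ring

/-- Differentiability of f at the limit gives a Lipschitz bound once w is close to it. On the
remaining compact interval the difference is bounded, and e^{-δz} is bounded below there. -/
theorem ExpConv.comp {W : Type*} [NormedAddCommGroup W] [NormedSpace ℝ W] (hδ : 0 < δ)
    {w : ℝ → V} {winf : V} (hw : ExpConv δ w winf) {O : Set V} (hO : IsOpen O)
    (hwO : ∀ z ≥ 0, w z ∈ O) (hinf : winf ∈ O) {f : V → W} (hf : ContDiffOn ℝ ∞ f O) :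
    ExpConv δ (fun z => f (w z)) (f winf) := by
  obtain ⟨h1, C, hC⟩ := hw
  have hc : ContDiffOn ℝ ∞ (fun z => f (w z)) (Ici 0) := hf.comp h1 fun z hz => hwO z hz
  refine ⟨hc, ?_⟩
  have hd : DifferentiableAt ℝ f winf :=
    ((hf.contDiffAt (hO.mem_nhds hinf)).differentiableAt (by simp))
  obtain ⟨K, hK⟩ := hd.hasFDerivAt.isBigO_sub.bound
  have hlim : Tendsto w atTop (𝓝 winf) := by
    rw [tendsto_iff_norm_sub_tendsto_zero]
    refine squeeze_zero' (Eventually.of_forall fun _ => norm_nonneg _)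
      ((eventually_ge_atTop 0).mono fun s hs => hC s hs) ?_
    have := (Real.tendsto_exp_neg_atTop_nhds_zero.comp
        (tendsto_id.const_mul_atTop hδ)).const_mul C
    rwa [mul_zero] at this
  obtain ⟨Z, hZ⟩ := (hlim.eventually hK).exists_forall_of_atTop
  obtain ⟨B, hB⟩ := (isCompact_Icc (a := (0 : ℝ)) (b := Z)).exists_bound_of_continuousOn
    ((hc.continuousOn.sub (continuousOn_const (c := f winf))).mono Icc_subset_Ici_self)
  refine ⟨max (|K| * C) (|B| * Real.exp (δ * Z)), fun z hz => ?_⟩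
  rcases le_total z Z with h | h
  · have h2 : ‖f (w z) - f winf‖ ≤ |B| := (hB z ⟨hz, h⟩).trans (le_abs_self _)
    calc _ ≤ |B| * 1 := by linarith
      _ ≤ |B| * (Real.exp (δ * Z) * Real.exp (-(δ * z))) := by
        gcongr
        rw [← Real.exp_add, Real.one_le_exp_iff]
        nlinarith
      _ = (|B| * Real.exp (δ * Z)) * Real.exp (-(δ * z)) := by ring
      _ ≤ _ := by gcongr; exact le_max_right _ _
  · calc _ ≤ K * ‖w z - winf‖ := hZ z h
      _ ≤ |K| * (C * Real.exp (-(δ * z))) := by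
        gcongr
        · exact le_abs_self _
        · exact hC z hz
      _ = (|K| * C) * Real.exp (-(δ * z)) := by ring
      _ ≤ _ := by gcongr; exact le_max_left _ _

/-- Functions converging at the rate `e^{-δz}` together with `n` derivatives. -/
def ExpReg (δ : ℝ) : ℕ → (ℝ → ℝ) → ℝ → Prop
  | 0, g, a => ExpConv δ g a
  | n + 1, g, a => ExpConv δ g a ∧ ExpReg δ n (derivWithin g (Ici 0)) 0

theorem ExpReg.congr {n : ℕ} {g g' : ℝ → ℝ} {a : ℝ} (h : ExpReg δ n g a)
    (he : ∀ z ≥ 0, g' z = g z) : ExpReg δ n g' a := by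
  induction n generalizing g g' a with
  | zero => exact ExpConv.congr h he
  | succ n ih =>
    exact ⟨h.1.congr he, ih h.2 fun z hz => derivWithin_congr he (he z hz)⟩

theorem ExpReg.mono {n : ℕ} {g : ℝ → ℝ} {a : ℝ} (h : ExpReg δ (n + 1) g a) : ExpReg δ n g a := by
  induction n generalizing g a with
  | zero => exact h.1
  | succ n ih => exact ⟨h.1, ih h.2⟩

theorem ExpConv.differentiableWithinAt {g : ℝ → ℝ} {a : ℝ} (h : ExpConv δ g a) {z : ℝ}
    (hz : 0 ≤ z) : DifferentiableWithinAt ℝ g (Ici 0) z :=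
  h.1.differentiableOn (by simp) z hz

theorem ExpReg.add {n : ℕ} {g h : ℝ → ℝ} {a b : ℝ} (hg : ExpReg δ n g a) (hh : ExpReg δ n h b) :
    ExpReg δ n (fun z => g z + h z) (a + b) := by
  induction n generalizing g h a b with
  | zero => exact ExpConv.add hg hh
  | succ n ih =>
    refine ⟨hg.1.add hh.1, ?_⟩
    have := ih hg.2 hh.2
    rw [add_zero] at this
    refine this.congr fun z hz => ?_
    exact derivWithin_fun_add (hg.1.differentiableWithinAt hz) (hh.1.differentiableWithinAt hz)

theorem expReg_const (n : ℕ) (c : ℝ) : ExpReg δ n (fun _ => c) c := by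
  induction n generalizing c with
  | zero => exact expConv_const c
  | succ n ih => exact ⟨expConv_const c, (ih 0).congr fun z _ => by simp⟩

theorem ExpReg.mul (hδ : 0 < δ) {n : ℕ} {g h : ℝ → ℝ} {a b : ℝ} (hg : ExpReg δ n g a)
    (hh : ExpReg δ n h b) : ExpReg δ n (fun z => g z * h z) (a * b) := by
  induction n generalizing g h a b with
  | zero => exact ExpConv.mul hδ hg hh
  | succ n ih =>
    refine ⟨hg.1.mul hδ hh.1, ?_⟩
    have := (ih hg.2 hh.mono).add (ih hg.mono hh.2)
    rw [zero_mul, mul_zero, add_zero] at this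
    refine this.congr fun z hz => ?_
    exact derivWithin_fun_mul (hg.1.differentiableWithinAt hz) (hh.1.differentiableWithinAt hz)

theorem ExpReg.sum {ι : Type*} (s : Finset ι) {n : ℕ} {g : ι → ℝ → ℝ} {a : ι → ℝ}
    (hg : ∀ i, ExpReg δ n (g i) (a i)) : ExpReg δ n (fun z => ∑ i ∈ s, g i z) (∑ i ∈ s, a i) := by
  classical
  induction s using Finset.induction_on with
  | empty => exact expReg_const n 0
  | insert i s hi ih =>
    simp_rw [Finset.sum_insert hi]
    exact (hg i).add ih

end ExpConv

namespace BVP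

variable {n₁ n₂ m p q r : ℕ} {S : BVP n₁ n₂ m p q r} {w : ℝ → State n₁ n₂} {uinf : State n₁ n₂}

/-- The exponential rate of a profile. -/
theorem IsProfile.exists_rate (hw : S.IsProfile w uinf) : ∃ δ > 0, ∀ j : ℕ,
    ExpConv δ (iteratedDerivWithin j (fun s => w s - uinf) (Ici 0)) 0 := by
  obtain ⟨δ, hδ, h⟩ := hw.exp_conv
  refine ⟨δ, hδ, fun j => ⟨?_, ?_⟩⟩
  · have hs : ContDiffOn ℝ ∞ (fun s => w s - uinf) (Ici 0) := hw.smooth.sub contDiffOn_const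
    induction j with
    | zero => simpa [iteratedDerivWithin_zero] using hs
    | succ j ih =>
      rw [iteratedDerivWithin_succ]
      exact contDiffOn_derivWithin_Ici ih
  · obtain ⟨C, hC⟩ := h j
    refine ⟨C, fun z hz => ?_⟩
    rw [sub_zero, Real.exp_neg, ← div_eq_mul_inv, le_div_iff₀ (Real.exp_pos _), mul_comm]
    exact hC z hz

end BVP

/-! ### Coefficients as finite sums of products p(ζ) g(z), the form required by the conjugator
construction. -/

section Sep

variable {F : Type*} [NormedAddCommGroup F] [NormedSpace ℝ F] {δ : ℝ}

/-- Finite sums `∑ p_i(ζ) g_i(z)` with smooth `p_i` and exponentially converging `g_i`. -/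
def Sep (δ : ℝ) (f : ℝ → F → ℂ) (finf : F → ℂ) : Prop :=
  ∃ (ι : Type) (_ : Fintype ι) (p : ι → F → ℂ) (g : ι → ℝ → ℂ) (ginf : ι → ℂ),
    (∀ i, ContDiff ℝ ∞ (p i)) ∧ (∀ i, ExpConv δ (g i) (ginf i)) ∧
    (∀ z ≥ 0, ∀ ζ, f z ζ = ∑ i, p i ζ * g i z) ∧ ∀ ζ, finf ζ = ∑ i, p i ζ * ginf i

theorem Sep.congr {f f' : ℝ → F → ℂ} {a a' : F → ℂ} (h : Sep δ f a)
    (he : ∀ z ≥ 0, ∀ ζ, f' z ζ = f z ζ) (ha : ∀ ζ, a' ζ = a ζ) : Sep δ f' a' := by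
  obtain ⟨ι, _, p, g, ginf, hp, hg, h1, h2⟩ := h
  exact ⟨ι, _, p, g, ginf, hp, hg, fun z hz ζ => (he z hz ζ).trans (h1 z hz ζ),
    fun ζ => (ha ζ).trans (h2 ζ)⟩

theorem Sep.add {f f' : ℝ → F → ℂ} {a a' : F → ℂ} (h : Sep δ f a) (h' : Sep δ f' a') :
    Sep δ (fun z ζ => f z ζ + f' z ζ) (fun ζ => a ζ + a' ζ) := by
  obtain ⟨ι, _, p, g, ginf, hp, hg, h1, h2⟩ := h
  obtain ⟨ι', _, p', g', ginf', hp', hg', h1', h2'⟩ := h'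
  refine ⟨ι ⊕ ι', inferInstance, Sum.elim p p', Sum.elim g g', Sum.elim ginf ginf', ?_, ?_,
    fun z hz ζ => ?_, fun ζ => ?_⟩
  · rintro (i | i)
    · exact hp i
    · exact hp' i
  · rintro (i | i)
    · exact hg i
    · exact hg' i
  · simp [h1 z hz ζ, h1' z hz ζ]
  · simp [h2 ζ, h2' ζ]

theorem Sep.mul (hδ : 0 < δ) {f f' : ℝ → F → ℂ} {a a' : F → ℂ} (h : Sep δ f a)
    (h' : Sep δ f' a') : Sep δ (fun z ζ => f z ζ * f' z ζ) (fun ζ => a ζ * a' ζ) := by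
  obtain ⟨ι, _, p, g, ginf, hp, hg, h1, h2⟩ := h
  obtain ⟨ι', _, p', g', ginf', hp', hg', h1', h2'⟩ := h'
  refine ⟨ι × ι', inferInstance, fun i ζ => p i.1 ζ * p' i.2 ζ, fun i z => g i.1 z * g' i.2 z,
    fun i => ginf i.1 * ginf' i.2, fun i => (hp i.1).mul (hp' i.2),
    fun i => (hg i.1).mul hδ (hg' i.2), fun z hz ζ => ?_, fun ζ => ?_⟩
  · beta_reduce
    rw [h1 z hz ζ, h1' z hz ζ, Finset.sum_mul_sum, Fintype.sum_prod_type]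
    exact Finset.sum_congr rfl fun _ _ => Finset.sum_congr rfl fun _ _ => by ring
  · beta_reduce
    rw [h2 ζ, h2' ζ, Finset.sum_mul_sum, Fintype.sum_prod_type]
    exact Finset.sum_congr rfl fun _ _ => Finset.sum_congr rfl fun _ _ => by ring

theorem sep_param {p : F → ℂ} (hp : ContDiff ℝ ∞ p) : Sep δ (fun _ => p) p :=
  ⟨Unit, inferInstance, fun _ => p, fun _ _ => 1, fun _ => 1, fun _ => hp,
    fun _ => expConv_const 1, by simp, by simp⟩

theorem sep_const (c : ℂ) : Sep δ (fun _ (_ : F) => c) (fun _ => c) := sep_param contDiff_const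

theorem ExpConv.sep {g : ℝ → ℝ} {a : ℝ} (h : ExpConv δ g a) :
    Sep δ (fun z (_ : F) => (g z : ℂ)) (fun _ => (a : ℂ)) :=
  ⟨Unit, inferInstance, fun _ _ => 1, fun _ z => (g z : ℂ), fun _ => (a : ℂ),
    fun _ => contDiff_const, fun _ => h.clm_comp Complex.ofRealCLM, by simp, by simp⟩

theorem Sep.neg (hδ : 0 < δ) {f : ℝ → F → ℂ} {a : F → ℂ} (h : Sep δ f a) :
    Sep δ (fun z ζ => -f z ζ) (fun ζ => -a ζ) :=
  ((sep_const (-1)).mul hδ h).congr (by simp) (by simp)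

theorem Sep.sum {κ : Type*} (s : Finset κ) {f : κ → ℝ → F → ℂ} {a : κ → F → ℂ}
    (h : ∀ k, Sep δ (f k) (a k)) :
    Sep δ (fun z ζ => ∑ k ∈ s, f k z ζ) (fun ζ => ∑ k ∈ s, a k ζ) := by
  classical
  induction s using Finset.induction_on with
  | empty => exact (sep_const 0).congr (by simp) (by simp)
  | insert i s hi ih =>
    simp_rw [Finset.sum_insert hi]
    exact (h i).add ih

variable {α β κ α' β' : Type*}

/-- Entrywise version of `Sep`. -/
def SepMatrix (δ : ℝ) (M : ℝ → F → Matrix α β ℂ) (Minf : F → Matrix α β ℂ) : Prop :=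
  ∀ i j, Sep δ (fun z ζ => M z ζ i j) (fun ζ => Minf ζ i j)

variable {M N : ℝ → F → Matrix α β ℂ} {Minf Ninf : F → Matrix α β ℂ}

theorem SepMatrix.congr (h : SepMatrix δ M Minf) (he : ∀ z ≥ 0, ∀ ζ, N z ζ = M z ζ)
    (ha : ∀ ζ, Ninf ζ = Minf ζ) : SepMatrix δ N Ninf :=
  fun i j => (h i j).congr (fun z hz ζ => by rw [he z hz ζ]) fun ζ => by rw [ha ζ]

theorem SepMatrix.add (h : SepMatrix δ M Minf) (h' : SepMatrix δ N Ninf) :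
    SepMatrix δ (fun z ζ => M z ζ + N z ζ) (fun ζ => Minf ζ + Ninf ζ) :=
  fun i j => (h i j).add (h' i j)

theorem SepMatrix.neg (hδ : 0 < δ) (h : SepMatrix δ M Minf) :
    SepMatrix δ (fun z ζ => -M z ζ) (fun ζ => -Minf ζ) :=
  fun i j => (h i j).neg hδ

theorem SepMatrix.sub (hδ : 0 < δ) (h : SepMatrix δ M Minf) (h' : SepMatrix δ N Ninf) :
    SepMatrix δ (fun z ζ => M z ζ - N z ζ) (fun ζ => Minf ζ - Ninf ζ) :=
  (h.add (h'.neg hδ)).congr (fun _ _ _ => sub_eq_add_neg _ _) fun _ => sub_eq_add_neg _ _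

theorem SepMatrix.sum {κ : Type*} (s : Finset κ) {M : κ → ℝ → F → Matrix α β ℂ}
    {Minf : κ → F → Matrix α β ℂ} (h : ∀ k, SepMatrix δ (M k) (Minf k)) :
    SepMatrix δ (fun z ζ => ∑ k ∈ s, M k z ζ) (fun ζ => ∑ k ∈ s, Minf k ζ) :=
  fun i j => (Sep.sum s fun k => h k i j).congr (fun _ _ _ => Matrix.sum_apply i j s _)
    fun _ => Matrix.sum_apply i j s _

theorem SepMatrix.smul (hδ : 0 < δ) {f : F → ℂ} (hf : ContDiff ℝ ∞ f)
    (h : SepMatrix δ M Minf) :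
    SepMatrix δ (fun z ζ => f ζ • M z ζ) (fun ζ => f ζ • Minf ζ) :=
  fun i j => (sep_param hf).mul hδ (h i j)

theorem SepMatrix.mul [Fintype β] (hδ : 0 < δ) {N : ℝ → F → Matrix β κ ℂ} {Ninf : F → Matrix β κ ℂ}
    (h : SepMatrix δ M Minf) (h' : SepMatrix δ N Ninf) :
    SepMatrix δ (fun z ζ => M z ζ * N z ζ) (fun ζ => Minf ζ * Ninf ζ) :=
  fun i j => Sep.sum Finset.univ fun k => (h i k).mul hδ (h' k j)

theorem SepMatrix.submatrix (h : SepMatrix δ M Minf) (f : α' → α) (g : β' → β) :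
    SepMatrix δ (fun z ζ => (M z ζ).submatrix f g) (fun ζ => (Minf ζ).submatrix f g) :=
  fun i j => h (f i) (g j)

theorem sepMatrix_const (A : Matrix α β ℂ) : SepMatrix δ (fun _ (_ : F) => A) (fun _ => A) :=
  fun i j => sep_const (A i j)

theorem sepMatrix_cx {A : ℝ → Matrix α β ℝ} {Ainf : Matrix α β ℝ}
    (h : ∀ i j, ExpConv δ (fun z => A z i j) (Ainf i j)) :
    SepMatrix δ (fun z (_ : F) => cx (A z)) (fun _ => cx Ainf) :=
  fun i j => (h i j).sep

theorem SepMatrix.fromBlocks {A : ℝ → F → Matrix α β ℂ} {B : ℝ → F → Matrix α β' ℂ}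
    {C : ℝ → F → Matrix α' β ℂ} {D : ℝ → F → Matrix α' β' ℂ} {A' : F → Matrix α β ℂ}
    {B' : F → Matrix α β' ℂ} {C' : F → Matrix α' β ℂ} {D' : F → Matrix α' β' ℂ}
    (hA : SepMatrix δ A A') (hB : SepMatrix δ B B') (hC : SepMatrix δ C C')
    (hD : SepMatrix δ D D') :
    SepMatrix δ (fun z ζ => Matrix.fromBlocks (A z ζ) (B z ζ) (C z ζ) (D z ζ))
      (fun ζ => Matrix.fromBlocks (A' ζ) (B' ζ) (C' ζ) (D' ζ)) := by
  rintro (i | i) (j | j)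
  · exact hA i j
  · exact hB i j
  · exact hC i j
  · exact hD i j

theorem SepMatrix.fromRows {A : ℝ → F → Matrix α β ℂ} {B : ℝ → F → Matrix α' β ℂ}
    {A' : F → Matrix α β ℂ} {B' : F → Matrix α' β ℂ}
    (hA : SepMatrix δ A A') (hB : SepMatrix δ B B') :
    SepMatrix δ (fun z ζ => Matrix.fromRows (A z ζ) (B z ζ))
      (fun ζ => Matrix.fromRows (A' ζ) (B' ζ)) := by
  rintro (i | i) j
  · exact hA i j
  · exact hB i j

theorem SepMatrix.fromCols {A : ℝ → F → Matrix α β ℂ} {B : ℝ → F → Matrix α β' ℂ}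
    {A' : F → Matrix α β ℂ} {B' : F → Matrix α β' ℂ}
    (hA : SepMatrix δ A A') (hB : SepMatrix δ B B') :
    SepMatrix δ (fun z ζ => Matrix.fromCols (A z ζ) (B z ζ))
      (fun ζ => Matrix.fromCols (A' ζ) (B' ζ)) := by
  rintro i (j | j)
  · exact hA i j
  · exact hB i j

variable {n₁ n₂ : ℕ}

/-- The entries are polynomial in those of a, e and of the two inverses. The inverses are separate
hypotheses because inversion does not preserve finite sums of products. -/
theorem SepMatrix.firstOrder (hδ : 0 < δ)
    {b a e : ℝ → F → Matrix (Fin n₁ ⊕ Fin n₂) (Fin n₁ ⊕ Fin n₂) ℂ}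
    {b' a' e' : F → Matrix (Fin n₁ ⊕ Fin n₂) (Fin n₁ ⊕ Fin n₂) ℂ}
    (ha : SepMatrix δ a a') (he : SepMatrix δ e e')
    (hbi : SepMatrix δ (fun z ζ => (b z ζ).toBlocks₂₂⁻¹) (fun ζ => (b' ζ).toBlocks₂₂⁻¹))
    (hai : SepMatrix δ (fun z ζ => (a z ζ).toBlocks₁₁⁻¹) (fun ζ => (a' ζ).toBlocks₁₁⁻¹)) :
    SepMatrix δ (fun z ζ => firstOrder (b z ζ) (a z ζ) (e z ζ))
      (fun ζ => firstOrder (b' ζ) (a' ζ) (e' ζ)) := by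
  have a₁₂ := ha.submatrix Sum.inl (Sum.inr : Fin n₂ → _)
  have a₂₁ := ha.submatrix Sum.inr (Sum.inl : Fin n₁ → _)
  have a₂₂ := ha.submatrix Sum.inr (Sum.inr : Fin n₂ → _)
  have e₁₁ := he.submatrix Sum.inl (Sum.inl : Fin n₁ → _)
  have e₁₂ := he.submatrix Sum.inl (Sum.inr : Fin n₂ → _)
  have e₂₁ := he.submatrix Sum.inr (Sum.inl : Fin n₁ → _)
  have e₂₂ := he.submatrix Sum.inr (Sum.inr : Fin n₂ → _)
  exact ((((hai.mul hδ e₁₁).neg hδ).fromBlocks ((hai.mul hδ e₁₂).neg hδ) (sepMatrix_const 0)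
    (sepMatrix_const 0)).fromBlocks (((hai.mul hδ a₁₂).neg hδ).fromRows (sepMatrix_const 1))
    ((hbi.mul hδ (e₂₁.sub hδ ((a₂₁.mul hδ hai).mul hδ e₁₁))).fromCols
      (hbi.mul hδ (e₂₂.sub hδ ((a₂₁.mul hδ hai).mul hδ e₁₂))))
    (hbi.mul hδ (a₂₂.sub hδ ((a₂₁.mul hδ hai).mul hδ a₁₂))))

end Sep

/-! ### Conjugators for matrices given entrywise. -/

section MatrixConjugator

attribute [local instance] Matrix.linftyOpNormedRing Matrix.linftyOpNormedAlgebra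

variable {F : Type*} [NormedAddCommGroup F] [NormedSpace ℝ F] [FiniteDimensional ℝ F]
variable {α : Type} [Fintype α] [DecidableEq α]

theorem SepMatrix.exists_conjugator {δ : ℝ} (hδ : 0 < δ) {G : ℝ → F → Matrix α α ℂ}
    {Ginf : F → Matrix α α ℂ} (h : SepMatrix δ G Ginf) :
    ∃ ρ > 0, ∃ Φ : ℝ → F → Matrix α α ℂ,
      (∀ i j, ContDiffOn ℝ ∞ (fun x : ℝ × F => Φ x.1 x.2 i j) (Ici 0 ×ˢ Metric.ball 0 ρ)) ∧
      (∀ z ≥ 0, ∀ ζ ∈ Metric.ball (0 : F) ρ, (Φ z ζ).det ≠ 0) ∧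
      (∀ z ≥ 0, ∀ ζ ∈ Metric.ball (0 : F) ρ, ∀ i j, HasDerivWithinAt (fun s => Φ s ζ i j)
        ((G z ζ * Φ z ζ - Φ z ζ * Ginf ζ) i j) (Ici 0) z) ∧
      ∃ θ > 0, ∃ C : ℝ, ∀ z ≥ 0, ∀ ζ ∈ Metric.ball (0 : F) ρ, ∀ i j,
        ‖(Φ z ζ - 1) i j‖ ≤ C * Real.exp (-(θ * z)) ∧
        ‖((Φ z ζ)⁻¹ - 1) i j‖ ≤ C * Real.exp (-(θ * z)) := by
  choose ι hι p g ginf hp hg h1 h2 using h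
  have hfd : FiniteDimensional ℂ (Matrix α α ℂ) := inferInstance
  let entry : α → α → Matrix α α ℂ →ₗ[ℂ] ℂ := fun i j =>
    { toFun := fun M => M i j, map_add' := fun _ _ => rfl, map_smul' := fun _ _ => rfl }
  let ent : α → α → Matrix α α ℂ →L[ℂ] ℂ := fun i j => LinearMap.toContinuousLinearMap (entry i j)
  -- Terms are indexed by an entry together with a summand of that entry. The factor in ζ becomes a
  -- scalar matrix, and the factor in z a multiple of the matrix unit of the entry.
  let P : (Σ x : α × α, ι x.1 x.2) → F → Matrix α α ℂ := fun k ζ =>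
    algebraMap ℂ (Matrix α α ℂ) (p k.1.1 k.1.2 k.2 ζ)
  let T : α × α → ℂ →L[ℝ] Matrix α α ℂ := fun x =>
    ((ContinuousLinearMap.id ℂ ℂ).smulRight (Matrix.single x.1 x.2 (1 : ℂ))).restrictScalars ℝ
  have hT : ∀ x c, T x c = c • Matrix.single x.1 x.2 (1 : ℂ) := fun _ _ => rfl
  have hconv : ∀ k : (Σ x : α × α, ι x.1 x.2), ExpConv δ (fun z => T k.1 (g k.1.1 k.1.2 k.2 z))
      (T k.1 (ginf k.1.1 k.1.2 k.2)) := fun k => (hg k.1.1 k.1.2 k.2).clm_comp (T k.1)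
  have hsum : ∀ (c : ∀ i j, ι i j → ℂ) (ζ : F),
      ∑ k : (Σ x : α × α, ι x.1 x.2), P k ζ * T k.1 (c k.1.1 k.1.2 k.2) =
        Matrix.of fun i j => ∑ k, p i j k ζ * c i j k := by
    intro c ζ
    rw [Matrix.matrix_eq_sum_single (Matrix.of fun i j => ∑ k, p i j k ζ * c i j k),
      Fintype.sum_sigma, Fintype.sum_prod_type]
    refine Finset.sum_congr rfl fun i _ => Finset.sum_congr rfl fun j _ => ?_
    simp only [Matrix.of_apply, P, hT]
    rw [← Matrix.singleAddMonoidHom_apply (α := ℂ) i j (∑ k, p i j k ζ * c i j k), map_sum]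
    refine Finset.sum_congr rfl fun k _ => ?_
    rw [← Algebra.smul_def, smul_smul, Matrix.smul_single, smul_eq_mul, mul_one,
      Matrix.singleAddMonoidHom_apply]
  obtain ⟨ρ, hρ, Φ, hs, hu, hode, θ, hθ, C, hC⟩ := ViscousBoundary.exists_conjugator P
    (fun k => (algebraMapCLM ℂ (Matrix α α ℂ)).restrictScalars ℝ |>.contDiff.comp
      (hp k.1.1 k.1.2 k.2))
    (fun k z => T k.1 (g k.1.1 k.1.2 k.2 z)) (fun k => (hconv k).1)
    (fun k => T k.1 (ginf k.1.1 k.1.2 k.2)) hδ (fun k => (hconv k).2)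
  have hG : ∀ z ≥ 0, ∀ ζ, ∑ k : (Σ x : α × α, ι x.1 x.2),
      P k ζ * T k.1 (g k.1.1 k.1.2 k.2 z) = G z ζ := by
    intro z hz ζ
    rw [hsum (fun i j k => g i j k z)]
    ext i j
    exact (h1 i j z hz ζ).symm
  have hGinf : ∀ ζ, ∑ k : (Σ x : α × α, ι x.1 x.2),
      P k ζ * T k.1 (ginf k.1.1 k.1.2 k.2) = Ginf ζ := by
    intro ζ
    rw [hsum (fun i j k => ginf i j k)]
    ext i j
    exact (h2 i j ζ).symm
  have hle : ∀ (M : Matrix α α ℂ) i j, ‖M i j‖ ≤ ‖M‖ := by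
    intro M i j
    rw [Matrix.linfty_opNorm_def]
    have h3 : ‖M i j‖₊ ≤ Finset.univ.sup fun i => ∑ j, ‖M i j‖₊ :=
      (Finset.single_le_sum (f := fun j => ‖M i j‖₊) (fun _ _ => zero_le)
        (Finset.mem_univ j)).trans (Finset.le_sup (f := fun i => ∑ j, ‖M i j‖₊)
          (Finset.mem_univ i))
    exact_mod_cast h3
  refine ⟨ρ, hρ, Φ, fun i j => ?_, fun z hz ζ hζ => ?_, fun z hz ζ hζ i j => ?_, θ, hθ, C, fun z hz ζ hζ i j => ?_⟩
  · exact ((ent i j).restrictScalars ℝ).contDiff.comp_contDiffOn hs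
  · exact ((Matrix.isUnit_iff_isUnit_det _).1 (hu z hz ζ hζ)).ne_zero
  · have := hode z hz ζ hζ
    rw [hG z hz ζ, hGinf ζ] at this
    exact ((ent i j).restrictScalars ℝ).hasFDerivAt.comp_hasDerivWithinAt z this
  · obtain ⟨h3, h4⟩ := hC z hz ζ hζ
    rw [← Matrix.nonsing_inv_eq_ringInverse] at h4
    exact ⟨(hle _ i j).trans h3, (hle _ i j).trans h4⟩

end MatrixConjugator

/-! ### Smoothness of determinants and inverses. -/

section SmoothEntries

variable {E : Type*} [NormedAddCommGroup E] [NormedSpace ℝ E] {O : Set E}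
variable {𝕂 : Type*} [NormedField 𝕂] [NormedAlgebra ℝ 𝕂]
variable {α : Type*} [Fintype α] [DecidableEq α]

theorem contDiffOn_det {M : E → Matrix α α 𝕂} (h : ∀ i j, ContDiffOn ℝ ∞ (fun u => M u i j) O) :
    ContDiffOn ℝ ∞ (fun u => (M u).det) O := by
  simp_rw [Matrix.det_apply]
  exact ContDiffOn.sum fun σ _ => (contDiffOn_prod fun i _ => h _ _).const_smul _

theorem contDiffOn_inv_apply {M : E → Matrix α α 𝕂}
    (h : ∀ i j, ContDiffOn ℝ ∞ (fun u => M u i j) O) (hdet : ∀ u ∈ O, (M u).det ≠ 0) (i j : α) :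
    ContDiffOn ℝ ∞ (fun u => (M u)⁻¹ i j) O := by
  simp_rw [Matrix.inv_def, Matrix.smul_apply, Matrix.adjugate_apply, Ring.inverse_eq_inv]
  refine ContDiffOn.mul ((contDiffOn_det h).inv hdet) (contDiffOn_det fun k l => ?_)
  simp_rw [Matrix.updateRow_apply]
  split_ifs
  · exact contDiffOn_const
  · exact h k l

theorem cx_inv {M : Matrix α α ℝ} (h : M.det ≠ 0) : (cx M)⁻¹ = cx M⁻¹ := by
  refine Matrix.inv_eq_left_inv ?_
  have h1 : M⁻¹ * M = 1 := Matrix.nonsing_inv_mul M (isUnit_iff_ne_zero.2 h)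
  have h2 : (M⁻¹ * M).map (Complex.ofRealHom) = (1 : Matrix α α ℝ).map Complex.ofRealHom := by
    rw [h1]
  rw [Matrix.map_mul, Matrix.map_one _ (map_zero _) (map_one _)] at h2
  exact h2

end SmoothEntries

/-! ### Convergence of the linearized coefficients along the profile. -/

namespace BVP

variable {n₁ n₂ m p q r : ℕ} {S : BVP n₁ n₂ m p q r} {w : ℝ → State n₁ n₂} {uinf : State n₁ n₂}
variable {δ : ℝ}

theorem expReg_iteratedDerivWithin
    (h : ∀ j : ℕ, ExpConv δ (iteratedDerivWithin j (fun s => w s - uinf) (Ici 0)) 0)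
    (k : Fin n₁ ⊕ Fin n₂) (n j : ℕ) :
    ExpReg δ n (fun z => iteratedDerivWithin j (fun s => w s - uinf) (Ici 0) z k) 0 := by
  have h0 : ∀ j, ExpConv δ
      (fun z => iteratedDerivWithin j (fun s => w s - uinf) (Ici 0) z k) 0 := fun j =>
    (h j).clm_comp (ContinuousLinearMap.proj (R := ℝ) (φ := fun _ => ℝ) k)
  induction n generalizing j with
  | zero => exact h0 j
  | succ n ih =>
    refine ⟨h0 j, (ih (j + 1)).congr fun z hz => ?_⟩
    have hd : DifferentiableWithinAt ℝ
        (iteratedDerivWithin j (fun s => w s - uinf) (Ici 0)) (Ici 0) z :=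
      (h j).1.differentiableOn (by simp) z hz
    rw [iteratedDerivWithin_succ]
    exact ((hasDerivWithinAt_pi.1 hd.hasDerivWithinAt) k).derivWithin
      (uniqueDiffOn_Ici 0 z hz)

theorem dw_eq (w : ℝ → State n₁ n₂) (uinf : State n₁ n₂) {z : ℝ} :
    dw w z = iteratedDerivWithin 1 (fun s => w s - uinf) (Ici 0) z := by
  rw [iteratedDerivWithin_one, derivWithin_sub_const]
  rfl

/-- By the chain rule the derivative is a sum of products of a partial derivative of f along w with
a component of w'. The first factor is covered by the induction applied to that partial derivative;
the second tends to 0, hence so does the sum. -/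
theorem expReg_comp (hδ : 0 < δ) (hw : ContDiffOn ℝ ∞ w (Ici 0))
    (h : ∀ j : ℕ, ExpConv δ (iteratedDerivWithin j (fun s => w s - uinf) (Ici 0)) 0)
    {O : Set (State n₁ n₂)} (hO : IsOpen O) (hwO : ∀ z ≥ 0, w z ∈ O) (hinf : uinf ∈ O)
    {f : State n₁ n₂ → ℝ} (hf : ContDiffOn ℝ ∞ f O) (n : ℕ) :
    ExpReg δ n (fun z => f (w z)) (f uinf) := by
  have hwc : ExpConv δ w uinf := by
    have := (h 0).add (expConv_const uinf)
    rw [zero_add] at this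
    exact this.congr fun z _ => by simp [iteratedDerivWithin_zero]
  induction n generalizing f with
  | zero => exact hwc.comp hδ hO hwO hinf hf
  | succ n ih =>
    refine ⟨hwc.comp hδ hO hwO hinf hf, ?_⟩
    have hs : ExpReg δ n (fun z => ∑ k, fderiv ℝ f (w z) (Pi.single k 1) *
        iteratedDerivWithin 1 (fun s => w s - uinf) (Ici 0) z k)
        (∑ k : Fin n₁ ⊕ Fin n₂, fderiv ℝ f uinf (Pi.single k 1) * 0) :=
      ExpReg.sum _ fun k => (ih (f := fun u => fderiv ℝ f u (Pi.single k 1))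
        ((hf.fderiv_of_isOpen hO (by simp)).clm_apply contDiffOn_const)).mul hδ
        (expReg_iteratedDerivWithin h k n 1)
    simp only [mul_zero, Finset.sum_const_zero] at hs
    refine hs.congr fun z hz => ?_
    have h1 : HasFDerivAt f (fderiv ℝ f (w z)) (w z) :=
      ((hf.contDiffAt (hO.mem_nhds (hwO z hz))).differentiableAt (by simp)).hasFDerivAt
    have h2 : HasDerivWithinAt w (dw w z) (Ici 0) z :=
      (hw.differentiableOn (by simp) z hz).hasDerivWithinAt
    rw [show (fun z => f (w z)) = f ∘ w from rfl,
      (h1.comp_hasDerivWithinAt z h2).derivWithin (uniqueDiffOn_Ici 0 z hz), ← dw_eq]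
    conv_lhs => rw [pi_eq_sum_univ' (dw w z), map_sum]
    refine Finset.sum_congr rfl fun k _ => ?_
    rw [map_smul, smul_eq_mul, mul_comm]

theorem expReg_derivMul (hδ : 0 < δ) (hw : ContDiffOn ℝ ∞ w (Ici 0))
    (h : ∀ j : ℕ, ExpConv δ (iteratedDerivWithin j (fun s => w s - uinf) (Ici 0)) 0)
    {O : Set (State n₁ n₂)} (hO : IsOpen O) (hwO : ∀ z ≥ 0, w z ∈ O) (hinf : uinf ∈ O)
    {M : State n₁ n₂ → Matrix (Fin n₁ ⊕ Fin n₂) (Fin n₁ ⊕ Fin n₂) ℝ}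
    (hM : ∀ i j, ContDiffOn ℝ ∞ (fun u => M u i j) O) (n : ℕ) (i l : Fin n₁ ⊕ Fin n₂) :
    ExpReg δ n (fun z => derivMul M (w z) (dw w z) i l) 0 := by
  have hs : ExpReg δ n (fun z => ∑ k, fderiv ℝ (fun u' => M u' i k) (w z) (Pi.single l 1) *
        iteratedDerivWithin 1 (fun s => w s - uinf) (Ici 0) z k)
        (∑ k : Fin n₁ ⊕ Fin n₂, fderiv ℝ (fun u' => M u' i k) uinf (Pi.single l 1) * 0) :=
    ExpReg.sum _ fun k => (expReg_comp hδ hw h hO hwO hinf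
      (f := fun u => fderiv ℝ (fun u' => M u' i k) u (Pi.single l 1))
      (((hM i k).fderiv_of_isOpen hO (by simp)).clm_apply contDiffOn_const) n).mul hδ
        (expReg_iteratedDerivWithin h k n 1)
  simp only [mul_zero, Finset.sum_const_zero] at hs
  exact hs.congr fun z _ => by simp [derivMul, dw_eq w uinf]

/-- The viscosity terms have vanishing first rows on the open set 𝒰*, hence so do their derivatives.
The matrix to be inverted is thereby independent of ζ, which keeps 𝒢 a finite sum of products. -/
theorem Admissible.toBlocks₁₁_calA (hS : S.Admissible) (hw : S.IsProfile w uinf) {z : ℝ}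
    (hz : 0 ≤ z) (ζ : Freq m) :
    (S.calA w z ζ).toBlocks₁₁ = cx (S.An (w z)).toBlocks₁₁ := by
  have hB : ∀ a b, ∀ u ∈ S.Ustar, ∀ (i : Fin n₁) k, S.B a b u (Sum.inl i) k = 0 := by
    intro a b u hu i k
    rw [hS.B_block a b u hu]
    cases k <;> rfl
  ext i j
  have h1 : dz (fun s => S.B (Fin.last m) (Fin.last m) (w s)) z (Sum.inl i) (Sum.inl j) = 0 := by
    simp only [dz, Matrix.of_apply]
    exact (derivWithin_congr (f := fun _ => 0) (fun s hs => hB _ _ _ (hw.mem_Ustar s hs) i _)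
      (hB _ _ _ (hw.mem_Ustar z hz) i _)).trans
      (congrFun (derivWithin_const _ _) z)
  have h2 : derivMul (S.B (Fin.last m) (Fin.last m)) (w z) (dw w z) (Sum.inl i) (Sum.inl j)
      = 0 := by
    simp only [derivMul, Matrix.of_apply]
    refine Finset.sum_eq_zero fun k _ => ?_
    have h3 : (fun u' => S.B (Fin.last m) (Fin.last m) u' (Sum.inl i) k) =ᶠ[𝓝 (w z)]
        fun _ => 0 := by
      filter_upwards [hS.isOpen_Ustar.mem_nhds (hw.mem_Ustar z hz)] with u hu
      exact hB _ _ u hu i k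
    rw [h3.fderiv_eq]
    simp
  simp [Matrix.toBlocks₁₁, calA, cx, h1, h2, Matrix.sum_apply, hB _ _ _ (hw.mem_Ustar z hz)]

theorem Admissible.det_toBlocks₂₂_A0 (hS : S.Admissible) {u : State n₁ n₂} (hu : u ∈ S.Ustar) :
    (S.A0 u).toBlocks₂₂.det ≠ 0 := by
  have h := hS.det_A0 u hu
  rw [← Matrix.fromBlocks_toBlocks (S.A0 u), hS.A0_block u hu,
    Matrix.det_fromBlocks_zero₁₂] at h
  exact right_ne_zero_of_mul h

theorem Admissible.det_toBlocks₁₁_A0 (hS : S.Admissible) {u : State n₁ n₂} (hu : u ∈ S.Ustar) :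
    (S.A0 u).toBlocks₁₁.det ≠ 0 := by
  have h := hS.det_A0 u hu
  rw [← Matrix.fromBlocks_toBlocks (S.A0 u), hS.A0_block u hu,
    Matrix.det_fromBlocks_zero₁₂] at h
  exact left_ne_zero_of_mul h

theorem Bbar_single (S : BVP n₁ n₂ m p q r) (u : State n₁ n₂) (a : ℝ) :
    S.Bbar u (EuclideanSpace.single (Fin.last m) a) =
      (a * a) • ((S.A0 u)⁻¹ * S.B (Fin.last m) (Fin.last m) u) := by
  unfold Bbar
  rw [Finset.sum_eq_single (Fin.last m), Finset.sum_eq_single (Fin.last m)]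
  · simp
  · intro b _ hb
    simp [hb]
  · simp
  · intro b _ hb
    exact Finset.sum_eq_zero fun k _ => by simp [hb]
  · simp

theorem Abar_single (S : BVP n₁ n₂ m p q r) (u : State n₁ n₂) (a : ℝ) :
    S.Abar u (EuclideanSpace.single (Fin.last m) a) = a • ((S.A0 u)⁻¹ * S.An u) := by
  unfold Abar
  rw [Finset.sum_eq_single (Fin.last m)]
  · simp [An]
  · intro b _ hb
    simp [hb]
  · simp

/-- A₀ is block lower triangular, so A₀⁻¹B inherits from B a vanishing (1,2) block. Multiplying back
by A₀ then involves only the (2,2) blocks. -/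
theorem Admissible.toBlocks₂₂_B_eq (hS : S.Admissible) {u : State n₁ n₂} (hu : u ∈ S.Ustar)
    (a b : Fin (m + 1)) :
    (S.B a b u).toBlocks₂₂ =
      (S.A0 u).toBlocks₂₂ * ((S.A0 u)⁻¹ * S.B a b u).toBlocks₂₂ := by
  have h1 : S.A0 u * ((S.A0 u)⁻¹ * S.B a b u) = S.B a b u := by
    rw [← mul_assoc, Matrix.mul_nonsing_inv _ (isUnit_iff_ne_zero.2 (hS.det_A0 u hu)), one_mul]
  have h2 : ((S.A0 u)⁻¹ * S.B a b u).toBlocks₁₂ = 0 := by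
    have h3 : (S.A0 u).toBlocks₁₁ * ((S.A0 u)⁻¹ * S.B a b u).toBlocks₁₂ = 0 := by
      have h4 : (S.A0 u * ((S.A0 u)⁻¹ * S.B a b u)).toBlocks₁₂ = 0 := by
        rw [h1, hS.B_block a b u hu]
        rfl
      rw [← Matrix.fromBlocks_toBlocks (S.A0 u),
        ← Matrix.fromBlocks_toBlocks ((Matrix.fromBlocks _ _ _ _)⁻¹ * S.B a b u),
        Matrix.fromBlocks_multiply, Matrix.toBlocks_fromBlocks₁₂, hS.A0_block u hu] at h4
      rw [← Matrix.fromBlocks_toBlocks (S.A0 u), hS.A0_block u hu]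
      simpa using h4
    have := congrArg (fun Y => (S.A0 u).toBlocks₁₁⁻¹ * Y) h3
    beta_reduce at this
    rwa [Matrix.mul_zero, Matrix.nonsing_inv_mul_cancel_left _ _
      (isUnit_iff_ne_zero.2 (hS.det_toBlocks₁₁_A0 hu))] at this
  have h5 : (S.A0 u * ((S.A0 u)⁻¹ * S.B a b u)).toBlocks₂₂ = (S.A0 u).toBlocks₂₁ *
      ((S.A0 u)⁻¹ * S.B a b u).toBlocks₁₂ + (S.A0 u).toBlocks₂₂ *
      ((S.A0 u)⁻¹ * S.B a b u).toBlocks₂₂ := by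
    generalize (S.A0 u)⁻¹ * S.B a b u = Y
    generalize S.A0 u = X
    conv_lhs => rw [← Matrix.fromBlocks_toBlocks X, ← Matrix.fromBlocks_toBlocks Y,
      Matrix.fromBlocks_multiply, Matrix.toBlocks_fromBlocks₂₂]
  rwa [h1, h2, Matrix.mul_zero, zero_add] at h5

/-- Parabolicity at the unit normal frequency excludes the eigenvalue 0. -/
theorem Admissible.det_toBlocks₂₂_B (hS : S.Admissible) {u : State n₁ n₂} (hu : u ∈ S.Ustar) :
    (S.B (Fin.last m) (Fin.last m) u).toBlocks₂₂.det ≠ 0 := by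
  rw [hS.toBlocks₂₂_B_eq hu, Matrix.det_mul]
  refine mul_ne_zero (hS.det_toBlocks₂₂_A0 hu) ?_
  obtain ⟨c, hc, h⟩ := hS.parabolic
  have h1 := h u hu (EuclideanSpace.single (Fin.last m) 1)
  rw [Bbar_single] at h1
  simp only [mul_one, one_smul, PiLp.norm_single, norm_one, one_pow] at h1
  intro hdet
  set X := ((S.A0 u)⁻¹ * S.B (Fin.last m) (Fin.last m) u).toBlocks₂₂
  have h2 : (0 : ℂ) ∈ spectrum ℂ (cx X) := by
    rw [spectrum.zero_mem_iff, Matrix.isUnit_iff_isUnit_det]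
    have : (cx X).det = ((X.det : ℝ) : ℂ) := (RingHom.map_det Complex.ofRealHom X).symm
    rw [this, hdet]
    simp
  have := h1 0 h2
  simp at this
  linarith

theorem contDiff_freq_coord (i : Fin m ⊕ Fin 2) : ContDiff ℝ ∞ fun ζ : Freq m => (ζ i : ℂ) := by
  change ContDiff ℝ ∞ fun ζ : Freq m =>
    Complex.ofRealCLM ((EuclideanSpace.proj i : Freq m →L[ℝ] ℝ) ζ)
  exact Complex.ofRealCLM.contDiff.comp (ContinuousLinearMap.contDiff _)

/-- Every term of the linearized operator that is absent from the constant state operator contains a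
derivative of the profile, and so tends to 0 exponentially. -/
theorem Admissible.sepMatrix_calG (hS : S.Admissible) (hw : S.IsProfile w uinf) :
    ∃ δ > 0, SepMatrix δ (S.calG w) (S.endG uinf) := by
  obtain ⟨δ, hδ, hr⟩ := hw.exists_rate
  have hu : uinf ∈ S.Ustar := hS.Uhyp_subset hw.end_mem
  have hreg : ∀ {f : State n₁ n₂ → ℝ}, ContDiffOn ℝ ∞ f S.Ustar → ∀ n,
      ExpReg δ n (fun z => f (w z)) (f uinf) := fun hf n =>
    expReg_comp hδ hw.smooth hr hS.isOpen_Ustar hw.mem_Ustar hu hf n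
  have hcx : ∀ {α β : Type} {M : State n₁ n₂ → Matrix α β ℝ},
      (∀ i j, ContDiffOn ℝ ∞ (fun u => M u i j) S.Ustar) →
      SepMatrix δ (fun z (_ : Freq m) => cx (M (w z))) (fun _ => cx (M uinf)) := fun hM =>
    sepMatrix_cx fun i j => (hreg (hM i j) 0)
  have hder : ∀ {M : State n₁ n₂ → Matrix (Fin n₁ ⊕ Fin n₂) (Fin n₁ ⊕ Fin n₂) ℝ},
      (∀ i j, ContDiffOn ℝ ∞ (fun u => M u i j) S.Ustar) → ∀ n i l,
      ExpReg δ n (fun z => derivMul M (w z) (dw w z) i l) 0 := fun hM n i l =>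
    expReg_derivMul hδ hw.smooth hr hS.isOpen_Ustar hw.mem_Ustar hu hM n i l
  have hcx0 : ∀ {M : ℝ → Matrix (Fin n₁ ⊕ Fin n₂) (Fin n₁ ⊕ Fin n₂) ℝ},
      (∀ i l, ExpReg δ 0 (fun z => M z i l) 0) →
      SepMatrix δ (fun z (_ : Freq m) => cx (M z)) (fun _ => 0) := fun hM =>
    (sepMatrix_cx (Ainf := 0) fun i j => hM i j).congr (fun _ _ _ => rfl) fun ζ => by
      ext i j
      simp [cx]
  have hdz : ∀ {M : State n₁ n₂ → Matrix (Fin n₁ ⊕ Fin n₂) (Fin n₁ ⊕ Fin n₂) ℝ},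
      (∀ i j, ContDiffOn ℝ ∞ (fun u => M u i j) S.Ustar) →
      SepMatrix δ (fun z (_ : Freq m) => cx (dz (fun s => M (w s)) z)) (fun _ => 0) := fun hM =>
    hcx0 fun i l => (hreg (hM i l) 1).2
  have hη : ∀ j, ContDiff ℝ ∞ fun ζ : Freq m => (ζ.eta j : ℂ) := fun j => contDiff_freq_coord _
  have hIη : ∀ j, ContDiff ℝ ∞ fun ζ : Freq m => Complex.I * (ζ.eta j : ℂ) := fun j =>
    contDiff_const.mul (hη j)
  have hγ : ContDiff ℝ ∞ fun ζ : Freq m => (ζ.gamma : ℂ) + Complex.I * (ζ.tau : ℂ) :=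
    (contDiff_freq_coord _).add (contDiff_const.mul (contDiff_freq_coord _))
  have hB := hS.smooth_B
  have hA := hS.smooth_A
  have ha₁ := SepMatrix.sum Finset.univ fun j : Fin m =>
    (hcx (M := fun u => S.B j.castSucc (Fin.last m) u + S.B (Fin.last m) j.castSucc u)
      fun i l => (hB j.castSucc (Fin.last m) i l).add (hB (Fin.last m) j.castSucc i l)).smul hδ
        (hIη j)
  have ha₂ := (((hcx (hA (Fin.last m))).sub hδ (hdz (hB (Fin.last m) (Fin.last m)))).sub hδ
      (hcx0 (hder (hB (Fin.last m) (Fin.last m)) 0))).sub hδ ha₁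
  have he₁ := SepMatrix.sum Finset.univ fun j : Fin m =>
    (hcx (hA (Fin.castSucc j))).smul hδ (hIη j)
  have he₂ := SepMatrix.sum Finset.univ fun j : Fin m => SepMatrix.sum Finset.univ fun k : Fin m =>
    (hcx (hB (Fin.castSucc j) (Fin.castSucc k))).smul hδ ((hη j).mul (hη k))
  have he₃ := SepMatrix.sum Finset.univ fun k : Fin m =>
    (hdz (hB (Fin.last m) (Fin.castSucc k))).smul hδ (hIη k)
  have he₄ := SepMatrix.sum Finset.univ fun j : Fin m =>
    (hcx0 (hder (hB (Fin.castSucc j) (Fin.last m)) 0)).smul hδ (hIη j)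
  -- This term contains the second derivative of the profile, so one order of `ExpReg` is consumed.
  have he₅ := hcx0 (M := fun z => dz (fun s => derivMul (S.B (Fin.last m) (Fin.last m)) (w s)
    (dw w s)) z) fun i l => (hder (hB (Fin.last m) (Fin.last m)) 1 i l).2
  have he₆ := (((((((hcx hS.smooth_A0).smul hδ hγ).add he₁).add he₂).add
    (hcx0 (hder (hA (Fin.last m)) 0))).sub hδ he₃).sub hδ he₄).sub hδ he₅
  -- Only the limits simplify here; what remains is the pair of coefficients in `endG`.
  simp only [smul_zero, Finset.sum_const_zero, sub_zero, add_zero] at ha₂ he₆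
  refine ⟨δ, hδ, SepMatrix.firstOrder hδ (b := fun z _ => cx (S.B (Fin.last m) (Fin.last m) (w z)))
    (b' := fun _ => cx (S.B (Fin.last m) (Fin.last m) uinf)) (a := S.calA w) (e := S.calM w)
    ha₂ he₆ ?_ ?_⟩
  · have hd : ∀ u ∈ S.Ustar, (S.B (Fin.last m) (Fin.last m) u).toBlocks₂₂.det ≠ 0 :=
      fun u hu => hS.det_toBlocks₂₂_B hu
    refine (hcx fun i j => contDiffOn_inv_apply
      (M := fun u => (S.B (Fin.last m) (Fin.last m) u).toBlocks₂₂) (fun i j => hB _ _ _ _)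
        hd i j).congr (fun z hz ζ => ?_) fun ζ => ?_
    · exact cx_inv (hd _ (hw.mem_Ustar z hz))
    · exact cx_inv (hd _ hu)
  · refine (hcx fun i j => contDiffOn_inv_apply
      (M := fun u => (S.An u).toBlocks₁₁) (fun i j => hA _ _ _)
        hS.noncharacteristic₁₁ i j).congr (fun z hz ζ => ?_) fun ζ => ?_
    · rw [hS.toBlocks₁₁_calA hw hz]
      exact cx_inv (hS.noncharacteristic₁₁ _ (hw.mem_Ustar z hz))
    · rw [← cx_inv (hS.noncharacteristic₁₁ _ hu)]
      congr 1
      ext i j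
      have : ∀ a b, S.B a b uinf (Sum.inl i) (Sum.inl j) = 0 := fun a b => by
        rw [hS.B_block a b uinf hu]
        rfl
      simp [Matrix.toBlocks₁₁, cx, Matrix.sum_apply, this]

theorem Admissible.exists_isConjugator (hS : S.Admissible) (hw : S.IsProfile w uinf) :
    ∃ Φ, S.IsConjugator w uinf Φ := by
  obtain ⟨δ, hδ, h⟩ := hS.sepMatrix_calG hw
  obtain ⟨ρ, hρ, Φ, hΦ⟩ := h.exists_conjugator hδ
  exact ⟨Φ, ρ, hρ, hΦ⟩

end BVP

theorem Sep.contDiff {F : Type*} [NormedAddCommGroup F] [NormedSpace ℝ F] {δ : ℝ}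
    {f : ℝ → F → ℂ} {a : F → ℂ} (h : Sep δ f a) : ContDiff ℝ ∞ a := by
  obtain ⟨ι, _, p, g, ginf, hp, -, -, h2⟩ := h
  rw [show a = fun ζ => ∑ i, p i ζ * ginf i from funext h2]
  exact ContDiff.sum fun i _ => (hp i).mul contDiff_const

section ActLemmas

variable {α β κ : Type*} [Fintype α] [DecidableEq α] [Fintype β] [DecidableEq β]

theorem act_mul [Fintype κ] (M : Matrix κ β ℂ) (N : Matrix β α ℂ) (v : EuclideanSpace ℂ α) :
    act (M * N) v = act M (act N v) := by
  apply (WithLp.equiv 2 _).injective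
  exact (Matrix.mulVec_mulVec _ _ _).symm

theorem act_one (v : EuclideanSpace ℂ α) : act (1 : Matrix α α ℂ) v = v := by
  apply (WithLp.equiv 2 _).injective
  exact Matrix.one_mulVec _

theorem noImagEigenvalue_act_iff (M : Matrix α α ℂ) : NoImagEigenvalue (act M) ↔
    ∀ μ : ℂ, μ.re = 0 → ∀ v : α → ℂ, M.mulVec v = μ • v → v = 0 := by
  constructor
  · intro h μ hμ v hv
    have := h μ hμ (WithLp.toLp 2 v) (by
      apply (WithLp.equiv 2 _).injective
      exact hv)
    exact congrArg WithLp.ofLp this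
  · intro h μ hμ v hv
    apply (WithLp.equiv 2 _).injective
    exact h μ hμ v.ofLp (congrArg WithLp.ofLp hv)

end ActLemmas

/-! ### The end state at zero frequency and the block reduction. -/

namespace BVP

variable {n₁ n₂ m p q r : ℕ} {S : BVP n₁ n₂ m p q r} {w : ℝ → State n₁ n₂} {uinf : State n₁ n₂}

/-- The upper right block of `G(u, 0)`. -/
def endQ (S : BVP n₁ n₂ m p q r) (u : State n₁ n₂) : Matrix (Fin n₁ ⊕ Fin n₂) (Fin n₂) ℂ :=
  Matrix.fromRows (-((cx (S.An u)).toBlocks₁₁⁻¹ * (cx (S.An u)).toBlocks₁₂)) 1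

/-- The lower right block of `G(u, 0)`. -/
def endP (S : BVP n₁ n₂ m p q r) (u : State n₁ n₂) : Matrix (Fin n₂) (Fin n₂) ℂ :=
  (cx (S.B (Fin.last m) (Fin.last m) u)).toBlocks₂₂⁻¹ * ((cx (S.An u)).toBlocks₂₂ -
    (cx (S.An u)).toBlocks₂₁ * (cx (S.An u)).toBlocks₁₁⁻¹ * (cx (S.An u)).toBlocks₁₂)

theorem endG_zero (S : BVP n₁ n₂ m p q r) (u : State n₁ n₂) :
    S.endG u 0 = Matrix.fromBlocks 0 (S.endQ u) 0 (S.endP u) := by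
  have h1 : ∀ j, (0 : Freq m).eta j = 0 := fun _ => rfl
  have h2 : (0 : Freq m).gamma = 0 := rfl
  have h3 : (0 : Freq m).tau = 0 := rfl
  have e1 : (0 : Matrix (Fin n₁ ⊕ Fin n₂) (Fin n₁ ⊕ Fin n₂) ℂ).toBlocks₁₁ = 0 := rfl
  have e2 : (0 : Matrix (Fin n₁ ⊕ Fin n₂) (Fin n₁ ⊕ Fin n₂) ℂ).toBlocks₁₂ = 0 := rfl
  have e3 : (0 : Matrix (Fin n₁ ⊕ Fin n₂) (Fin n₁ ⊕ Fin n₂) ℂ).toBlocks₂₁ = 0 := rfl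
  have e4 : (0 : Matrix (Fin n₁ ⊕ Fin n₂) (Fin n₁ ⊕ Fin n₂) ℂ).toBlocks₂₂ = 0 := rfl
  simp only [endG, h1, h2, h3, firstOrder, endQ, endP]
  simp only [Complex.ofReal_zero, mul_zero, zero_smul, Finset.sum_const_zero, sub_zero, add_zero,
    e1, e2, e3, e4, Matrix.mul_zero, neg_zero]
  congr 1
  · ext (i | i) (j | j) <;> rfl
  · ext i (j | j) <;> rfl

theorem isUnit_det_cx {α : Type*} [Fintype α] [DecidableEq α] {M : Matrix α α ℝ}
    (h : M.det ≠ 0) : IsUnit (cx M).det := by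
  have : (cx M).det = ((M.det : ℝ) : ℂ) := (RingHom.map_det Complex.ofRealHom M).symm
  rw [this, isUnit_iff_ne_zero]
  exact_mod_cast h

/-- An eigenvector v of `endP` extends to x = (-(a¹¹)⁻¹a¹²v, v), which satisfies A_d x = μ B_dd x.
If μ = 0, A_d would be singular. If μ = iξ with ξ ≠ 0, then iξ A_d x + ξ² B_dd x = ((iξ)² + ξ²) B_dd
x = 0, so iĀ + B̄ at the normal frequency ξ has the eigenvalue 0, against dissipativity. -/
theorem Admissible.noImagEigenvalue_endP (hS : S.Admissible) {u : State n₁ n₂} (hu : u ∈ S.Uhyp) :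
    NoImagEigenvalue (act (S.endP u)) := by
  rw [noImagEigenvalue_act_iff]
  intro μ hμ v hv
  by_contra hv0
  have hus := hS.Uhyp_subset hu
  set b := cx (S.B (Fin.last m) (Fin.last m) u) with hb
  set a := cx (S.An u) with ha
  have hbd : IsUnit b.toBlocks₂₂.det := isUnit_det_cx (hS.det_toBlocks₂₂_B hus)
  have had : IsUnit a.toBlocks₁₁.det := isUnit_det_cx (hS.noncharacteristic₁₁ u hus)
  have hbb : b = Matrix.fromBlocks 0 0 0 b.toBlocks₂₂ := by
    rw [hb, hS.B_block _ _ u hus]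
    ext (i | i) (j | j) <;> simp [cx, Matrix.toBlocks₂₂]
  let x : Fin n₁ ⊕ Fin n₂ → ℂ := Sum.elim (-(a.toBlocks₁₁⁻¹ * a.toBlocks₁₂).mulVec v) v
  have hx : x ≠ 0 := fun h => hv0 (funext fun i => congrFun h (Sum.inr i))
  have key : a.mulVec x = μ • b.mulVec x := by
    rw [hbb, ← Matrix.fromBlocks_toBlocks a]
    simp only [x, Matrix.fromBlocks_mulVec, Sum.elim_comp_inl, Sum.elim_comp_inr]
    have h1 : a.toBlocks₁₁.mulVec (-(a.toBlocks₁₁⁻¹ * a.toBlocks₁₂).mulVec v) +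
        a.toBlocks₁₂.mulVec v = 0 := by
      rw [Matrix.mulVec_neg, Matrix.mulVec_mulVec, Matrix.mul_nonsing_inv_cancel_left _ _ had]
      simp
    have h2 : a.toBlocks₂₁.mulVec (-(a.toBlocks₁₁⁻¹ * a.toBlocks₁₂).mulVec v) +
        a.toBlocks₂₂.mulVec v = μ • b.toBlocks₂₂.mulVec v := by
      rw [← Matrix.mulVec_smul, ← hv, endP, ← hb, ← ha, Matrix.mulVec_mulVec,
        Matrix.mul_nonsing_inv_cancel_left _ _ hbd, Matrix.mulVec_neg, Matrix.mulVec_mulVec,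
        ← Matrix.mul_assoc, Matrix.sub_mulVec]
      abel
    rw [h1, h2]
    ext (i | i) <;> simp
  by_cases hμ0 : μ.im = 0
  · have : μ = 0 := Complex.ext hμ hμ0
    rw [this, zero_smul] at key
    exact (isUnit_det_cx (hS.noncharacteristic u hu)).ne_zero
      (Matrix.exists_mulVec_eq_zero_iff.1 ⟨x, hx, key⟩)
  · obtain ⟨c, hc, h⟩ := hS.dissipative
    have h1 := h u hu (EuclideanSpace.single (Fin.last m) μ.im) 0 ?_
    · simp only [PiLp.norm_single, Complex.zero_re] at h1
      have : 0 < ‖μ.im‖ := norm_pos_iff.2 hμ0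
      have : 0 < c * (‖μ.im‖ ^ 2 / (1 + ‖μ.im‖ ^ 2)) := by positivity
      linarith
    · rw [spectrum.zero_mem_iff, Matrix.isUnit_iff_isUnit_det, isUnit_iff_ne_zero, not_not]
      refine Matrix.exists_mulVec_eq_zero_iff.1 ⟨x, hx, ?_⟩
      have hA : cx (S.Abar u (EuclideanSpace.single (Fin.last m) μ.im)) =
          (μ.im : ℂ) • (cx ((S.A0 u)⁻¹) * a) := by
        rw [Abar_single]
        ext i j
        simp [cx, ha, Matrix.mul_apply]
      have hB : cx (S.Bbar u (EuclideanSpace.single (Fin.last m) μ.im)) =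
          ((μ.im : ℂ) * μ.im) • (cx ((S.A0 u)⁻¹) * b) := by
        rw [Bbar_single]
        ext i j
        simp [cx, hb, Matrix.mul_apply]
      have hμI : μ = Complex.I * μ.im := by
        apply Complex.ext <;> simp [hμ]
      rw [hA, hB, Matrix.add_mulVec, Matrix.smul_mulVec, Matrix.smul_mulVec, Matrix.smul_mulVec,
        ← Matrix.mulVec_mulVec, key, ← Matrix.mulVec_mulVec, Matrix.mulVec_smul, smul_smul,
        smul_smul, ← add_smul]
      nth_rewrite 2 [hμI]
      have : Complex.I * (μ.im : ℂ) * (Complex.I * (μ.im : ℂ)) + (μ.im : ℂ) * (μ.im : ℂ) = 0 := by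
        linear_combination (μ.im : ℂ) * (μ.im : ℂ) * Complex.I_mul_I
      rw [this, zero_smul]

theorem Admissible.isUnit_det_endP (hS : S.Admissible) {u : State n₁ n₂} (hu : u ∈ S.Uhyp) :
    IsUnit (S.endP u).det := by
  rw [isUnit_iff_ne_zero]
  intro h
  obtain ⟨v, hv, h0⟩ := Matrix.exists_mulVec_eq_zero_iff.2 h
  exact hv ((noImagEigenvalue_act_iff _).1 (hS.noImagEigenvalue_endP hu) 0 rfl v (by simpa using h0))

theorem inv_fromBlocks_one {α β : Type*} [Fintype α] [DecidableEq α] [Fintype β] [DecidableEq β]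
    (W : Matrix α β ℂ) :
    (Matrix.fromBlocks 1 W 0 1 : Matrix (α ⊕ β) (α ⊕ β) ℂ)⁻¹ = Matrix.fromBlocks 1 (-W) 0 1 := by
  refine Matrix.inv_eq_left_inv ?_
  simp [Matrix.fromBlocks_multiply, Matrix.fromBlocks_one]

/-- The lower right block does not see W. The normalization of V(0) therefore fixes P(0), whichever
block reduction is chosen. -/
theorem conj_endG_zero (S : BVP n₁ n₂ m p q r) (u : State n₁ n₂)
    (W : Matrix (Fin n₁ ⊕ Fin n₂) (Fin n₂) ℂ) :
    (Matrix.fromBlocks 1 W 0 1)⁻¹ * S.endG u 0 * Matrix.fromBlocks 1 W 0 1 =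
      Matrix.fromBlocks 0 (S.endQ u - W * S.endP u) 0 (S.endP u) := by
  rw [inv_fromBlocks_one, endG_zero]
  simp [Matrix.fromBlocks_multiply, sub_eq_add_neg]

section Smooth

attribute [local instance] Matrix.linftyOpNormedRing Matrix.linftyOpNormedAlgebra

theorem contDiffOn_matrix_iff {F : Type*} [NormedAddCommGroup F] [NormedSpace ℝ F]
    {α : Type*} [Fintype α] [DecidableEq α] {M : F → Matrix α α ℂ} {O : Set F} :
    ContDiffOn ℝ ∞ M O ↔ ∀ i j, ContDiffOn ℝ ∞ (fun ζ => M ζ i j) O := by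
  constructor
  · intro h i j
    let entry : Matrix α α ℂ →ₗ[ℝ] ℂ :=
      { toFun := fun M => M i j, map_add' := fun _ _ => rfl, map_smul' := fun _ _ => rfl }
    exact (LinearMap.toContinuousLinearMap entry).contDiff.comp_contDiffOn h
  · intro h
    rw [show M = fun ζ => ∑ i, ∑ j, M ζ i j • Matrix.single i j (1 : ℂ) by
      ext1 ζ
      conv_lhs => rw [Matrix.matrix_eq_sum_single (M ζ)]
      simp]
    exact ContDiffOn.sum fun i _ => ContDiffOn.sum fun j _ => (h i j).smul contDiffOn_const

/-- The choice W = Q P₀⁻¹ clears the upper right block at ζ = 0. An off-diagonal matrix commuting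
with diag(0, P₀) satisfies h₁₂P₀ = 0 and P₀h₂₁ = 0, hence vanishes as P₀ is invertible. The
correction 1 + X equals 1 at ζ = 0, which preserves the form of V(0). -/
theorem Admissible.exists_isBlockReduction (hS : S.Admissible) (hw : S.IsProfile w uinf) :
    ∃ V, S.IsBlockReduction uinf V := by
  have hG : ContDiffOn ℝ ∞ (S.endG uinf) univ := by
    obtain ⟨δ, hδ, h⟩ := hS.sepMatrix_calG hw
    exact contDiffOn_matrix_iff.2 fun i j => (h i j).contDiff.contDiffOn
  have hPd := hS.isUnit_det_endP hw.end_mem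
  set P₀ := S.endP uinf with hP₀
  let W := S.endQ uinf * P₀⁻¹
  let V₀ : Matrix (FOIdx n₁ n₂) (FOIdx n₁ n₂) ℂ := Matrix.fromBlocks 1 W 0 1
  let e : Matrix (FOIdx n₁ n₂) (FOIdx n₁ n₂) ℂ := Matrix.fromBlocks 1 0 0 0
  have hV₀d : IsUnit V₀.det := by simp [V₀]
  let N : Freq m → Matrix (FOIdx n₁ n₂) (FOIdx n₁ n₂) ℂ := fun ζ => V₀⁻¹ * S.endG uinf ζ * V₀
  have hN0 : N 0 = Matrix.fromBlocks 0 0 0 P₀ := by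
    simp only [N, V₀, conj_endG_zero]
    rw [← hP₀, Matrix.mul_assoc, Matrix.nonsing_inv_mul _ hPd, Matrix.mul_one, sub_self]
  have h1e : 1 - e = Matrix.fromBlocks 0 0 0 1 := by
    rw [← Matrix.fromBlocks_one]
    ext (i | i) (j | j) <;> simp [e, Matrix.fromBlocks]
  obtain ⟨X, hX, hX0, hev⟩ := exists_analytic_blockDiagonalization (e := e) (D := N 0)
    (by simp [e, Matrix.fromBlocks_multiply])
    (by rw [hN0]; simp [e, Matrix.fromBlocks_multiply]) (by
      intro h h1 h2 h3
      rw [h1e] at h2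
      rw [hN0] at h3
      rw [← Matrix.fromBlocks_toBlocks h] at h1 h2 h3 ⊢
      simp only [e, Matrix.fromBlocks_multiply, Matrix.one_mul, Matrix.mul_one, Matrix.zero_mul,
        Matrix.mul_zero, add_zero, zero_add] at h1 h2 h3
      have k1 : h.toBlocks₁₁ = 0 := congrArg Matrix.toBlocks₁₁ h1
      have k2 : h.toBlocks₂₂ = 0 := congrArg Matrix.toBlocks₂₂ h2
      have k3 : h.toBlocks₁₂ * P₀ = 0 := congrArg Matrix.toBlocks₁₂ h3
      have k4 : 0 = P₀ * h.toBlocks₂₁ := congrArg Matrix.toBlocks₂₁ h3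
      have k5 : h.toBlocks₁₂ = 0 := by
        rw [← Matrix.mul_nonsing_inv_cancel_right (A := P₀) h.toBlocks₁₂ hPd, k3, Matrix.zero_mul]
      have k6 : h.toBlocks₂₁ = 0 := by
        rw [← Matrix.nonsing_inv_mul_cancel_left (A := P₀) h.toBlocks₂₁ hPd, ← k4, Matrix.mul_zero]
      rw [k1, k2, k5, k6, Matrix.fromBlocks_zero])
  have hNc : ContDiffOn ℝ ∞ N univ := (contDiffOn_const.mul hG).mul contDiffOn_const
  have hNt : Tendsto N (𝓝 0) (𝓝 (N 0)) := (contDiffOn_univ.1 hNc).continuous.tendsto 0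
  -- Analyticity at one point spreads to a neighbourhood, whereas being C^∞ at one point does not
  -- give a common neighbourhood for all orders. This is why X is constructed with order ω.
  obtain ⟨ρ, hρ, hball⟩ := Metric.eventually_nhds_iff_ball.1
    (hNt.eventually ((hX.eventually (by simp)).and hev))
  refine ⟨fun ζ => V₀ * (1 + X (N ζ)), ⟨ρ, hρ, ?_, fun ζ hζ => ?_⟩, W, ?_⟩
  · refine contDiffOn_matrix_iff.1 (contDiffOn_const.mul (contDiffOn_const.add fun ζ hζ => ?_))
    exact (((hball ζ hζ).1.of_le le_top).comp ζ
      (contDiffOn_univ.1 hNc).contDiffAt).contDiffWithinAt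
  · obtain ⟨-, hu, hcomm⟩ := hball ζ hζ
    have hud := (Matrix.isUnit_iff_isUnit_det _).1 hu
    refine ⟨?_, ?_⟩
    · rw [Matrix.det_mul]
      exact mul_ne_zero hV₀d.ne_zero hud.ne_zero
    · have h4 : (V₀ * (1 + X (N ζ)))⁻¹ * S.endG uinf ζ * (V₀ * (1 + X (N ζ))) =
          Ring.inverse (1 + X (N ζ)) * N ζ * (1 + X (N ζ)) := by
        rw [Matrix.mul_inv_rev, ← Matrix.nonsing_inv_eq_ringInverse]
        simp only [N, mul_assoc]
      rw [h4]
      rw [← Matrix.fromBlocks_toBlocks (Ring.inverse (1 + X (N ζ)) * N ζ * (1 + X (N ζ)))] at hcomm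
      simp only [e, Matrix.fromBlocks_multiply, Matrix.one_mul, Matrix.mul_one, Matrix.zero_mul,
        Matrix.mul_zero, add_zero] at hcomm
      rw [Matrix.fromBlocks_inj] at hcomm
      exact ⟨hcomm.2.1.symm, hcomm.2.2.1⟩
  · simp [hX0, V₀]

end Smooth

end BVP

/-! ### L² norms on the half line. -/

section HalfLineNorm

open MeasureTheory

variable {E F : Type*} [NormedAddCommGroup E] [NormedAddCommGroup F]

/-- The `L²` norm on the half line. -/
def hnorm (f : ℝ → E) : ℝ := (eLpNorm f 2 halfLine).toReal

theorem hnorm_nonneg (f : ℝ → E) : 0 ≤ hnorm f := ENNReal.toReal_nonneg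

theorem hnorm_eq_rpow {f : ℝ → E} (hf : MemLp f 2 halfLine) :
    hnorm f = (∫ z, ‖f z‖ ^ (2 : ℝ) ∂halfLine) ^ (1 / (2 : ℝ)) := by
  rw [hnorm, hf.eLpNorm_eq_integral_rpow_norm (by simp) (by simp), ENNReal.toReal_ofReal]
  · simp
  · exact Real.rpow_nonneg (integral_nonneg fun _ => Real.rpow_nonneg (norm_nonneg _) _) _

theorem hnorm_sq {f : ℝ → E} (hf : MemLp f 2 halfLine) :
    hnorm f ^ 2 = ∫ z, ‖f z‖ ^ 2 ∂halfLine := by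
  rw [hnorm_eq_rpow hf, ← Real.sqrt_eq_rpow, Real.sq_sqrt]
  · simp
  · exact integral_nonneg fun _ => Real.rpow_nonneg (norm_nonneg _) _

theorem integrable_norm_mul {f : ℝ → E} {g : ℝ → F} (hf : MemLp f 2 halfLine)
    (hg : MemLp g 2 halfLine) : Integrable (fun z => ‖f z‖ * ‖g z‖) halfLine :=
  hf.norm.integrable_mul hg.norm

theorem integral_norm_mul_le {f : ℝ → E} {g : ℝ → F} (hf : MemLp f 2 halfLine)
    (hg : MemLp g 2 halfLine) : ∫ z, ‖f z‖ * ‖g z‖ ∂halfLine ≤ hnorm f * hnorm g := by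
  rw [hnorm_eq_rpow hf, hnorm_eq_rpow hg]
  have h2 : ENNReal.ofReal 2 = 2 := by simp
  have h := integral_mul_norm_le_Lp_mul_Lq (p := 2) (q := 2) (by constructor <;> norm_num)
    (h2.symm ▸ hf.norm) (h2.symm ▸ hg.norm)
  simpa only [norm_norm] using h

theorem hnorm_add_le {f g : ℝ → E} (hf : MemLp f 2 halfLine) (hg : MemLp g 2 halfLine) :
    hnorm (fun z => f z + g z) ≤ hnorm f + hnorm g := by
  unfold hnorm
  rw [← ENNReal.toReal_add hf.2.ne hg.2.ne]
  exact ENNReal.toReal_mono (by simp [hf.2.ne, hg.2.ne])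
    (eLpNorm_add_le hf.1 hg.1 (by norm_num))

theorem hnorm_le_of_norm_le {f : ℝ → E} {g : ℝ → F} (hg : MemLp g 2 halfLine) {c : ℝ}
    (hc : 0 ≤ c) (h : ∀ z, ‖f z‖ ≤ c * ‖g z‖) : hnorm f ≤ c * hnorm g := by
  have h1 := eLpNorm_le_mul_eLpNorm_of_ae_le_mul (μ := halfLine) (Eventually.of_forall h) 2
  have h2 := ENNReal.toReal_mono (by simp [ENNReal.mul_eq_top, hg.2.ne]) h1
  rwa [ENNReal.toReal_mul, ENNReal.toReal_ofReal hc] at h2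

theorem MemLp.intervalIntegrable {f : ℝ → E} (hf : MemLp f 2 halfLine) {R : ℝ} (hR : 0 ≤ R) :
    IntervalIntegrable f volume 0 R := by
  rw [intervalIntegrable_iff_integrableOn_Ioc_of_le hR]
  have h1 : MemLp f 2 (volume.restrict (Ioc 0 R)) :=
    hf.mono_measure (Measure.restrict_mono Ioc_subset_Ioi_self le_rfl)
  exact h1.integrable (by norm_num)

end HalfLineNorm

/-! ### The energy identity for L² solutions. -/

section EnergyIdentity

open MeasureTheory

/-- Sources are merely L², so solutions are absolutely continuous and not C¹. Integration by parts
is therefore carried out for primitives of integrable functions. -/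
theorem integral_mul_eq_sub {g₁ g₂ : ℝ → ℝ} {R : ℝ} (hg₁ : IntervalIntegrable g₁ volume 0 R)
    (hg₂ : IntervalIntegrable g₂ volume 0 R) (c₁ c₂ : ℝ) :
    ∫ s in (0 : ℝ)..R, (g₁ s * (c₂ + ∫ t in (0 : ℝ)..s, g₂ t) +
        (c₁ + ∫ t in (0 : ℝ)..s, g₁ t) * g₂ s) =
      (c₁ + ∫ t in (0 : ℝ)..R, g₁ t) * (c₂ + ∫ t in (0 : ℝ)..R, g₂ t) - c₁ * c₂ := by
  have hconst : ∀ c : ℝ, AbsolutelyContinuousOnInterval (fun _ => c) 0 R := fun c =>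
    (LipschitzWith.const c).lipschitzOnWith.absolutelyContinuousOnInterval
  have ac₁ := (hconst c₁).add (hg₁.absolutelyContinuousOnInterval_intervalIntegral
    (c := 0) left_mem_uIcc)
  have ac₂ := (hconst c₂).add (hg₂.absolutelyContinuousOnInterval_intervalIntegral
    (c := 0) left_mem_uIcc)
  have h := ac₁.integral_deriv_mul_eq_sub ac₂
  simp only [Pi.add_apply, intervalIntegral.integral_same, add_zero] at h
  rw [← h]
  apply intervalIntegral.integral_congr_ae
  filter_upwards [hg₁.ae_hasDerivAt_integral, hg₂.ae_hasDerivAt_integral] with s h1 h2 hs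
  have hs' := uIoc_subset_uIcc hs
  have d1 : deriv ((fun _ => c₁) + fun s => ∫ t in (0 : ℝ)..s, g₁ t) s = g₁ s :=
    ((h1 hs' 0 left_mem_uIcc).const_add c₁).deriv
  have d2 : deriv ((fun _ => c₂) + fun s => ∫ t in (0 : ℝ)..s, g₂ t) s = g₂ s :=
    ((h2 hs' 0 left_mem_uIcc).const_add c₂).deriv
  rw [d1, d2]

/-- Expanding B in a basis reduces the claim to products of two scalar coordinates. -/
theorem integral_bilin_eq_sub {E : Type*} [NormedAddCommGroup E] [NormedSpace ℝ E]
    [FiniteDimensional ℝ E] (B : E →ₗ[ℝ] E →ₗ[ℝ] ℝ) {u g : ℝ → E} {R : ℝ} (hR : 0 ≤ R)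
    (hg : ∀ z, 0 ≤ z → IntervalIntegrable g volume 0 z)
    (hu : ∀ z ≥ 0, u z = u 0 + ∫ t in (0 : ℝ)..z, g t) :
    ∫ s in (0 : ℝ)..R, (B (g s) (u s) + B (u s) (g s)) = B (u R) (u R) - B (u 0) (u 0) := by
  let b := Module.finBasis ℝ E
  let x : Fin (Module.finrank ℝ E) → E →L[ℝ] ℝ := fun i =>
    LinearMap.toContinuousLinearMap (b.coord i)
  have hB : ∀ v w, B v w = ∑ i, ∑ j, B (b i) (b j) * (x i v * x j w) := by
    intro v w
    conv_lhs => rw [← b.sum_repr v, ← b.sum_repr w]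
    simp only [map_sum, map_smul, LinearMap.sum_apply, LinearMap.smul_apply, smul_eq_mul,
      Finset.mul_sum]
    rw [Finset.sum_comm]
    refine Finset.sum_congr rfl fun i _ => Finset.sum_congr rfl fun j _ => ?_
    change _ = B (b i) (b j) * (b.repr v i * b.repr w j)
    ring
  have hxg : ∀ i, ∀ z, 0 ≤ z → IntervalIntegrable (fun s => x i (g s)) volume 0 z :=
    fun i z hz => ⟨(x i).integrable_comp (hg z hz).1, (x i).integrable_comp (hg z hz).2⟩
  have hxu : ∀ i, ∀ z ≥ 0, x i (u z) = x i (u 0) + ∫ t in (0 : ℝ)..z, x i (g t) := by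
    intro i z hz
    rw [hu z hz, map_add, ← ContinuousLinearMap.intervalIntegral_comp_comm _ (hg z hz)]
  have hc : ∀ i, ContinuousOn (fun s => x i (u s)) (uIcc 0 R) := by
    intro i
    have h1 : ContinuousOn (fun z => x i (u 0) + ∫ t in (0 : ℝ)..z, x i (g t)) (uIcc 0 R) :=
      continuousOn_const.add (intervalIntegral.continuousOn_primitive_interval'
        (hxg i R hR) left_mem_uIcc)
    refine h1.congr fun z hz => hxu i z ?_
    rw [uIcc_of_le hR] at hz
    exact hz.1
  have key : ∀ i j, ∫ s in (0 : ℝ)..R, (x i (g s) * x j (u s) + x i (u s) * x j (g s)) =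
      x i (u R) * x j (u R) - x i (u 0) * x j (u 0) := by
    intro i j
    rw [hxu i R hR, hxu j R hR, ← integral_mul_eq_sub (hxg i R hR) (hxg j R hR)]
    refine intervalIntegral.integral_congr fun s hs => ?_
    rw [uIcc_of_le hR] at hs
    simp only [hxu i s hs.1, hxu j s hs.1]
  have hint : ∀ i j, IntervalIntegrable
      (fun s => B (b i) (b j) * (x i (g s) * x j (u s) + x i (u s) * x j (g s))) volume 0 R :=
    fun i j => (((hxg i R hR).mul_continuousOn (hc j)).add
      ((hxg j R hR).continuousOn_mul (hc i))).const_mul _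
  calc _ = ∫ s in (0 : ℝ)..R, ∑ i, ∑ j,
        B (b i) (b j) * (x i (g s) * x j (u s) + x i (u s) * x j (g s)) := by
        refine intervalIntegral.integral_congr fun s _ => ?_
        rw [hB (g s), hB (u s)]
        simp only [mul_add, Finset.sum_add_distrib]
    _ = ∑ i, ∑ j, B (b i) (b j) * (x i (u R) * x j (u R) - x i (u 0) * x j (u 0)) := by
        rw [intervalIntegral.integral_finsetSum fun i _ => ?_]
        · refine Finset.sum_congr rfl fun i _ => ?_
          rw [intervalIntegral.integral_finsetSum fun j _ => hint i j]
          refine Finset.sum_congr rfl fun j _ => ?_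
          rw [intervalIntegral.integral_const_mul, key]
        · convert! IntervalIntegrable.sum Finset.univ fun j _ => hint i j using 1
          ext s
          simp
    _ = _ := by
        rw [hB (u R), hB (u 0)]
        simp only [mul_sub, Finset.sum_sub_distrib]

theorem eq_zero_of_integrable_of_tendsto {φ : ℝ → ℝ} {l : ℝ} (hφ : Integrable φ halfLine)
    (h : Tendsto φ atTop (𝓝 l)) : l = 0 := by
  have hI : IntegrableAtFilter φ atTop := ⟨Ioi 0, Ioi_mem_atTop _, hφ⟩
  refine hI.eq_zero_of_tendsto (fun s hs => ?_) h
  rcases mem_atTop_sets.1 hs with ⟨b, hb⟩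
  rw [← top_le_iff, ← Real.volume_Ici (a := b)]
  exact measure_mono hb

variable {E : Type*} [NormedAddCommGroup E] [InnerProductSpace ℂ E] [FiniteDimensional ℂ E]

/-- The energy identity on the half line. -/
theorem integral_inner_eq {T : E →L[ℂ] E} (hT : ∀ x y, inner ℂ (T x) y = inner ℂ x (T y))
    {u g : ℝ → E} (hu : MemLp u 2 halfLine) (hg : MemLp g 2 halfLine)
    (h : ∀ z ≥ 0, u z = u 0 + ∫ t in (0 : ℝ)..z, g t) :
    ∫ z, 2 * (inner ℂ (T (u z)) (g z)).re ∂halfLine = -(inner ℂ (T (u 0)) (u 0)).re := by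
  have hfr : FiniteDimensional ℝ E := FiniteDimensional.complexToReal E
  let B : E →ₗ[ℝ] E →ₗ[ℝ] ℝ := LinearMap.mk₂ ℝ (fun x y => (inner ℂ (T x) y).re)
    (fun x y z => by simp) (fun c x y => by
      rw [← Complex.coe_smul, map_smul, inner_smul_left]; simp)
    (fun x y z => by simp) (fun c x y => by
      rw [← Complex.coe_smul, inner_smul_right]; simp)
  have hB : ∀ x y, B x y = (inner ℂ (T x) y).re := fun _ _ => rfl
  have hsymm : ∀ x y, B x y = B y x := by
    intro x y
    rw [hB, hB, hT, ← inner_conj_symm, Complex.conj_re]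
  have hbd : ∀ x y, |B x y| ≤ ‖T‖ * (‖x‖ * ‖y‖) := by
    intro x y
    rw [hB, ← mul_assoc]
    exact (Complex.abs_re_le_norm _).trans ((norm_inner_le_norm _ _).trans (by
      gcongr
      exact T.le_opNorm x))
  have hmeas : ∀ {v w : ℝ → E}, MemLp v 2 halfLine → MemLp w 2 halfLine →
      Integrable (fun z => B (v z) (w z)) halfLine := by
    intro v w hv hw
    refine Integrable.mono' ((integrable_norm_mul hv hw).const_mul ‖T‖) ?_
      (Eventually.of_forall fun z => hbd _ _)
    exact (Complex.continuous_re.comp_aestronglyMeasurable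
      ((T.continuous.comp_aestronglyMeasurable hv.1).inner hw.1))
  have h1 : ∀ R, 0 ≤ R → ∫ s in (0 : ℝ)..R, 2 * B (u s) (g s) = B (u R) (u R) - B (u 0) (u 0) := by
    intro R hR
    rw [← integral_bilin_eq_sub B hR (fun z hz => MemLp.intervalIntegrable hg hz) h]
    refine intervalIntegral.integral_congr fun s _ => ?_
    simp only [hsymm (g s) (u s), two_mul]
  have hint : Integrable (fun z => 2 * B (u z) (g z)) halfLine := (hmeas hu hg).const_mul 2
  have h2 : Tendsto (fun R => ∫ s in (0 : ℝ)..R, 2 * B (u s) (g s)) atTop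
      (𝓝 (∫ z, 2 * B (u z) (g z) ∂halfLine)) :=
    intervalIntegral_tendsto_integral_Ioi 0 hint tendsto_id
  -- The energy at R has a limit because the integral up to R does. Being also integrable in R, it
  -- can only tend to 0, so there is no boundary term at infinity.
  have h3 : Tendsto (fun R => B (u R) (u R)) atTop
      (𝓝 (∫ z, 2 * B (u z) (g z) ∂halfLine + B (u 0) (u 0))) := by
    refine (h2.add_const (B (u 0) (u 0))).congr' ?_
    filter_upwards [eventually_ge_atTop 0] with R hR
    rw [h1 R hR]
    ring
  have h4 := eq_zero_of_integrable_of_tendsto (hmeas hu hu) h3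
  simp only [hB] at h4
  linarith

end EnergyIdentity

/-! ### Lyapunov symmetrizers. -/

section Symmetrizer

open MeasureTheory

variable {E : Type*} [NormedAddCommGroup E] [InnerProductSpace ℂ E] [FiniteDimensional ℂ E]

/-- `S = ∫₀^∞ (e^{tA}Q)* e^{tA}Q dt` solves a Lyapunov equation. -/
theorem exists_lyapunov [CompleteSpace E] {A Q : E →L[ℂ] E} (hc : Commute A Q) (hQ : Q * Q = Q)
    {κ C : ℝ} (hκ : 0 < κ) (h : ∀ t ≥ 0, ‖flow A t * Q‖ ≤ C * Real.exp (-(κ * t))) :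
    ∃ S : E →L[ℂ] E, (∀ x y, inner ℂ (S x) y = inner ℂ x (S y)) ∧
      (∀ x, 2 * (inner ℂ (S x) (A x)).re = -‖Q x‖ ^ 2) ∧
      (∀ x, 0 ≤ (inner ℂ (S x) x).re) ∧ ∀ x, (inner ℂ (S x) x).re ≤ ‖S‖ * ‖Q x‖ ^ 2 := by
  let M : ℝ → E →L[ℂ] E := fun t => flow A t * Q
  have hMc : Continuous M := (continuous_flow A).mul continuous_const
  have hstar : Continuous fun t => star (M t) * M t := hMc.star.mul hMc
  have hexp : IntegrableOn (fun t => C ^ 2 * Real.exp (-(2 * κ) * t)) (Ioi 0) :=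
    (exp_neg_integrableOn_Ioi 0 (by positivity)).const_mul _
  have hbd : ∀ t ≥ 0, ‖M t‖ * ‖M t‖ ≤ C ^ 2 * Real.exp (-(2 * κ) * t) := by
    intro t ht
    calc _ ≤ (C * Real.exp (-(κ * t))) * (C * Real.exp (-(κ * t))) :=
          mul_self_le_mul_self (norm_nonneg _) (h t ht)
      _ = C ^ 2 * (Real.exp (-(κ * t)) * Real.exp (-(κ * t))) := by ring
      _ = _ := by rw [← Real.exp_add]; ring_nf
  have hint : IntegrableOn (fun t => star (M t) * M t) (Ioi 0) := by
    refine Integrable.mono' hexp hstar.aestronglyMeasurable ?_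
    filter_upwards [ae_restrict_mem measurableSet_Ioi] with t ht
    refine (norm_mul_le _ _).trans ?_
    rw [norm_star]
    exact hbd t (le_of_lt ht)
  let S : E →L[ℂ] E := ∫ t in Ioi 0, star (M t) * M t
  have hS : ∀ x y, inner ℂ y (S x) = ∫ t in Ioi (0 : ℝ), inner ℂ (M t y) (M t x) := by
    intro x y
    let φ : (E →L[ℂ] E) →L[ℂ] ℂ := (innerSL ℂ y).comp (ContinuousLinearMap.apply ℂ E x)
    have h1 : φ S = ∫ t in Ioi (0 : ℝ), φ (star (M t) * M t) := (φ.integral_comp_comm hint).symm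
    refine h1.trans (setIntegral_congr_fun measurableSet_Ioi fun t _ => ?_)
    change inner ℂ y (ContinuousLinearMap.adjoint (M t) (M t x)) = _
    rw [ContinuousLinearMap.adjoint_inner_right]
  have hsymm : ∀ x y, inner ℂ (S x) y = inner ℂ x (S y) := by
    intro x y
    rw [← inner_conj_symm, hS, hS, ← integral_conj]
    exact setIntegral_congr_fun measurableSet_Ioi fun t _ => inner_conj_symm _ _
  have hMQ : ∀ t x, M t (Q x) = M t x := fun t x => by
    change flow A t (Q (Q x)) = flow A t (Q x)
    rw [show Q (Q x) = (Q * Q) x from rfl, hQ]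
  have hsq : ∀ x, (inner ℂ (S x) x).re = ∫ t in Ioi (0 : ℝ), ‖M t x‖ ^ 2 := by
    intro x
    have h1 : inner ℂ x (S x) = ∫ t in Ioi (0 : ℝ), ((‖M t x‖ ^ 2 : ℝ) : ℂ) := by
      rw [hS]
      refine setIntegral_congr_fun measurableSet_Ioi fun t _ => ?_
      simp only [inner_self_eq_norm_sq_to_K]
      norm_cast
    rw [hsymm, h1, integral_complex_ofReal, Complex.ofReal_re]
  refine ⟨S, hsymm, fun x => ?_, fun x => ?_, fun x => ?_⟩
  · have hcomm : ∀ t, A * M t = M t * A := fun t =>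
      (((flow_commute A t).mul_right hc) : Commute A (flow A t * Q))
    -- Integrating this derivative over (0, ∞) yields 2 Re⟨Sx, Ax⟩ on one side and, by decay at
    -- infinity, -‖Qx‖² on the other.
    have hd : ∀ t ∈ Ici (0 : ℝ), HasDerivAt (fun t => ‖M t x‖ ^ 2)
        (2 * (inner ℂ (M t x) (M t (A x))).re) t := by
      intro t _
      have h1 : HasDerivAt (fun t => M t x) (M t (A x)) t := by
        have := hasDerivAt_flow_apply A (Q x) t
        have e : M t (A x) = A (M t x) := congrArg (fun N : E →L[ℂ] E => N x) (hcomm t).symm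
        rw [e]
        exact this
      have h2 := Complex.reCLM.hasFDerivAt.comp_hasDerivAt t (h1.inner ℂ h1)
      refine (h2.congr_deriv ?_).congr_of_eventuallyEq (Eventually.of_forall fun t => ?_)
      · rw [Complex.reCLM_apply, Complex.add_re, ← inner_conj_symm (M t (A x)) (M t x), Complex.conj_re]
        ring
      · change _ = (inner ℂ (M t x) (M t x)).re
        simp only [inner_self_eq_norm_sq_to_K]
        norm_cast
    have hi : IntegrableOn (fun t => inner ℂ (M t x) (M t (A x))) (Ioi 0) := by
      refine Integrable.mono' (hexp.mul_const (‖x‖ * ‖A x‖))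
        ((hMc.clm_apply continuous_const).inner
          (hMc.clm_apply continuous_const)).aestronglyMeasurable ?_
      filter_upwards [ae_restrict_mem measurableSet_Ioi] with t ht
      calc _ ≤ ‖M t x‖ * ‖M t (A x)‖ := norm_inner_le_norm _ _
        _ ≤ (‖M t‖ * ‖x‖) * (‖M t‖ * ‖A x‖) := by
          gcongr <;> exact ContinuousLinearMap.le_opNorm _ _
        _ = (‖M t‖ * ‖M t‖) * (‖x‖ * ‖A x‖) := by ring
        _ ≤ _ := mul_le_mul_of_nonneg_right (hbd t (le_of_lt ht)) (by positivity)
    have hlim : Tendsto (fun t => ‖M t x‖ ^ 2) atTop (𝓝 0) := by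
      have h1 : Tendsto (fun t : ℝ => C ^ 2 * Real.exp (-(2 * κ) * t) * ‖x‖ ^ 2) atTop (𝓝 0) := by
        have := ((Real.tendsto_exp_atBot.comp (tendsto_id.const_mul_atTop_of_neg
          (show -(2 * κ) < 0 by linarith))).const_mul (C ^ 2)).mul_const (‖x‖ ^ 2)
        simpa using this
      refine squeeze_zero' (Eventually.of_forall fun _ => by positivity)
        ((eventually_ge_atTop 0).mono fun t ht => ?_) h1
      calc _ ≤ (‖M t‖ * ‖x‖) ^ 2 := by gcongr; exact ContinuousLinearMap.le_opNorm _ _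
        _ = (‖M t‖ * ‖M t‖) * ‖x‖ ^ 2 := by ring
        _ ≤ _ := mul_le_mul_of_nonneg_right (hbd t ht) (by positivity)
    have h3 := integral_Ioi_of_hasDerivAt_of_tendsto' hd (hi.re.const_mul 2) hlim
    have h4 : (inner ℂ (S x) (A x)).re = ∫ t in Ioi (0 : ℝ), (inner ℂ (M t x) (M t (A x))).re := by
      rw [hsymm, hS]
      exact (integral_re hi).symm
    rw [integral_const_mul, ← h4] at h3
    rw [h3]
    simp [M, flow_zero]
  · rw [hsq]
    exact integral_nonneg fun _ => by positivity
  -- The quadratic form of S factors through Q because M t Q = M t.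
  · have h1 : (inner ℂ (S x) x).re = (inner ℂ (S (Q x)) (Q x)).re := by
      rw [hsq, hsq]
      simp only [hMQ]
    rw [h1]
    calc _ ≤ ‖inner ℂ (S (Q x)) (Q x)‖ := Complex.re_le_norm _
      _ ≤ ‖S (Q x)‖ * ‖Q x‖ := norm_inner_le_norm _ _
      _ ≤ (‖S‖ * ‖Q x‖) * ‖Q x‖ := by gcongr; exact S.le_opNorm _
      _ = _ := by ring

theorem IsDichotomy.neg_idem {L Pm Pp : E →L[ℂ] E} (hd : IsDichotomy L Pm Pp) : Pm * Pm = Pm := by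
  ext v
  exact hd.apply_neg _ (hd.mem_neg v)

theorem IsDichotomy.pos_idem {L Pm Pp : E →L[ℂ] E} (hd : IsDichotomy L Pm Pp) : Pp * Pp = Pp := by
  ext v
  have h1 : (Pm + Pp) (Pp v) = Pp v := by rw [hd.add]; rfl
  have h2 : Pm (Pp v) = 0 := hd.apply_pos _ (hd.mem_pos v)
  change Pp (Pp v) = Pp v
  rwa [add_apply, h2, zero_add] at h1

/-- A symmetrizer for an operator without imaginary eigenvalues. -/
theorem IsDichotomy.exists_symmetrizer {L Pm Pp : E →L[ℂ] E} (hd : IsDichotomy L Pm Pp) :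
    ∃ T : E →L[ℂ] E, (∀ x y, inner ℂ (T x) y = inner ℂ x (T y)) ∧
      (∀ x, ‖x‖ ^ 2 ≤ 4 * (inner ℂ (T x) (L x)).re) ∧
      ∃ C ≥ 0, ∀ x, -(inner ℂ (T x) x).re ≤ C * ‖Pm x‖ ^ 2 := by
  have hcs : CompleteSpace E := FiniteDimensional.complete ℂ E
  obtain ⟨κ, hκ, C, -, hC⟩ := hd.decay
  obtain ⟨S₁, hs₁, he₁, -, hle₁⟩ := exists_lyapunov hd.comm_neg hd.neg_idem hκ
    fun t ht => (hC t ht).1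
  obtain ⟨S₂, hs₂, he₂, hpos₂, -⟩ := exists_lyapunov (A := -L) (hd.comm_pos.neg_left)
    hd.pos_idem hκ fun t ht => by rw [flow_neg_op]; exact (hC t ht).2
  -- S₁ is the Lyapunov form of L on the stable part, S₂ that of -L on the unstable part. Then 2
  -- Re⟨Tx, Lx⟩ = ‖Pp x‖² + ‖Pm x‖² ≥ ‖x‖²/2, and only S₁ contributes to -⟨Tx, x⟩ with an
  -- unfavourable sign.
  refine ⟨S₂ - S₁, fun x y => ?_, fun x => ?_, ‖S₁‖, norm_nonneg _, fun x => ?_⟩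
  · rw [sub_apply, sub_apply, inner_sub_left, inner_sub_right, hs₁, hs₂]
  · have h1 := he₁ x
    have h2 := he₂ x
    rw [neg_apply, inner_neg_right, Complex.neg_re] at h2
    rw [sub_apply, inner_sub_left, Complex.sub_re]
    have h3 : x = Pm x + Pp x := by
      rw [← add_apply, hd.add]
      rfl
    have h4 : ‖x‖ ≤ ‖Pm x‖ + ‖Pp x‖ := by
      conv_lhs => rw [h3]
      exact norm_add_le _ _
    have h5 : ‖x‖ ^ 2 ≤ (‖Pm x‖ + ‖Pp x‖) ^ 2 := by gcongr
    nlinarith [sq_nonneg (‖Pm x‖ - ‖Pp x‖)]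
  · rw [sub_apply, inner_sub_left, Complex.sub_re]
    linarith [hle₁ x, hpos₂ x]

end Symmetrizer

/-! ### L² estimates uniform under perturbation. -/

section Estimates

open MeasureTheory

variable {E : Type*} [NormedAddCommGroup E] [InnerProductSpace ℂ E] [FiniteDimensional ℂ E]

/-- `L²` solutions of `u' = L u + f` on the half line. -/
structure IsSol (L : E →L[ℂ] E) (f u : ℝ → E) : Prop where
  memLp_source : MemLp f 2 halfLine
  memLp : MemLp u 2 halfLine
  eq : ∀ z ≥ 0, u z = u 0 + ∫ s in (0 : ℝ)..z, (L (u s) + f s)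

/-- The energy identity is combined with the lower bound for Re⟨Tu, Lu⟩ and with Cauchy-Schwarz on
the source term. The constant c may be negative; this is used below to bound the trace. -/
theorem IsSol.integral_inner {L T : E →L[ℂ] E} (hT : ∀ x y, inner ℂ (T x) y = inner ℂ x (T y))
    {f u : ℝ → E} (h : IsSol L f u) {c : ℝ} (hc : ∀ x, c * ‖x‖ ^ 2 ≤ (inner ℂ (T x) (L x)).re) :
    2 * c * hnorm u ^ 2 ≤ -(inner ℂ (T (u 0)) (u 0)).re + 2 * ‖T‖ * (hnorm u * hnorm f) := by
  have hLu : MemLp (fun s => L (u s)) 2 halfLine := L.comp_memLp' h.memLp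
  have h1 := integral_inner_eq hT h.memLp (hLu.add h.memLp_source) h.eq
  have hu2 : Integrable (fun z => ‖u z‖ ^ 2) halfLine :=
    (h.memLp.norm).integrable_sq
  have huf := integrable_norm_mul h.memLp h.memLp_source
  have h2 : 2 * c * hnorm u ^ 2 - 2 * ‖T‖ * ∫ z, ‖u z‖ * ‖f z‖ ∂halfLine ≤
      -(inner ℂ (T (u 0)) (u 0)).re := by
    rw [← h1, hnorm_sq h.memLp, ← integral_const_mul, ← integral_const_mul, ← integral_sub]
    · refine integral_mono ((hu2.const_mul _).sub (huf.const_mul _)) ?_ fun z => ?_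
      · refine Integrable.mono' ((integrable_norm_mul h.memLp
          (hLu.add h.memLp_source)).const_mul (2 * ‖T‖))
          ((Complex.continuous_re.comp_aestronglyMeasurable
            ((T.continuous.comp_aestronglyMeasurable h.memLp.1).inner
              (hLu.add h.memLp_source).1)).const_mul 2) (Eventually.of_forall fun z => ?_)
        rw [norm_mul, Real.norm_two, mul_assoc]
        refine mul_le_mul_of_nonneg_left ?_ zero_le_two
        calc _ ≤ ‖T (u z)‖ * ‖L (u z) + f z‖ :=
              (Complex.abs_re_le_norm _).trans (norm_inner_le_norm _ _)
          _ ≤ (‖T‖ * ‖u z‖) * ‖L (u z) + f z‖ := by gcongr; exact T.le_opNorm _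
          _ = _ := mul_assoc _ _ _
      · have h5 : -(‖T‖ * ‖u z‖ * ‖f z‖) ≤ (inner ℂ (T (u z)) (f z)).re := by
          have h6 : |(inner ℂ (T (u z)) (f z)).re| ≤ ‖T‖ * ‖u z‖ * ‖f z‖ :=
            (Complex.abs_re_le_norm _).trans ((norm_inner_le_norm _ _).trans (by
              gcongr; exact T.le_opNorm _))
          exact (abs_le.1 h6).1
        have h7 := hc (u z)
        simp only [Pi.add_apply, inner_add_right, Complex.add_re]
        nlinarith
    · exact hu2.const_mul _
    · exact huf.const_mul _
  have h3 := integral_norm_mul_le h.memLp h.memLp_source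
  have h4 : 2 * ‖T‖ * ∫ z, ‖u z‖ * ‖f z‖ ∂halfLine ≤ 2 * ‖T‖ * (hnorm u * hnorm f) := by gcongr
  linarith

/-- Positivity of Re⟨Tx, Lx⟩ is an open condition, so the symmetrizer of L serves every P close to
L. The constants are uniform, and the trace is measured with the fixed projection of L. -/
theorem IsDichotomy.exists_estimate {L Pm Pp : E →L[ℂ] E} (hd : IsDichotomy L Pm Pp) :
    ∃ ε > 0, ∃ C > 0, ∀ P : E →L[ℂ] E, ‖P - L‖ ≤ ε → NoImagEigenvalue (P : E →ₗ[ℂ] E) ∧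
      ∀ f u, IsSol P f u → hnorm u + ‖u 0‖ ≤ C * (hnorm f + ‖Pm (u 0)‖) := by
  obtain ⟨T, hT, hTL, C₁, hC₁, hTu⟩ := hd.exists_symmetrizer
  set K := ‖T‖ with hK
  have hK0 : 0 ≤ K := norm_nonneg _
  have hp : ∀ P : E →L[ℂ] E, ‖P - L‖ ≤ 1 / (8 * (K + 1)) →
      ∀ x, 1 / 8 * ‖x‖ ^ 2 ≤ (inner ℂ (T x) (P x)).re := by
    intro P hP x
    have e : P x = L x + (P - L) x := by simp
    have h1 : |(inner ℂ (T x) ((P - L) x)).re| ≤ 1 / 8 * ‖x‖ ^ 2 := by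
      calc _ ≤ ‖T x‖ * ‖(P - L) x‖ := (Complex.abs_re_le_norm _).trans (norm_inner_le_norm _ _)
        _ ≤ (K * ‖x‖) * (1 / (8 * (K + 1)) * ‖x‖) := by
          gcongr
          · exact T.le_opNorm x
          · exact (P - L).le_of_opNorm_le hP x
        _ = K / (K + 1) * (1 / 8 * ‖x‖ ^ 2) := by field_simp
        _ ≤ 1 * (1 / 8 * ‖x‖ ^ 2) := by
          gcongr
          rw [div_le_one (by positivity)]
          linarith
        _ = _ := one_mul _
    rw [e, inner_add_right, Complex.add_re]
    linarith [hTL x, (abs_le.1 h1).1]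
  -- Perturbations of this size cost at most 1/8 of the available 1/4 in the positivity of the form.
  -- The constant is the product of the factor bounding u(0) by the L² norms of u and f and the
  -- factor bounding the norm of u.
  refine ⟨1 / (8 * (K + 1)), by positivity, (2 * ‖L‖ + 6) * (8 * K + 8 * C₁ + 2), by positivity,
    fun P hP => ⟨fun μ hμ v hv => ?_, fun f u hu => ?_⟩⟩
  · have h1 := hp P hP v
    have hv' : P v = μ • v := hv
    -- Since ⟨Tv, v⟩ is real, an imaginary μ gives Re⟨Tv, μv⟩ = 0, which contradicts positivity
    -- unless v = 0.
    have h2 : (inner ℂ (T v) v).im = 0 := by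
      have h3 : (starRingEnd ℂ) (inner ℂ (T v) v) = inner ℂ (T v) v := by
        rw [inner_conj_symm, hT]
      exact Complex.conj_eq_iff_im.1 h3
    rw [hv', inner_smul_right, Complex.mul_re, hμ, h2] at h1
    have h4 : ‖v‖ ^ 2 ≤ 0 := by linarith
    exact norm_eq_zero.1 (pow_eq_zero_iff (two_ne_zero) |>.1 (le_antisymm h4 (by positivity)))
  · set a := hnorm u
    set b := hnorm f
    have ha : 0 ≤ a := hnorm_nonneg u
    have hb : 0 ≤ b := hnorm_nonneg f
    set p := ‖Pm (u 0)‖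
    have hp0 : 0 ≤ p := norm_nonneg _
    have h1 : a ≤ (8 * K + 8 * C₁ + 1) * (b + p) := by
      have h2 := hu.integral_inner hT (hp P hP)
      have h3 := hTu (u 0)
      refine abs_le_of_sq_le_sq' ?_ (by positivity) |>.2
      have h4 : a ^ 2 ≤ 64 * K ^ 2 * b ^ 2 + 8 * C₁ * p ^ 2 := by
        nlinarith [sq_nonneg (a - 8 * K * b)]
      have h5 : (8 * K * b) ^ 2 + 8 * C₁ * p ^ 2 ≤ ((8 * K + 8 * C₁ + 1) * (b + p)) ^ 2 := by
        have h6 : (8 * K * b) ^ 2 ≤ ((8 * K + 8 * C₁ + 1) * b) ^ 2 := by gcongr; linarith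
        have h7 : 8 * C₁ * p ^ 2 ≤ ((8 * K + 8 * C₁ + 1) * p) ^ 2 := by
          rw [mul_pow]
          gcongr
          nlinarith
        have h8 : 0 ≤ ((8 * K + 8 * C₁ + 1) * b) * ((8 * K + 8 * C₁ + 1) * p) := by positivity
        nlinarith
      nlinarith
    have h2 : ‖u 0‖ ≤ (2 * ‖L‖ + 5) * (a + b) := by
      have hPL : ‖P‖ ≤ ‖L‖ + 1 := by
        have h3 : ‖P‖ ≤ ‖P - L‖ + ‖L‖ := by simpa using norm_add_le (P - L) L
        have h4 : 1 / (8 * (K + 1)) ≤ 1 := by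
          rw [div_le_one (by positivity)]
          linarith
        linarith
      -- With T = 1 and c = -‖P‖ the energy inequality bounds the trace: ‖u(0)‖² ≤ 2‖P‖‖u‖² plus a
      -- multiple of ‖u‖‖f‖.
      have h3 := hu.integral_inner (T := 1) (fun _ _ => rfl) (c := -‖P‖) fun x => by
        have h4 : |(inner ℂ x (P x)).re| ≤ ‖P‖ * ‖x‖ ^ 2 := by
          calc _ ≤ ‖x‖ * ‖P x‖ := (Complex.abs_re_le_norm _).trans (norm_inner_le_norm _ _)
            _ ≤ ‖x‖ * (‖P‖ * ‖x‖) := by gcongr; exact P.le_opNorm x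
            _ = _ := by ring
        have h5 := (abs_le.1 h4).2
        have h6 := (abs_le.1 h4).1
        rw [one_apply_eq_self]
        linarith
      have h5 : ‖(1 : E →L[ℂ] E)‖ ≤ 1 := ContinuousLinearMap.norm_id_le
      have h6 : (inner ℂ ((1 : E →L[ℂ] E) (u 0)) (u 0)).re = ‖u 0‖ ^ 2 := by
        rw [one_apply_eq_self, inner_self_eq_norm_sq_to_K]
        norm_cast
      rw [h6] at h3
      refine abs_le_of_sq_le_sq' ?_ (by positivity) |>.2
      have h7 : ‖(1 : E →L[ℂ] E)‖ * (a * b) ≤ 1 * (a * b) := by gcongr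
      have h8 : ‖P‖ * a ^ 2 ≤ (‖L‖ + 1) * a ^ 2 := by gcongr
      have h9 : 0 ≤ ‖L‖ := norm_nonneg L
      have h10 : ‖u 0‖ ^ 2 ≤ 2 * (‖L‖ + 1) * a ^ 2 + 2 * (a * b) := by linarith
      have h11 : 0 ≤ a * b := by positivity
      have h12 : (2 * ‖L‖ + 5) * (a ^ 2 + 2 * (a * b)) ≤ ((2 * ‖L‖ + 5) * (a + b)) ^ 2 := by
        have : (2 * ‖L‖ + 5) ^ 1 ≤ (2 * ‖L‖ + 5) ^ 2 := pow_le_pow_right₀ (by linarith) (by norm_num)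
        rw [mul_pow]
        calc _ ≤ (2 * ‖L‖ + 5) ^ 1 * (a + b) ^ 2 := by
              rw [pow_one]
              gcongr
              nlinarith [sq_nonneg b]
          _ ≤ _ := by gcongr
      nlinarith [mul_nonneg h9 h11, sq_nonneg a]
    calc a + ‖u 0‖ ≤ a + (2 * ‖L‖ + 5) * (a + b) := by linarith
      _ ≤ (2 * ‖L‖ + 6) * (a + b) := by nlinarith [norm_nonneg L]
      _ ≤ (2 * ‖L‖ + 6) * ((8 * K + 8 * C₁ + 2) * (b + p)) := by
        gcongr
        nlinarith
      _ = _ := by ring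

end Estimates

/-! ### Stability of stable spaces and of injective boundary conditions. -/

section Perturbation

open MeasureTheory

variable {E : Type*} [NormedAddCommGroup E] [InnerProductSpace ℂ E] [FiniteDimensional ℂ E]

theorem isSol_flow {L : E →L[ℂ] E} {v : E} (hv : v ∈ specNeg (L : E →ₗ[ℂ] E)) :
    IsSol L (fun _ => 0) (fun z => flow L z v) := by
  have hcs : CompleteSpace E := FiniteDimensional.complete ℂ E
  have hc : Continuous fun z => flow L z v := (continuous_flow L).clm_apply continuous_const
  obtain ⟨κ, hκ, C, hC, h⟩ := exists_norm_flow_le_of_mem_specNeg hv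
  refine ⟨MemLp.zero', ?_, fun z _ => ?_⟩
  · rw [memLp_two_iff_integrable_sq_norm hc.aestronglyMeasurable]
    have hexp : IntegrableOn (fun t => C ^ 2 * Real.exp (-(2 * κ) * t)) (Ioi 0) :=
      (exp_neg_integrableOn_Ioi 0 (by positivity)).const_mul _
    refine Integrable.mono' hexp (hc.norm.pow 2).aestronglyMeasurable ?_
    filter_upwards [ae_restrict_mem measurableSet_Ioi] with t ht
    rw [Real.norm_of_nonneg (by positivity)]
    calc _ ≤ (C * Real.exp (-(κ * t))) ^ 2 := by gcongr; exact h t (le_of_lt ht)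
      _ = C ^ 2 * (Real.exp (-(κ * t)) * Real.exp (-(κ * t))) := by ring
      _ = _ := by rw [← Real.exp_add]; ring_nf
  · simp only [add_zero]
    rw [intervalIntegral.integral_eq_sub_of_hasDerivAt
      (fun t _ => hasDerivAt_flow_apply L v t)
      ((L.continuous.comp hc).intervalIntegrable _ _)]
    simp

theorem IsSol.sub {L : E →L[ℂ] E} {f u f' u' : ℝ → E} (h : IsSol L f u) (h' : IsSol L f' u') :
    IsSol L (fun z => f z - f' z) (fun z => u z - u' z) := by
  refine ⟨h.memLp_source.sub h'.memLp_source, h.memLp.sub h'.memLp, fun z hz => ?_⟩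
  have hi : ∀ {f u}, IsSol L f u → IntervalIntegrable (fun s => L (u s) + f s) volume 0 z :=
    fun h => MemLp.intervalIntegrable ((L.comp_memLp' h.memLp).add h.memLp_source) hz
  rw [h.eq z hz, h'.eq z hz, add_sub_add_comm, ← intervalIntegral.integral_sub (hi h) (hi h')]
  congr 1
  refine intervalIntegral.integral_congr fun s _ => ?_
  simp only [map_sub]
  abel

theorem IsSol.of_perturbation {L P : E →L[ℂ] E} {f u : ℝ → E} (h : IsSol P f u) :
    IsSol L (fun z => (P - L) (u z) + f z) u := by
  refine ⟨((P - L).comp_memLp' h.memLp).add h.memLp_source, h.memLp, fun z hz => ?_⟩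
  rw [h.eq z hz]
  congr 1
  refine intervalIntegral.integral_congr fun s _ => ?_
  simp only [sub_apply]
  abel

theorem IsDichotomy.apply_neg_pos {L Pm Pp : E →L[ℂ] E} (hd : IsDichotomy L Pm Pp) {v : E}
    (hv : v ∈ specNeg (L : E →ₗ[ℂ] E)) : Pp v = 0 := by
  have h1 : (Pm + Pp) v = v := by rw [hd.add]; rfl
  rw [add_apply, hd.apply_neg v hv] at h1
  simpa using h1

theorem IsDichotomy.neg {L Pm Pp : E →L[ℂ] E} (hd : IsDichotomy L Pm Pp) :
    IsDichotomy (-L) Pp Pm := by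
  have hcs : CompleteSpace E := FiniteDimensional.complete ℂ E
  refine ⟨by rw [add_comm, hd.add], hd.comm_pos.neg_left, hd.comm_neg.neg_left,
    fun v => hd.mem_pos v, fun v => ?_, fun v hv => ?_, fun v hv => ?_, ?_⟩
  · have := hd.mem_neg v
    convert! this using 2
    exact neg_neg _
  · have h1 : (Pm + Pp) v = v := by rw [hd.add]; rfl
    rw [add_apply, hd.apply_pos v hv, zero_add] at h1
    exact h1
  · refine hd.apply_neg_pos ?_
    convert! hv using 2
    exact (neg_neg _).symm
  · obtain ⟨κ, hκ, C, hC, h⟩ := hd.decay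
    refine ⟨κ, hκ, C, hC, fun t ht => ⟨?_, ?_⟩⟩
    · rw [flow_neg_op]
      exact (h t ht).2
    · rw [flow_neg_op, neg_neg]
      exact (h t ht).1

/-- Stability of the stable space and of the `L²` estimates under perturbations. -/
theorem IsDichotomy.exists_stable {L Pm Pp : E →L[ℂ] E} (hd : IsDichotomy L Pm Pp) :
    ∃ ε > 0, ∃ C > 0, ∀ P : E →L[ℂ] E, ‖P - L‖ ≤ ε →
      IsCompl (specNeg (P : E →ₗ[ℂ] E)) (specNeg (-L : E →ₗ[ℂ] E)) ∧
      (∀ a ∈ specNeg (P : E →ₗ[ℂ] E), ‖a - Pm a‖ ≤ C * ‖P - L‖ * ‖a‖) ∧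
      ∀ f u, IsSol P f u → hnorm u + ‖u 0‖ ≤ C * (hnorm f + ‖Pm (u 0)‖) := by
  have hcs : CompleteSpace E := FiniteDimensional.complete ℂ E
  obtain ⟨ε₁, hε₁, C₁, hC₁, h₁⟩ := hd.exists_estimate
  obtain ⟨ε₂, hε₂, C₂, hC₂, h₂⟩ := hd.neg.exists_estimate
  have hzero : hnorm (fun _ : ℝ => (0 : E)) = 0 := by simp [hnorm]
  -- For v in both spaces, the decaying P-solution starting at v has no source and no stable trace
  -- with respect to A, so the estimate forces v = 0.
  have hdisj : ∀ {A : E →L[ℂ] E} {Q Q' : E →L[ℂ] E} {ε C : ℝ}, IsDichotomy A Q Q' →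
      (∀ P : E →L[ℂ] E, ‖P - A‖ ≤ ε → NoImagEigenvalue (P : E →ₗ[ℂ] E) ∧
        ∀ f u, IsSol P f u → hnorm u + ‖u 0‖ ≤ C * (hnorm f + ‖Q (u 0)‖)) →
      ∀ P : E →L[ℂ] E, ‖P - A‖ ≤ ε →
        Disjoint (specNeg (P : E →ₗ[ℂ] E)) (specNeg (-A : E →ₗ[ℂ] E)) := by
    intro A Q Q' ε C hA h P hP
    rw [Submodule.disjoint_def]
    intro v hv hv'
    have h3 := (h P hP).2 _ _ (isSol_flow hv)
    simp only [hzero, flow_zero, one_apply_eq_self, hA.apply_pos v hv', norm_zero, add_zero,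
      mul_zero] at h3
    have := hnorm_nonneg (fun z => flow P z v)
    exact norm_le_zero_iff.1 (by linarith)
  have hfr : ∀ A : E →ₗ[ℂ] E, NoImagEigenvalue A → Module.finrank ℂ (specNeg A) +
      Module.finrank ℂ (specNeg (-A)) = Module.finrank ℂ E := fun A hA =>
    Submodule.finrank_add_eq_of_isCompl (isCompl_specNeg hA)
  have hL := hfr _ (h₁ L (by rw [sub_self, norm_zero]; exact hε₁.le)).1
  refine ⟨min ε₁ ε₂, lt_min hε₁ hε₂, max C₁ (C₁ * (C₁ * ‖Pm‖)), lt_max_of_lt_left hC₁,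
    fun P hP => ⟨?_, fun a ha => ?_, fun f u hu => ?_⟩⟩
  · have hP₁ := hP.trans (min_le_left _ _)
    have hP₂ : ‖-P - -L‖ ≤ ε₂ := by
      rw [neg_sub_neg, norm_sub_rev]
      exact hP.trans (min_le_right _ _)
    have hPf := hfr _ (h₁ P hP₁).1
    have d₁ := hdisj hd h₁ P hP₁
    have d₂ := hdisj hd.neg h₂ (-P) hP₂
    have d₂' : Disjoint (specNeg (-P : E →ₗ[ℂ] E)) (specNeg (L : E →ₗ[ℂ] E)) := by
      convert! d₂ using 2
      exact (neg_neg _).symm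
    -- Disjointness gives dim 𝔼⁻(P) + dim 𝔼⁺(L) ≤ dim E, and the same with P and L exchanged. The
    -- two left sides add up to 2 dim E, so both inequalities are equalities.
    have e₁ := Submodule.finrank_add_finrank_le_of_disjoint d₁
    have e₂ := Submodule.finrank_add_finrank_le_of_disjoint d₂'
    exact (Submodule.isCompl_iff_disjoint _ _ (by omega)).2 d₁
  · have hP₁ := hP.trans (min_le_left _ _)
    have hy := isSol_flow ha
    have h3 := (h₁ P hP₁).2 _ _ hy
    simp only [hzero, flow_zero, one_apply_eq_self, zero_add] at h3
    -- The difference of the P-solution from a and the L-solution from Pm a solves the L equation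
    -- with source (P - L)e^{zP}a. Its trace a - Pm a has no stable part, hence is O(‖P - L‖).
    have h4 := (h₁ L (by rw [sub_self, norm_zero]; exact hε₁.le)).2 _ _
      ((hy.of_perturbation (L := L)).sub (isSol_flow (hd.mem_neg a)))
    have h5 : Pm (a - Pm a) = 0 := by
      rw [map_sub, hd.apply_neg _ (hd.mem_neg a), sub_self]
    simp only [flow_zero, one_apply_eq_self, h5, norm_zero, add_zero, sub_zero] at h4
    have h6 : hnorm (fun z => (P - L) (flow P z a)) ≤ ‖P - L‖ * hnorm (fun z => flow P z a) :=
      hnorm_le_of_norm_le hy.memLp (norm_nonneg _) fun z => (P - L).le_opNorm _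
    have h7 := hnorm_nonneg fun z => flow P z a - flow L z (Pm a)
    calc ‖a - Pm a‖ ≤ C₁ * (‖P - L‖ * hnorm (fun z => flow P z a)) := by
          refine le_trans ?_ (mul_le_mul_of_nonneg_left h6 hC₁.le)
          linarith
      _ ≤ C₁ * (‖P - L‖ * (C₁ * (‖Pm‖ * ‖a‖))) := by
          gcongr
          have h8 := Pm.le_opNorm a
          have h9 : C₁ * ‖Pm a‖ ≤ C₁ * (‖Pm‖ * ‖a‖) := by gcongr
          linarith [norm_nonneg a]
      _ = C₁ * (C₁ * ‖Pm‖) * ‖P - L‖ * ‖a‖ := by ring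
      _ ≤ _ := by gcongr; exact le_max_right _ _
  · refine ((h₁ P (hP.trans (min_le_left _ _))).2 f u hu).trans ?_
    have := hnorm_nonneg f
    gcongr
    exact le_max_left _ _

theorem finrank_map_of_injOn {V W : Type*} [AddCommGroup V] [Module ℂ V] [AddCommGroup W]
    [Module ℂ W] (p : Submodule ℂ V) (Γ : V →ₗ[ℂ] W) (h : ∀ a ∈ p, Γ a = 0 → a = 0) :
    Module.finrank ℂ (p.map Γ) = Module.finrank ℂ p := by
  rw [← LinearMap.range_domRestrict]
  refine LinearMap.finrank_range_of_inj ?_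
  rw [injective_iff_map_eq_zero]
  exact fun a ha => Subtype.ext (h a a.2 ha)

/-- Uniform solvability of the parabolic part of the boundary value problem. -/
theorem exists_boundary_estimate {B : Type*} [NormedAddCommGroup B] [NormedSpace ℂ B]
    [FiniteDimensional ℂ B] {L : E →L[ℂ] E} (hL : NoImagEigenvalue (L : E →ₗ[ℂ] E))
    (Γ₀ : E →L[ℂ] B) (hinj : ∀ a ∈ specNeg (L : E →ₗ[ℂ] E), Γ₀ a = 0 → a = 0)
    {FH : Submodule ℂ B} (hFH : IsCompl FH ((specNeg (L : E →ₗ[ℂ] E)).map (Γ₀ : E →ₗ[ℂ] B))) :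
    ∃ ε > 0, ∃ C > 0, ∀ (P : E →L[ℂ] E) (Γ : E →L[ℂ] B), ‖P - L‖ ≤ ε → ‖Γ - Γ₀‖ ≤ ε →
      IsCompl FH ((specNeg (P : E →ₗ[ℂ] E)).map (Γ : E →ₗ[ℂ] B)) ∧
      (∀ x ∈ FH, ∀ a ∈ specNeg (P : E →ₗ[ℂ] E), ‖x‖ + ‖a‖ ≤ C * ‖x + Γ a‖) ∧
      ∀ f u, IsSol P f u → hnorm u ≤ C * (hnorm f + ‖u 0‖) ∧
        ∃ a ∈ specNeg (P : E →ₗ[ℂ] E), ∃ b, u 0 = a + b ∧ ‖b‖ ≤ C * hnorm f := by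
  have hcs : CompleteSpace E := FiniteDimensional.complete ℂ E
  obtain ⟨Pm, Pp, hd⟩ := exists_isDichotomy hL
  obtain ⟨ε, hε, C, hC, h⟩ := hd.exists_stable
  -- the lower bound at the unperturbed operator
  obtain ⟨K, hK, hlow⟩ : ∃ K > 0, ∀ x ∈ FH, ∀ a ∈ specNeg (L : E →ₗ[ℂ] E),
      ‖x‖ + ‖a‖ ≤ K * ‖x + Γ₀ a‖ := by
    let J : FH × specNeg (L : E →ₗ[ℂ] E) →ₗ[ℂ] B :=
      (FH.subtype).coprod ((Γ₀ : E →ₗ[ℂ] B) ∘ₗ (specNeg (L : E →ₗ[ℂ] E)).subtype)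
    have hJ : LinearMap.ker J = ⊥ := by
      rw [LinearMap.ker_eq_bot']
      rintro ⟨x, a⟩ hxa
      have h1 : (x : B) + Γ₀ a = 0 := hxa
      have h2 : (x : B) = 0 := by
        refine (Submodule.disjoint_def.1 hFH.disjoint) x x.2 ?_
        rw [eq_neg_of_add_eq_zero_left h1]
        exact Submodule.neg_mem _ (Submodule.mem_map_of_mem a.2)
      rw [h2, zero_add] at h1
      exact Prod.ext (Subtype.ext h2) (Subtype.ext (hinj a a.2 h1))
    obtain ⟨K, hK, hanti⟩ := J.exists_antilipschitzWith hJ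
    refine ⟨2 * K, by positivity, fun x hx a ha => ?_⟩
    have h1 := ZeroHomClass.bound_of_antilipschitz J hanti (⟨x, hx⟩, ⟨a, ha⟩)
    have h2 : ‖x‖ ≤ ‖((⟨x, hx⟩, ⟨a, ha⟩) : FH × specNeg (L : E →ₗ[ℂ] E))‖ :=
      norm_fst_le ((⟨x, hx⟩, ⟨a, ha⟩) : FH × specNeg (L : E →ₗ[ℂ] E))
    have h3 : ‖a‖ ≤ ‖((⟨x, hx⟩, ⟨a, ha⟩) : FH × specNeg (L : E →ₗ[ℂ] E))‖ :=
      norm_snd_le ((⟨x, hx⟩, ⟨a, ha⟩) : FH × specNeg (L : E →ₗ[ℂ] E))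
    have h4 : J (⟨x, hx⟩, ⟨a, ha⟩) = x + Γ₀ a := rfl
    rw [h4] at h1
    linarith
  -- The three summands account for the errors from Γ₀(a - Pm a), from (Γ - Γ₀)a and from a - Pm a.
  -- With ε ≤ 1/(2c) their sum is at most ‖a‖/2 and is absorbed.
  set c := K * ‖Γ₀‖ * C + K + C with hc
  have hc0 : 0 < c := by positivity
  refine ⟨min ε (1 / (2 * c)), by positivity, max (2 * K) (C * (‖Pm‖ + 1)),
    lt_max_of_lt_left (by positivity), fun P Γ hP hΓ => ?_⟩
  obtain ⟨hcompl, hgraph, hest⟩ := h P (hP.trans (min_le_left _ _))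
  have hbound : ∀ x ∈ FH, ∀ a ∈ specNeg (P : E →ₗ[ℂ] E), ‖x‖ + ‖a‖ ≤ 2 * K * ‖x + Γ a‖ := by
    intro x hx a ha
    have h1 := hlow x hx (Pm a) (hd.mem_neg a)
    have h2 := hgraph a ha
    have hP' := hP.trans (min_le_right _ _)
    have hΓ' := hΓ.trans (min_le_right _ _)
    have h3 : ‖x + Γ₀ (Pm a)‖ ≤ ‖x + Γ a‖ + ‖Γ - Γ₀‖ * ‖a‖ + ‖Γ₀‖ * ‖a - Pm a‖ := by
      have e : x + Γ₀ (Pm a) = (x + Γ a) - (Γ - Γ₀) a - Γ₀ (a - Pm a) := by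
        rw [sub_apply, map_sub]
        abel
      rw [e]
      refine (norm_sub_le _ _).trans (add_le_add ((norm_sub_le _ _).trans (add_le_add le_rfl ?_)) ?_)
      · exact (Γ - Γ₀).le_opNorm a
      · exact Γ₀.le_opNorm _
    have h4 : ‖a‖ ≤ ‖Pm a‖ + ‖a - Pm a‖ := by
      have := norm_add_le (Pm a) (a - Pm a)
      rwa [add_sub_cancel] at this
    have h5 : ‖Γ - Γ₀‖ * ‖a‖ ≤ 1 / (2 * c) * ‖a‖ := by gcongr
    have h6 : ‖a - Pm a‖ ≤ C * (1 / (2 * c)) * ‖a‖ := h2.trans (by gcongr)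
    have h7 : K * (1 / (2 * c) * ‖a‖) + K * (‖Γ₀‖ * (C * (1 / (2 * c)) * ‖a‖)) +
        C * (1 / (2 * c)) * ‖a‖ = 1 / 2 * ‖a‖ := by
      rw [hc]
      have : K * ‖Γ₀‖ * C + K + C ≠ 0 := hc0.ne'
      field_simp
      ring
    have h8 : K * ‖x + Γ₀ (Pm a)‖ ≤ K * (‖x + Γ a‖ + 1 / (2 * c) * ‖a‖ +
        ‖Γ₀‖ * (C * (1 / (2 * c)) * ‖a‖)) := by
      gcongr
      exact h3.trans (by gcongr)
    nlinarith [norm_nonneg x]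
  have hinjP : ∀ a ∈ specNeg (P : E →ₗ[ℂ] E), (Γ : E →ₗ[ℂ] B) a = 0 → a = 0 := by
    intro a ha h0
    have h1 := hbound 0 (Submodule.zero_mem _) a ha
    have h2 : Γ a = 0 := h0
    rw [h2, norm_zero, add_zero, norm_zero, mul_zero, zero_add] at h1
    exact norm_le_zero_iff.1 h1
  refine ⟨?_, fun x hx a ha => (hbound x hx a ha).trans ?_, fun f u hu => ⟨?_, ?_⟩⟩
  · have hdj : Disjoint FH ((specNeg (P : E →ₗ[ℂ] E)).map (Γ : E →ₗ[ℂ] B)) := by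
      rw [Submodule.disjoint_def]
      rintro x hx ⟨a, ha, rfl⟩
      have h1 := hbound _ hx (-a) (Submodule.neg_mem _ ha)
      have h2 : (Γ : E →ₗ[ℂ] B) a + Γ (-a) = 0 := by
        rw [map_neg]
        exact add_neg_cancel _
      rw [h2, norm_zero, mul_zero] at h1
      exact norm_le_zero_iff.1 (by linarith [norm_nonneg (-a)])
    refine (Submodule.isCompl_iff_disjoint _ _ ?_).2 hdj
    have e₁ := Submodule.finrank_add_eq_of_isCompl hFH
    rw [finrank_map_of_injOn _ _ (fun a ha h => hinj a ha h)] at e₁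
    rw [finrank_map_of_injOn _ _ hinjP]
    have e₂ := Submodule.finrank_add_eq_of_isCompl hcompl
    have e₃ := Submodule.finrank_add_eq_of_isCompl (isCompl_specNeg hL)
    omega
  · gcongr
    exact le_max_left _ _
  · have h1 := hest f u hu
    have h2 := hnorm_nonneg f
    calc hnorm u ≤ C * (hnorm f + ‖Pm (u 0)‖) := by linarith [norm_nonneg (u 0)]
      _ ≤ C * ((‖Pm‖ + 1) * (hnorm f + ‖u 0‖)) := by
        gcongr
        have h3 := Pm.le_opNorm (u 0)
        nlinarith [norm_nonneg Pm, norm_nonneg (u 0)]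
      _ = C * (‖Pm‖ + 1) * (hnorm f + ‖u 0‖) := by ring
      _ ≤ _ := by gcongr; exact le_max_right _ _
  -- The trace is split along 𝔼⁻(P) ⊕ 𝔼⁺(L), with the unstable space of the fixed operator.
  -- Subtracting the homogeneous solution from a leaves the trace b, which Pm annihilates, so the
  -- source alone controls it.
  · obtain ⟨a, ha, b, hb, hab⟩ := Submodule.mem_sup.1
      (hcompl.sup_eq_top ▸ Submodule.mem_top : u 0 ∈ specNeg (P : E →ₗ[ℂ] E) ⊔ _)
    refine ⟨a, ha, b, hab.symm, ?_⟩
    have h1 := hest _ _ (hu.sub (isSol_flow ha))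
    simp only [flow_zero, one_apply_eq_self, sub_zero] at h1
    have h2 : u 0 - a = b := by rw [← hab]; abel
    rw [h2, hd.apply_pos b hb, norm_zero, add_zero] at h1
    have h3 := hnorm_nonneg f
    have h4 := hnorm_nonneg fun z => u z - flow P z a
    calc ‖b‖ ≤ C * hnorm f := by linarith
      _ ≤ C * (‖Pm‖ + 1) * hnorm f := by
        gcongr
        nlinarith [norm_nonneg Pm]
      _ ≤ _ := by gcongr; exact le_max_right _ _

end Perturbation

/-! ### Transport of solutions by linear maps and by dilations. -/

section Transfer

open MeasureTheory

variable {E : Type*} [NormedAddCommGroup E] [InnerProductSpace ℂ E] [FiniteDimensional ℂ E]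
variable {E' : Type*} [NormedAddCommGroup E'] [InnerProductSpace ℂ E'] [FiniteDimensional ℂ E']

theorem IsSol.map {L : E →L[ℂ] E} {L' : E' →L[ℂ] E'} {f u : ℝ → E} (h : IsSol L f u)
    (A : E →L[ℂ] E') (hA : ∀ v, A (L v) = L' (A v)) :
    IsSol L' (fun z => A (f z)) (fun z => A (u z)) := by
  have hcs : CompleteSpace E := FiniteDimensional.complete ℂ E
  have hcs' : CompleteSpace E' := FiniteDimensional.complete ℂ E'
  refine ⟨A.comp_memLp' h.memLp_source, A.comp_memLp' h.memLp, fun z hz => ?_⟩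
  have hi : IntervalIntegrable (fun s => L (u s) + f s) volume 0 z :=
    MemLp.intervalIntegrable ((L.comp_memLp' h.memLp).add h.memLp_source) hz
  rw [h.eq z hz, map_add, ← ContinuousLinearMap.intervalIntegral_comp_comm A hi]
  simp only [map_add, hA]

theorem IsSol.add {L : E →L[ℂ] E} {f u f' u' : ℝ → E} (h : IsSol L f u) (h' : IsSol L f' u') :
    IsSol L (fun z => f z + f' z) (fun z => u z + u' z) := by
  refine ⟨h.memLp_source.add h'.memLp_source, h.memLp.add h'.memLp, fun z hz => ?_⟩
  have hi : ∀ {f u}, IsSol L f u → IntervalIntegrable (fun s => L (u s) + f s) volume 0 z :=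
    fun h => MemLp.intervalIntegrable ((L.comp_memLp' h.memLp).add h.memLp_source) hz
  rw [h.eq z hz, h'.eq z hz, add_add_add_comm, ← intervalIntegral.integral_add (hi h) (hi h')]
  congr 1
  refine intervalIntegral.integral_congr fun s _ => ?_
  simp only [map_add]
  abel

theorem map_mul_halfLine {c : ℝ} (hc : 0 < c) :
    Measure.map (fun z => c * z) halfLine = ENNReal.ofReal c⁻¹ • halfLine := by
  have hme : MeasurableEmbedding fun z : ℝ => c * z :=
    (Homeomorph.mulLeft₀ c hc.ne').measurableEmbedding
  have hpre : (fun z : ℝ => c * z) ⁻¹' Ioi 0 = Ioi 0 := by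
    ext z
    simp [hc]
  have h1 := hme.restrict_map volume (Ioi (0 : ℝ))
  rw [hpre] at h1
  rw [halfLine, ← h1, Real.map_volume_mul_left hc.ne', Measure.restrict_smul, abs_of_pos (inv_pos.2 hc)]

theorem MemLp.comp_mul {f : ℝ → E} (hf : MemLp f 2 halfLine) {c : ℝ} (hc : 0 < c) :
    MemLp (fun z => f (c * z)) 2 halfLine := by
  have hme : MeasurableEmbedding fun z : ℝ => c * z :=
    (Homeomorph.mulLeft₀ c hc.ne').measurableEmbedding
  refine (hme.memLp_map_measure_iff (g := f)).1 ?_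
  rw [map_mul_halfLine hc]
  exact hf.smul_measure ENNReal.ofReal_ne_top

theorem hnorm_comp_mul (f : ℝ → E) {c : ℝ} (hc : 0 < c) :
    hnorm (fun z => f (c * z)) = (Real.sqrt c)⁻¹ * hnorm f := by
  have hme : MeasurableEmbedding fun z : ℝ => c * z :=
    (Homeomorph.mulLeft₀ c hc.ne').measurableEmbedding
  have h1 : eLpNorm (fun z => f (c * z)) 2 halfLine =
      eLpNorm f 2 (Measure.map (fun z => c * z) halfLine) :=
    (hme.eLpNorm_map_measure (g := f)).symm
  rw [hnorm, h1, map_mul_halfLine hc, eLpNorm_smul_measure_of_ne_top (by simp), smul_eq_mul,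
    ENNReal.toReal_mul, ENNReal.ofReal_rpow_of_pos (inv_pos.2 hc), ENNReal.toReal_ofReal
    (by positivity), hnorm]
  congr 1
  rw [← Real.sqrt_inv, Real.sqrt_eq_rpow]
  simp

theorem IsSol.comp_mul {L : E →L[ℂ] E} {f u : ℝ → E} (h : IsSol L f u) {c : ℝ} (hc : 0 < c) :
    IsSol ((c : ℂ) • L) (fun z => (c : ℂ) • f (c * z)) (fun z => u (c * z)) := by
  refine ⟨(MemLp.comp_mul h.memLp_source hc).const_smul (c : ℂ), MemLp.comp_mul h.memLp hc,
    fun z hz => ?_⟩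
  rw [h.eq (c * z) (by positivity), mul_zero]
  congr 1
  have h1 := intervalIntegral.smul_integral_comp_mul_left (fun s => L (u s) + f s) c
    (a := 0) (b := z)
  rw [mul_zero] at h1
  rw [← h1, ← intervalIntegral.integral_smul]
  refine intervalIntegral.integral_congr fun s _ => ?_
  simp only [smul_add, Complex.coe_smul, smul_apply]

end Transfer

/-! ### Elimination of the parabolic component at the boundary. -/

section Matching

variable {E₁ E₂ : Type*} [NormedAddCommGroup E₁] [InnerProductSpace ℂ E₁]
  [FiniteDimensional ℂ E₁] [NormedAddCommGroup E₂] [InnerProductSpace ℂ E₂]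
  [FiniteDimensional ℂ E₂] {β : Type*} [Fintype β]

theorem projAlong_mem {E F : Submodule ℂ (EuclideanSpace ℂ β)} (h : IsCompl E F)
    (y : EuclideanSpace ℂ β) : projAlong E F y ∈ E ∧ y - projAlong E F y ∈ F := by
  classical
  rw [projAlong, dif_pos h]
  refine ⟨Submodule.coe_mem _, ?_⟩
  have h1 := Submodule.projectionOnto_apply_eq_zero_iff h (x := y - E.projectionOnto F h y)
  refine h1.1 ?_
  rw [map_sub, Submodule.projectionOnto_apply_left, sub_self]

/-- The conclusions of `exists_boundary_estimate`, with a constant `C`. -/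
structure BoundaryEstimate (C : ℝ) (P : E₂ →L[ℂ] E₂) (Γ : E₂ →L[ℂ] EuclideanSpace ℂ β)
    (FH : Submodule ℂ (EuclideanSpace ℂ β)) : Prop where
  isCompl : IsCompl FH ((specNeg (P : E₂ →ₗ[ℂ] E₂)).map (Γ : E₂ →ₗ[ℂ] EuclideanSpace ℂ β))
  lower : ∀ x ∈ FH, ∀ a ∈ specNeg (P : E₂ →ₗ[ℂ] E₂), ‖x‖ + ‖a‖ ≤ C * ‖x + Γ a‖
  sol : ∀ f u, IsSol P f u → hnorm u ≤ C * (hnorm f + ‖u 0‖) ∧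
    ∃ a ∈ specNeg (P : E₂ →ₗ[ℂ] E₂), ∃ b, u 0 = a + b ∧ ‖b‖ ≤ C * hnorm f

variable {P : E₂ →L[ℂ] E₂} {Γ₁ : E₁ →L[ℂ] EuclideanSpace ℂ β} {Γ₂ : E₂ →L[ℂ] EuclideanSpace ℂ β}
  {FH : Submodule ℂ (EuclideanSpace ℂ β)} {C K : ℝ}

/-- The constant of the full problem in terms of that of the reduced problem. -/
theorem BoundaryEstimate.full_of_reduced (hC : 0 < C) (hK : 0 < K) {C₁ : ℝ} (hC₁ : 0 < C₁) :
    ∃ C₂ > 0, ∀ (H : E₁ →L[ℂ] E₁) (P : E₂ →L[ℂ] E₂) (Γ₁ : E₁ →L[ℂ] EuclideanSpace ℂ β)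
      (Γ₂ : E₂ →L[ℂ] EuclideanSpace ℂ β) (FH : Submodule ℂ (EuclideanSpace ℂ β)) (φ : ℝ),
      BoundaryEstimate C P Γ₂ FH → ‖Γ₁‖ ≤ K → ‖Γ₂‖ ≤ K → 0 < φ → φ ≤ 1 →
      (∀ f u, IsSol H f u → φ * hnorm u + ‖u 0‖ ≤ C₁ * (φ⁻¹ * hnorm f + ‖projAlong FH
        ((specNeg (P : E₂ →ₗ[ℂ] E₂)).map (Γ₂ : E₂ →ₗ[ℂ] EuclideanSpace ℂ β)) (Γ₁ (u 0))‖)) →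
      ∀ f₁ u₁ f₂ u₂, IsSol H f₁ u₁ → IsSol P f₂ u₂ →
        φ * hnorm u₁ + ‖u₁ 0‖ + hnorm u₂ + ‖u₂ 0‖ ≤
          C₂ * (φ⁻¹ * (hnorm f₁ + hnorm f₂) + ‖Γ₁ (u₁ 0) + Γ₂ (u₂ 0)‖) := by
  -- In units of the right-hand side X, c₁ bounds the u₁ terms and c₂ the trace u₂(0).
  set c₁ := C₁ * (1 + C * (1 + K * C)) with hc₁
  set c₂ := C * (1 + K * C + K * c₁) + C with hc₂
  have hc₁0 : 0 < c₁ := by positivity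
  have hc₂0 : 0 < c₂ := by positivity
  refine ⟨c₁ + c₂ + C * (1 + c₂), by positivity,
    fun H P Γ₁ Γ₂ FH φ hbd hΓ₁ hΓ₂ hφ hφ1 hred f₁ u₁ f₂ u₂ h₁ h₂ => ?_⟩
  set g := Γ₁ (u₁ 0) + Γ₂ (u₂ 0) with hg
  set X := φ⁻¹ * (hnorm f₁ + hnorm f₂) + ‖g‖ with hX
  have hφi : 1 ≤ φ⁻¹ := (one_le_inv₀ hφ).2 hφ1
  have hf₁ : 0 ≤ hnorm f₁ := hnorm_nonneg _
  have hf₂ : 0 ≤ hnorm f₂ := hnorm_nonneg _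
  have hm₁ : 0 ≤ φ⁻¹ * hnorm f₁ := by positivity
  have hm₂ : hnorm f₂ ≤ φ⁻¹ * hnorm f₂ := le_mul_of_one_le_left hf₂ hφi
  have hXe : X = φ⁻¹ * hnorm f₁ + φ⁻¹ * hnorm f₂ + ‖g‖ := by rw [hX, mul_add]
  have hgX : ‖g‖ ≤ X := by linarith
  have hf₂X : hnorm f₂ ≤ X := by linarith [norm_nonneg g]
  have hgf : ‖g‖ + hnorm f₂ ≤ X := by linarith
  have hX0 : 0 ≤ X := (norm_nonneg g).trans hgX
  obtain ⟨hu₂, a, ha, b, hab, hb⟩ := hbd.sol f₂ u₂ h₂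
  have hΓb : ‖Γ₂ b‖ ≤ K * (C * hnorm f₂) := by
    calc _ ≤ ‖Γ₂‖ * ‖b‖ := Γ₂.le_opNorm b
      _ ≤ _ := by gcongr
  obtain ⟨hh, a', ha', haa'⟩ := projAlong_mem hbd.isCompl (Γ₁ (u₁ 0))
  set h := projAlong FH _ (Γ₁ (u₁ 0)) with hh'
  -- The boundary condition is sorted along 𝔽_H ⊕ 𝔽_P: Γ₂ a' is the 𝔽_P part of Γ₁u₁(0), and a is
  -- the stable part of u₂(0). The lower bound then controls h, the datum of the reduced problem, by
  -- g and the small part b.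
  have e₁ : h + Γ₂ (a' + a) = g - Γ₂ b := by
    have h3 : Γ₂ a' = Γ₁ (u₁ 0) - h := haa'
    rw [map_add, h3, hg, hab, map_add]
    abel
  have hgb : ‖g - Γ₂ b‖ ≤ (1 + K * C) * X := by
    calc _ ≤ ‖g‖ + ‖Γ₂ b‖ := norm_sub_le _ _
      _ ≤ X + K * (C * X) := by
        gcongr
        exact hΓb.trans (by gcongr)
      _ = _ := by ring
  have hhX : ‖h‖ ≤ C * ((1 + K * C) * X) := by
    have h3 := hbd.lower h hh _ (Submodule.add_mem _ ha' ha)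
    rw [e₁] at h3
    have h4 : C * ‖g - Γ₂ b‖ ≤ C * ((1 + K * C) * X) := by gcongr
    linarith [norm_nonneg (a' + a)]
  have hu₁ : φ * hnorm u₁ + ‖u₁ 0‖ ≤ c₁ * X := by
    calc _ ≤ C₁ * (φ⁻¹ * hnorm f₁ + ‖h‖) := hred f₁ u₁ h₁
      _ ≤ C₁ * (X + C * ((1 + K * C) * X)) := by
        gcongr
        linarith [norm_nonneg g]
      _ = _ := by rw [hc₁]; ring
  have hu₁0 : ‖u₁ 0‖ ≤ c₁ * X := by
    have : 0 ≤ φ * hnorm u₁ := mul_nonneg hφ.le (hnorm_nonneg _)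
    linarith
  -- Once u₁(0) is known, the boundary condition determines Γ₂a, and the lower bound with zero 𝔽_H
  -- component recovers a.
  have haX : ‖a‖ ≤ C * ((1 + K * C) * X + K * (c₁ * X)) := by
    have h3 := hbd.lower 0 (Submodule.zero_mem _) a ha
    have e₂ : 0 + Γ₂ a = (g - Γ₂ b) - Γ₁ (u₁ 0) := by
      rw [hg, hab, map_add]
      abel
    rw [e₂, norm_zero, zero_add] at h3
    refine h3.trans ?_
    gcongr
    refine (norm_sub_le _ _).trans (add_le_add hgb ?_)
    calc _ ≤ ‖Γ₁‖ * ‖u₁ 0‖ := Γ₁.le_opNorm _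
      _ ≤ _ := by gcongr
  have hu₂0 : ‖u₂ 0‖ ≤ c₂ * X := by
    calc _ ≤ ‖a‖ + ‖b‖ := by rw [hab]; exact norm_add_le _ _
      _ ≤ C * ((1 + K * C) * X + K * (c₁ * X)) + C * X :=
        add_le_add haX (hb.trans (by gcongr))
      _ = _ := by rw [hc₂]; ring
  have hu₂n : hnorm u₂ ≤ C * (X + c₂ * X) := hu₂.trans (by gcongr)
  calc _ ≤ c₁ * X + C * (X + c₂ * X) + c₂ * X := by linarith
    _ = _ := by ring

/-- A solution of the reduced problem is completed by the source-free decaying parabolic solution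
whose trace cancels the 𝔽_P part of Γ₁u(0). The full boundary datum is then exactly the projected
one. -/
theorem BoundaryEstimate.reduced_of_full (hbd : BoundaryEstimate C P Γ₂ FH) {H : E₁ →L[ℂ] E₁}
    {C₂ φ : ℝ} (hfull : ∀ f₁ u₁ f₂ u₂, IsSol H f₁ u₁ → IsSol P f₂ u₂ →
      φ * hnorm u₁ + ‖u₁ 0‖ + hnorm u₂ + ‖u₂ 0‖ ≤
        C₂ * (φ⁻¹ * (hnorm f₁ + hnorm f₂) + ‖Γ₁ (u₁ 0) + Γ₂ (u₂ 0)‖)) {f u : ℝ → E₁}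
    (hu : IsSol H f u) : φ * hnorm u + ‖u 0‖ ≤ C₂ * (φ⁻¹ * hnorm f + ‖projAlong FH
      ((specNeg (P : E₂ →ₗ[ℂ] E₂)).map (Γ₂ : E₂ →ₗ[ℂ] EuclideanSpace ℂ β)) (Γ₁ (u 0))‖) := by
  have hcs : CompleteSpace E₂ := FiniteDimensional.complete ℂ E₂
  obtain ⟨-, a, ha, haa⟩ := projAlong_mem hbd.isCompl (Γ₁ (u 0))
  set h := projAlong FH _ (Γ₁ (u 0)) with hh'
  have h1 := hfull f u _ _ hu (isSol_flow (Submodule.neg_mem _ ha))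
  have hzero : hnorm (fun _ : ℝ => (0 : E₂)) = 0 := by simp [hnorm]
  have e : Γ₁ (u 0) + Γ₂ (flow P 0 (-a)) = h := by
    have h3 : Γ₂ a = Γ₁ (u 0) - h := haa
    rw [flow_zero, one_apply_eq_self, map_neg, h3]
    abel
  rw [e, hzero, add_zero] at h1
  have h4 := hnorm_nonneg fun z => flow P z (-a)
  linarith [norm_nonneg (flow P 0 (-a))]

end Matching

/-! ### Weighted estimates under change of basis and rescaling. -/

section Operators

open MeasureTheory

variable {α β κ : Type*} [Fintype α] [DecidableEq α] [Fintype β] [DecidableEq β] [Fintype κ]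
  [DecidableEq κ]

/-- The continuous linear map defined by a matrix. -/
def op (M : Matrix β α ℂ) : EuclideanSpace ℂ α →L[ℂ] EuclideanSpace ℂ β :=
  LinearMap.toContinuousLinearMap (act M)

theorem isL2Solution_iff {M : Matrix α α ℂ} {F U : ℝ → EuclideanSpace ℂ α} :
    IsL2Solution M F U ↔ IsSol (op M) F U :=
  ⟨fun h => ⟨h.1, h.2, h.3⟩, fun h => ⟨h.1, h.2, h.3⟩⟩

theorem op_mul (M : Matrix κ β ℂ) (N : Matrix β α ℂ) (v : EuclideanSpace ℂ α) :
    op (M * N) v = op M (op N v) := act_mul M N v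

theorem op_one (v : EuclideanSpace ℂ α) : op (1 : Matrix α α ℂ) v = v := act_one v

theorem op_smul (c : ℂ) (M : Matrix β α ℂ) : op (c • M) = c • op M := by
  ext1 v
  apply (WithLp.equiv 2 _).injective
  exact Matrix.smul_mulVec c M v.ofLp

theorem op_sum {ι : Type*} (s : Finset ι) (M : ι → Matrix β α ℂ) :
    op (∑ i ∈ s, M i) = ∑ i ∈ s, op (M i) := by
  let T : Matrix β α ℂ →ₗ[ℂ] (EuclideanSpace ℂ α →L[ℂ] EuclideanSpace ℂ β) :=
    { toFun := op
      map_add' := fun M N => by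
        ext1 v
        apply (WithLp.equiv 2 _).injective
        exact Matrix.add_mulVec M N v.ofLp
      map_smul' := op_smul }
  exact map_sum T M s

theorem comp₁_op (M : Matrix (α ⊕ β) (α ⊕ β) ℂ) (U : EuclideanSpace ℂ (α ⊕ β)) :
    comp₁ (op M U) = op M.toBlocks₁₁ (comp₁ U) + op M.toBlocks₁₂ (comp₂ U) := by
  apply (WithLp.equiv 2 _).injective
  ext i
  change M.mulVec U.ofLp (Sum.inl i) = _
  conv_lhs => rw [← Matrix.fromBlocks_toBlocks M, Matrix.fromBlocks_mulVec]
  rfl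

theorem comp₂_op (M : Matrix (α ⊕ β) (α ⊕ β) ℂ) (U : EuclideanSpace ℂ (α ⊕ β)) :
    comp₂ (op M U) = op M.toBlocks₂₁ (comp₁ U) + op M.toBlocks₂₂ (comp₂ U) := by
  apply (WithLp.equiv 2 _).injective
  ext i
  change M.mulVec U.ofLp (Sum.inr i) = _
  conv_lhs => rw [← Matrix.fromBlocks_toBlocks M, Matrix.fromBlocks_mulVec]
  rfl

theorem op_cols (M : Matrix κ (α ⊕ β) ℂ) (U : EuclideanSpace ℂ (α ⊕ β)) :
    op M U = op M.toCols₁ (comp₁ U) + op M.toCols₂ (comp₂ U) := by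
  apply (WithLp.equiv 2 _).injective
  change M.mulVec U.ofLp = _
  conv_lhs => rw [← Matrix.fromCols_toCols M, Matrix.fromCols_mulVec]
  rfl

/-- `U ↦ U¹` as a continuous linear map. -/
def comp₁L : EuclideanSpace ℂ (α ⊕ β) →L[ℂ] EuclideanSpace ℂ α :=
  LinearMap.toContinuousLinearMap
    { toFun := comp₁, map_add' := fun _ _ => rfl, map_smul' := fun _ _ => rfl }

/-- `U ↦ U²` as a continuous linear map. -/
def comp₂L : EuclideanSpace ℂ (α ⊕ β) →L[ℂ] EuclideanSpace ℂ β :=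
  LinearMap.toContinuousLinearMap
    { toFun := comp₂, map_add' := fun _ _ => rfl, map_smul' := fun _ _ => rfl }

/-- `u ↦ (u, 0)`. -/
def incl₁ : EuclideanSpace ℂ α →L[ℂ] EuclideanSpace ℂ (α ⊕ β) :=
  LinearMap.toContinuousLinearMap
    { toFun := fun u => WithLp.toLp 2 (Sum.elim u.ofLp 0)
      map_add' := fun u v => by
        apply (WithLp.equiv 2 _).injective
        ext (i | i) <;> simp
      map_smul' := fun c u => by
        apply (WithLp.equiv 2 _).injective
        ext (i | i) <;> simp }

/-- `u ↦ (0, u)`. -/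
def incl₂ : EuclideanSpace ℂ β →L[ℂ] EuclideanSpace ℂ (α ⊕ β) :=
  LinearMap.toContinuousLinearMap
    { toFun := fun u => WithLp.toLp 2 (Sum.elim 0 u.ofLp)
      map_add' := fun u v => by
        apply (WithLp.equiv 2 _).injective
        ext (i | i) <;> simp
      map_smul' := fun c u => by
        apply (WithLp.equiv 2 _).injective
        ext (i | i) <;> simp }

theorem comp₁_incl (u : EuclideanSpace ℂ α) (v : EuclideanSpace ℂ β) :
    comp₁ (incl₁ u + incl₂ v) = u := by
  apply (WithLp.equiv 2 _).injective
  ext i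
  change u i + 0 = u i
  exact add_zero _

theorem comp₂_incl (u : EuclideanSpace ℂ α) (v : EuclideanSpace ℂ β) :
    comp₂ (incl₁ u + incl₂ v) = v := by
  apply (WithLp.equiv 2 _).injective
  ext i
  change 0 + v i = v i
  exact zero_add _

theorem ext_comp {U W : EuclideanSpace ℂ (α ⊕ β)} (h₁ : comp₁ U = comp₁ W)
    (h₂ : comp₂ U = comp₂ W) : U = W := by
  apply (WithLp.equiv 2 _).injective
  ext (i | i)
  · exact congrArg (fun x : EuclideanSpace ℂ α => x i) h₁
  · exact congrArg (fun x : EuclideanSpace ℂ β => x i) h₂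

theorem op_incl₂ {D : Matrix (α ⊕ β) (α ⊕ β) ℂ} (h₁₂ : D.toBlocks₁₂ = 0)
    (v : EuclideanSpace ℂ β) : op D (incl₂ v) = incl₂ (op D.toBlocks₂₂ v) :=
  ext_comp
    (by rw [comp₁_op, ← zero_add (incl₂ v), ← map_zero incl₁, comp₁_incl, comp₂_incl,
      ← zero_add (incl₂ (op D.toBlocks₂₂ v)), ← map_zero incl₁, comp₁_incl, h₁₂]; simp [op, act])
    (by rw [comp₂_op, ← zero_add (incl₂ v), ← map_zero incl₁, comp₁_incl, comp₂_incl,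
      ← zero_add (incl₂ (op D.toBlocks₂₂ v)), ← map_zero incl₁, comp₂_incl]; simp)

theorem norm_sq_eq_comp (U : EuclideanSpace ℂ (α ⊕ β)) :
    ‖U‖ ^ 2 = ‖comp₁ U‖ ^ 2 + ‖comp₂ U‖ ^ 2 := by
  rw [EuclideanSpace.norm_sq_eq, EuclideanSpace.norm_sq_eq, EuclideanSpace.norm_sq_eq,
    Fintype.sum_sum_type]
  rfl

theorem norm_comp₁_le (U : EuclideanSpace ℂ (α ⊕ β)) : ‖comp₁ U‖ ≤ ‖U‖ :=
  abs_le_of_sq_le_sq' (by nlinarith [norm_sq_eq_comp U]) (norm_nonneg _) |>.2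

theorem norm_comp₂_le (U : EuclideanSpace ℂ (α ⊕ β)) : ‖comp₂ U‖ ≤ ‖U‖ :=
  abs_le_of_sq_le_sq' (by nlinarith [norm_sq_eq_comp U]) (norm_nonneg _) |>.2

theorem norm_le_comp (U : EuclideanSpace ℂ (α ⊕ β)) : ‖U‖ ≤ ‖comp₁ U‖ + ‖comp₂ U‖ :=
  abs_le_of_sq_le_sq' (by
    nlinarith [norm_sq_eq_comp U, norm_nonneg (comp₁ U), norm_nonneg (comp₂ U)])
    (by positivity) |>.2

theorem memLp_comp₁ {U : ℝ → EuclideanSpace ℂ (α ⊕ β)} (hU : MemLp U 2 halfLine) :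
    MemLp (fun z => comp₁ (U z)) 2 halfLine :=
  (comp₁L : EuclideanSpace ℂ (α ⊕ β) →L[ℂ] EuclideanSpace ℂ α).comp_memLp' hU

theorem memLp_comp₂ {U : ℝ → EuclideanSpace ℂ (α ⊕ β)} (hU : MemLp U 2 halfLine) :
    MemLp (fun z => comp₂ (U z)) 2 halfLine :=
  (comp₂L : EuclideanSpace ℂ (α ⊕ β) →L[ℂ] EuclideanSpace ℂ β).comp_memLp' hU

theorem hnorm_comp₁_le {U : ℝ → EuclideanSpace ℂ (α ⊕ β)} (hU : MemLp U 2 halfLine) :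
    hnorm (fun z => comp₁ (U z)) ≤ hnorm U := by
  simpa using hnorm_le_of_norm_le hU zero_le_one fun z => by
    rw [one_mul]; exact norm_comp₁_le (U z)

theorem hnorm_comp₂_le {U : ℝ → EuclideanSpace ℂ (α ⊕ β)} (hU : MemLp U 2 halfLine) :
    hnorm (fun z => comp₂ (U z)) ≤ hnorm U := by
  simpa using hnorm_le_of_norm_le hU zero_le_one fun z => by
    rw [one_mul]; exact norm_comp₂_le (U z)

theorem hnorm_norm {E : Type*} [NormedAddCommGroup E] (f : ℝ → E) :
    hnorm (fun z => ‖f z‖) = hnorm f := by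
  unfold hnorm
  rw [eLpNorm_norm]

theorem hnorm_le_comp {U : ℝ → EuclideanSpace ℂ (α ⊕ β)} (hU : MemLp U 2 halfLine) :
    hnorm U ≤ hnorm (fun z => comp₁ (U z)) + hnorm (fun z => comp₂ (U z)) := by
  have h1 := hnorm_add_le (memLp_comp₁ hU).norm (memLp_comp₂ hU).norm
  rw [hnorm_norm, hnorm_norm] at h1
  refine le_trans ?_ h1
  have h3 := hnorm_le_of_norm_le (f := U) (g := fun z => ‖comp₁ (U z)‖ + ‖comp₂ (U z)‖)
    ((memLp_comp₁ hU).norm.add (memLp_comp₂ hU).norm) zero_le_one fun z => by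
      rw [one_mul, Real.norm_of_nonneg (by positivity)]
      exact norm_le_comp (U z)
  rwa [one_mul] at h3

theorem hnorm_op_le {M : Matrix β α ℂ} {K : ℝ} (hK : 0 ≤ K) (hM : ‖op M‖ ≤ K)
    {U : ℝ → EuclideanSpace ℂ α} (hU : MemLp U 2 halfLine) :
    hnorm (fun z => op M (U z)) ≤ K * hnorm U :=
  hnorm_le_of_norm_le hU hK fun z => (op M).le_of_opNorm_le hM (U z)

/-- The weighted norm of the maximal estimates. -/
def wnorm (φ : ℝ) (U : ℝ → EuclideanSpace ℂ (α ⊕ β)) : ℝ :=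
  φ * hnorm (fun z => comp₁ (U z)) + hnorm (fun z => comp₂ (U z)) + ‖U 0‖

/-- Bounds making a matrix bounded for the weighted norms. -/
structure WeightBound (φ K : ℝ) (M : Matrix (α ⊕ β) (α ⊕ β) ℂ) : Prop where
  b : ‖op M‖ ≤ K
  b₁₁ : ‖op M.toBlocks₁₁‖ ≤ K
  b₁₂ : ‖op M.toBlocks₁₂‖ ≤ K
  b₂₁ : ‖op M.toBlocks₂₁‖ ≤ K * φ
  b₂₂ : ‖op M.toBlocks₂₂‖ ≤ K

/-- U¹ carries the weight φ and U² the weight 1. The block sending U¹ into U² must therefore gain a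
factor φ, while the opposite block is harmless since φ ≤ 1. -/
theorem WeightBound.wnorm_le {φ K : ℝ} {M : Matrix (α ⊕ β) (α ⊕ β) ℂ} (h : WeightBound φ K M)
    (hφ : 0 ≤ φ) (hφ1 : φ ≤ 1) (hK : 0 ≤ K) {U : ℝ → EuclideanSpace ℂ (α ⊕ β)}
    (hU : MemLp U 2 halfLine) : wnorm φ (fun z => op M (U z)) ≤ 2 * K * wnorm φ U := by
  have hU₁ := memLp_comp₁ hU
  have hU₂ := memLp_comp₂ hU
  have n₁ := hnorm_nonneg fun z => comp₁ (U z)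
  have n₂ := hnorm_nonneg fun z => comp₂ (U z)
  have h₁ : hnorm (fun z => comp₁ (op M (U z))) ≤
      K * hnorm (fun z => comp₁ (U z)) + K * hnorm (fun z => comp₂ (U z)) := by
    simp only [comp₁_op]
    exact (hnorm_add_le ((op M.toBlocks₁₁).comp_memLp' hU₁)
      ((op M.toBlocks₁₂).comp_memLp' hU₂)).trans
      (add_le_add (hnorm_op_le hK h.b₁₁ hU₁) (hnorm_op_le hK h.b₁₂ hU₂))
  have h₂ : hnorm (fun z => comp₂ (op M (U z))) ≤
      K * φ * hnorm (fun z => comp₁ (U z)) + K * hnorm (fun z => comp₂ (U z)) := by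
    simp only [comp₂_op]
    exact (hnorm_add_le ((op M.toBlocks₂₁).comp_memLp' hU₁)
      ((op M.toBlocks₂₂).comp_memLp' hU₂)).trans
      (add_le_add (hnorm_op_le (by positivity) h.b₂₁ hU₁) (hnorm_op_le hK h.b₂₂ hU₂))
  have h₃ : ‖op M (U 0)‖ ≤ K * ‖U 0‖ := (op M).le_of_opNorm_le h.b _
  unfold wnorm
  have h₄ : φ * hnorm (fun z => comp₁ (op M (U z))) ≤
      φ * (K * hnorm (fun z => comp₁ (U z)) + K * hnorm (fun z => comp₂ (U z))) := by gcongr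
  have h₅ : φ * (K * hnorm (fun z => comp₂ (U z))) ≤ 1 * (K * hnorm (fun z => comp₂ (U z))) := by
    gcongr
  have h₆ : 0 ≤ K * ‖U 0‖ := by positivity
  nlinarith

/-- The maximal estimate with constant `C` for one block diagonal system. -/
def FullEstimate (C φ : ℝ) (H : Matrix α α ℂ) (P : Matrix β β ℂ) (Γ₁ : Matrix κ α ℂ)
    (Γ₂ : Matrix κ β ℂ) : Prop :=
  ∀ f₁ u₁ f₂ u₂, IsSol (op H) f₁ u₁ → IsSol (op P) f₂ u₂ →
    φ * hnorm u₁ + ‖u₁ 0‖ + hnorm u₂ + ‖u₂ 0‖ ≤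
      C * (φ⁻¹ * (hnorm f₁ + hnorm f₂) + ‖op Γ₁ (u₁ 0) + op Γ₂ (u₂ 0)‖)

variable {V G : Matrix (α ⊕ β) (α ⊕ β) ℂ} {Γ : Matrix κ (α ⊕ β) ℂ} {φ K C : ℝ}

/-- Solutions of the two block equations assemble into U = Vu. Sources are measured without
component weights, so V need only be bounded; the weighted bound is needed for V⁻¹, which returns
from U to u. -/
theorem fullEstimate_of_conj (hV : V.det ≠ 0) (h₁₂ : (V⁻¹ * G * V).toBlocks₁₂ = 0)
    (h₂₁ : (V⁻¹ * G * V).toBlocks₂₁ = 0) (hb : ‖op V‖ ≤ K) (hbi : WeightBound φ K V⁻¹)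
    (hφ : 0 < φ) (hφ1 : φ ≤ 1) (hK : 0 ≤ K) (hC : 0 ≤ C)
    (h : ∀ F U, IsSol (op G) F U → wnorm φ U ≤ C * (φ⁻¹ * hnorm F + ‖op Γ (U 0)‖)) :
    FullEstimate (4 * K * C * (K + 1)) φ (V⁻¹ * G * V).toBlocks₁₁ (V⁻¹ * G * V).toBlocks₂₂
      (Γ * V).toCols₁ (Γ * V).toCols₂ := by
  intro f₁ u₁ f₂ u₂ s₁ s₂
  have hVu : IsUnit V.det := isUnit_iff_ne_zero.2 hV
  set D := V⁻¹ * G * V with hD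
  have t₁ := s₁.map (L' := op D) incl₁ fun v => ext_comp
    (by rw [comp₁_op, ← add_zero (incl₁ v), ← map_zero incl₂, comp₁_incl, comp₂_incl,
      ← add_zero (incl₁ (op D.toBlocks₁₁ v)), ← map_zero incl₂, comp₁_incl]; simp)
    (by rw [comp₂_op, ← add_zero (incl₁ v), ← map_zero incl₂, comp₁_incl, comp₂_incl,
      ← add_zero (incl₁ (op D.toBlocks₁₁ v)), ← map_zero incl₂, comp₂_incl, h₂₁]; simp [op, act])
  have t₂ := s₂.map (L' := op D) incl₂ fun v => (op_incl₂ h₁₂ v).symm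
  have t := t₁.add t₂
  set u : ℝ → EuclideanSpace ℂ (α ⊕ β) := fun z => incl₁ (u₁ z) + incl₂ (u₂ z) with hu
  set f : ℝ → EuclideanSpace ℂ (α ⊕ β) := fun z => incl₁ (f₁ z) + incl₂ (f₂ z) with hf
  have hVD : V * D = G * V := by
    rw [hD, ← Matrix.mul_assoc, Matrix.mul_nonsing_inv_cancel_left _ _ hVu]
  have T := t.map (L' := op G) (op V) fun v => by rw [← op_mul, hVD, op_mul]
  have h1 := h _ _ T
  have h2 := hbi.wnorm_le hφ.le hφ1 hK T.memLp
  have e1 : (fun z => op V⁻¹ (op V (u z))) = u := by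
    ext1 z
    rw [← op_mul, Matrix.nonsing_inv_mul _ hVu, op_one]
  rw [e1] at h2
  have e2 : op Γ (op V (u 0)) = op (Γ * V).toCols₁ (u₁ 0) + op (Γ * V).toCols₂ (u₂ 0) := by
    rw [← op_mul, op_cols, hu, comp₁_incl, comp₂_incl]
  rw [e2] at h1
  have e3 : wnorm φ u = φ * hnorm u₁ + hnorm u₂ + ‖u 0‖ := by
    unfold wnorm
    simp only [hu, comp₁_incl, comp₂_incl]
  have n1 : ‖u₁ 0‖ ≤ ‖u 0‖ := by
    have := norm_comp₁_le (u 0)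
    rwa [hu, comp₁_incl] at this
  have n2 : ‖u₂ 0‖ ≤ ‖u 0‖ := by
    have := norm_comp₂_le (u 0)
    rwa [hu, comp₂_incl] at this
  have n3 : hnorm (fun z => op V (f z)) ≤ K * (hnorm f₁ + hnorm f₂) := by
    refine (hnorm_op_le hK hb t.memLp_source).trans ?_
    gcongr
    have := hnorm_le_comp t.memLp_source
    simpa only [hf, comp₁_incl, comp₂_incl] using this
  have p1 := hnorm_nonneg u₁
  have p2 := hnorm_nonneg u₂
  have p3 := hnorm_nonneg f₁
  have p4 := hnorm_nonneg f₂
  set g := ‖op (Γ * V).toCols₁ (u₁ 0) + op (Γ * V).toCols₂ (u₂ 0)‖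
  have hg : 0 ≤ g := norm_nonneg _
  calc _ ≤ 2 * wnorm φ u := by
        rw [e3]
        have : 0 ≤ φ * hnorm u₁ := by positivity
        linarith
    _ ≤ 2 * (2 * K * (C * (φ⁻¹ * (K * (hnorm f₁ + hnorm f₂)) + g))) := by
        gcongr
        refine h2.trans ?_
        gcongr
        refine h1.trans ?_
        gcongr
    _ = 4 * K * C * (K * (φ⁻¹ * (hnorm f₁ + hnorm f₂)) + g) := by ring
    _ ≤ 4 * K * C * ((K + 1) * (φ⁻¹ * (hnorm f₁ + hnorm f₂)) + (K + 1) * g) := by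
        have : 0 ≤ φ⁻¹ * (hnorm f₁ + hnorm f₂) := by positivity
        gcongr
        · linarith
        · nlinarith
    _ = _ := by ring

/-- Here the roles are exchanged: sources pass through V⁻¹ and solutions return through V. -/
theorem FullEstimate.conj (hV : V.det ≠ 0) (h₁₂ : (V⁻¹ * G * V).toBlocks₁₂ = 0)
    (h₂₁ : (V⁻¹ * G * V).toBlocks₂₁ = 0) (hb : WeightBound φ K V) (hbi : ‖op V⁻¹‖ ≤ K)
    (hφ : 0 < φ) (hφ1 : φ ≤ 1) (hK : 0 ≤ K) (hC : 0 ≤ C)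
    (h : FullEstimate C φ (V⁻¹ * G * V).toBlocks₁₁ (V⁻¹ * G * V).toBlocks₂₂
      (Γ * V).toCols₁ (Γ * V).toCols₂) {F U : ℝ → EuclideanSpace ℂ (α ⊕ β)}
    (hU : IsSol (op G) F U) :
    wnorm φ U ≤ 4 * K * C * (K + 1) * (φ⁻¹ * hnorm F + ‖op Γ (U 0)‖) := by
  have hVu : IsUnit V.det := isUnit_iff_ne_zero.2 hV
  set D := V⁻¹ * G * V with hD
  have hDV : V⁻¹ * G = D * V⁻¹ := by
    rw [hD, Matrix.mul_assoc (V⁻¹ * G), Matrix.mul_nonsing_inv _ hVu, Matrix.mul_one]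
  have t := hU.map (L' := op D) (op V⁻¹) fun v => by rw [← op_mul, hDV, op_mul]
  set u : ℝ → EuclideanSpace ℂ (α ⊕ β) := fun z => op V⁻¹ (U z) with hu
  set f : ℝ → EuclideanSpace ℂ (α ⊕ β) := fun z => op V⁻¹ (F z) with hf
  have s₁ := t.map (L' := op D.toBlocks₁₁) comp₁L fun v => by
    change comp₁ (op D v) = op D.toBlocks₁₁ (comp₁ v)
    rw [comp₁_op, h₁₂]
    simp [op, act]
  have s₂ := t.map (L' := op D.toBlocks₂₂) comp₂L fun v => by
    change comp₂ (op D v) = op D.toBlocks₂₂ (comp₂ v)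
    rw [comp₂_op, h₂₁]
    simp [op, act]
  have h1 := h _ _ _ _ s₁ s₂
  have e1 : (fun z => op V (u z)) = U := by
    ext1 z
    rw [hu, ← op_mul, Matrix.mul_nonsing_inv _ hVu, op_one]
  have e2 : op (Γ * V).toCols₁ (comp₁L (u 0)) + op (Γ * V).toCols₂ (comp₂L (u 0)) =
      op Γ (U 0) := by
    change op (Γ * V).toCols₁ (comp₁ (u 0)) + op (Γ * V).toCols₂ (comp₂ (u 0)) = _
    rw [← op_cols, op_mul]
    exact congrArg (op Γ) (congrFun e1 0)
  rw [e2] at h1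
  have h2 := hb.wnorm_le hφ.le hφ1 hK t.memLp
  rw [e1] at h2
  have n1 := norm_le_comp (u 0)
  have n2 : hnorm (fun z => comp₁L (f z)) ≤ K * hnorm F :=
    (hnorm_comp₁_le t.memLp_source).trans (hnorm_op_le hK hbi hU.memLp_source)
  have n3 : hnorm (fun z => comp₂L (f z)) ≤ K * hnorm F :=
    (hnorm_comp₂_le t.memLp_source).trans (hnorm_op_le hK hbi hU.memLp_source)
  have p1 := hnorm_nonneg F
  have h3 : wnorm φ u ≤ φ * hnorm (fun z => comp₁L (u z)) + ‖comp₁L (u 0)‖ +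
      hnorm (fun z => comp₂L (u z)) + ‖comp₂L (u 0)‖ := by
    change φ * hnorm (fun z => comp₁L (u z)) + hnorm (fun z => comp₂L (u z)) + ‖u 0‖ ≤ _
    have n1' : ‖u 0‖ ≤ ‖comp₁L (u 0)‖ + ‖comp₂L (u 0)‖ := n1
    linarith
  set g := ‖op Γ (U 0)‖
  have hg : 0 ≤ g := norm_nonneg _
  calc _ ≤ 2 * K * (C * (φ⁻¹ * (K * hnorm F + K * hnorm F) + g)) := by
        refine h2.trans ?_
        gcongr
        refine (h3.trans h1).trans ?_
        gcongr
    _ = 4 * K * C * (K * (φ⁻¹ * hnorm F) + g / 2) := by ring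
    _ ≤ 4 * K * C * ((K + 1) * (φ⁻¹ * hnorm F) + (K + 1) * g) := by
        have : 0 ≤ φ⁻¹ * hnorm F := by positivity
        gcongr
        · linarith
        · nlinarith
    _ = _ := by ring

/-- The reduced maximal estimate with constant `C` for one system. -/
def ReducedEstimate (C φ : ℝ) (H : Matrix α α ℂ)
    (R : EuclideanSpace ℂ α →ₗ[ℂ] EuclideanSpace ℂ κ) : Prop :=
  ∀ f u, IsSol (op H) f u → φ * hnorm u + ‖u 0‖ ≤ C * (φ⁻¹ * hnorm f + ‖R (u 0)‖)

/-- For v(z) = u(z/c) the norm of the solution gains √c, that of the source c⁻¹f(z/c) loses √c, and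
the trace is unchanged. All terms are consistent with replacing φ by φ√c. -/
theorem ReducedEstimate.scale {H : Matrix α α ℂ}
    {R : EuclideanSpace ℂ α →ₗ[ℂ] EuclideanSpace ℂ κ} (h : ReducedEstimate C φ H R) {c : ℝ}
    (hc : 0 < c) : ReducedEstimate C (φ * Real.sqrt c) ((c : ℂ) • H) R := by
  intro f u hu
  have hv := hu.comp_mul (inv_pos.2 hc)
  rw [op_smul, smul_smul, Complex.ofReal_inv, inv_mul_cancel₀ (by exact_mod_cast hc.ne'),
    one_smul] at hv
  have h1 := h _ _ hv
  have e1 : hnorm (fun z => ((c : ℂ)⁻¹) • f (c⁻¹ * z)) = (Real.sqrt c)⁻¹ * hnorm f := by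
    have h2 : hnorm (fun z => ((c : ℂ)⁻¹) • f (c⁻¹ * z)) =
        c⁻¹ * hnorm (fun z => f (c⁻¹ * z)) := by
      have h3 := eLpNorm_const_smul ((c : ℂ)⁻¹) (fun z => f (c⁻¹ * z)) 2 halfLine
      unfold hnorm
      change (eLpNorm (((c : ℂ)⁻¹) • fun z => f (c⁻¹ * z)) 2 halfLine).toReal = _
      rw [h3, ENNReal.toReal_mul, toReal_enorm, norm_inv, Complex.norm_real,
        Real.norm_of_nonneg hc.le]
    rw [h2, hnorm_comp_mul f (inv_pos.2 hc), Real.sqrt_inv, inv_inv, ← mul_assoc]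
    congr 1
    rw [inv_mul_eq_div, div_eq_iff hc.ne', ← Real.sqrt_inv]
    have : Real.sqrt c * Real.sqrt c = c := Real.mul_self_sqrt hc.le
    rw [Real.sqrt_inv]
    field_simp
    rw [Real.sq_sqrt hc.le]
  rw [e1, hnorm_comp_mul u (inv_pos.2 hc), Real.sqrt_inv, inv_inv, mul_zero] at h1
  rw [mul_inv]
  convert! h1 using 2 <;> ring

end Operators

/-! ### Matrices depending differentiably on the frequency. -/

section Entries

variable {α β κ : Type*} [Fintype α] [DecidableEq α] [Fintype β] [DecidableEq β] [Fintype κ]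
  [DecidableEq κ] {F : Type*} [NormedAddCommGroup F] [NormedSpace ℝ F]

/-- Differentiability at the origin of the entries of a matrix depending on parameters. -/
def EntryDiff (M : F → Matrix α β ℂ) : Prop :=
  ∀ i j, DifferentiableAt ℝ (fun ζ => M ζ i j) 0

theorem EntryDiff.mul {M : F → Matrix α β ℂ} {N : F → Matrix β κ ℂ} (hM : EntryDiff M)
    (hN : EntryDiff N) : EntryDiff fun ζ => M ζ * N ζ := by
  intro i j
  simp only [Matrix.mul_apply]
  exact DifferentiableAt.fun_sum fun k _ => (hM i k).mul (hN k j)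

theorem EntryDiff.of_contDiffOn {M : F → Matrix α β ℂ} {ρ : ℝ} (hρ : 0 < ρ)
    (h : ∀ i j, ContDiffOn ℝ ∞ (fun ζ => M ζ i j) (Metric.ball 0 ρ)) : EntryDiff M := fun i j =>
  ((h i j).contDiffAt (Metric.ball_mem_nhds 0 hρ)).differentiableAt (by simp)

theorem EntryDiff.eventually_le {M : F → Matrix β α ℂ} (h : EntryDiff M) :
    ∃ C > 0, ∀ᶠ ζ in 𝓝 (0 : F), ‖op (M ζ) - op (M 0)‖ ≤ C * ‖ζ‖ := by
  have e : (fun ζ => op (M ζ)) = fun ζ => ∑ i, ∑ j, M ζ i j • op (Matrix.single i j (1 : ℂ)) := by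
    ext1 ζ
    conv_lhs => rw [Matrix.matrix_eq_sum_single (M ζ)]
    rw [op_sum]
    refine Finset.sum_congr rfl fun i _ => ?_
    rw [op_sum]
    refine Finset.sum_congr rfl fun j _ => ?_
    rw [← op_smul, Matrix.smul_single, smul_eq_mul, mul_one]
  have hd : DifferentiableAt ℝ (fun ζ => op (M ζ)) 0 := by
    rw [e]
    exact DifferentiableAt.fun_sum fun i _ => DifferentiableAt.fun_sum fun j _ =>
      (h i j).smul_const _
  obtain ⟨C, hC, hb⟩ := hd.hasFDerivAt.isBigO_sub.exists_pos
  exact ⟨C, hC, by simpa using hb.bound⟩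

theorem EntryDiff.tendsto {M : F → Matrix β α ℂ} (h : EntryDiff M) {ε : ℝ} (hε : 0 < ε) :
    ∀ᶠ ζ in 𝓝 (0 : F), ‖op (M ζ) - op (M 0)‖ ≤ ε := by
  obtain ⟨C, hC, hb⟩ := h.eventually_le
  filter_upwards [hb, Metric.ball_mem_nhds (0 : F) (div_pos hε hC)] with ζ h1 h2
  rw [mem_ball_zero_iff, lt_div_iff₀ hC] at h2
  linarith

theorem EntryDiff.eventually_norm_le {M : F → Matrix β α ℂ} (h : EntryDiff M) :
    ∀ᶠ ζ in 𝓝 (0 : F), ‖op (M ζ)‖ ≤ ‖op (M 0)‖ + 1 := by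
  filter_upwards [h.tendsto one_pos] with ζ h1
  have := norm_sub_norm_le (op (M ζ)) (op (M 0))
  linarith

/-- A differentiable lower left block that vanishes at ζ = 0 is O(|ζ|), hence O(φ) as soon as |ζ| ≤
φ. The upper triangular form of V(0) enters the estimates here. -/
theorem exists_weightBound {M : F → Matrix (α ⊕ β) (α ⊕ β) ℂ} (h : EntryDiff M)
    (h0 : (M 0).toBlocks₂₁ = 0) : ∃ K, ∀ᶠ ζ in 𝓝 (0 : F), ∀ φ, ‖ζ‖ ≤ φ →
      WeightBound φ K (M ζ) := by
  have h₁₁ : EntryDiff fun ζ => (M ζ).toBlocks₁₁ := fun i j => h _ _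
  have h₁₂ : EntryDiff fun ζ => (M ζ).toBlocks₁₂ := fun i j => h _ _
  have h₂₁ : EntryDiff fun ζ => (M ζ).toBlocks₂₁ := fun i j => h _ _
  have h₂₂ : EntryDiff fun ζ => (M ζ).toBlocks₂₂ := fun i j => h _ _
  obtain ⟨C, hC, hb⟩ := h₂₁.eventually_le
  refine ⟨(‖op (M 0)‖ + 1) + (‖op (M 0).toBlocks₁₁‖ + 1) + (‖op (M 0).toBlocks₁₂‖ + 1) +
    (‖op (M 0).toBlocks₂₂‖ + 1) + C, ?_⟩
  filter_upwards [h.eventually_norm_le, h₁₁.eventually_norm_le, h₁₂.eventually_norm_le,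
    h₂₂.eventually_norm_le, hb] with ζ a1 a2 a3 a4 a5 φ hφ
  have p0 := norm_nonneg (op (M 0))
  have p1 := norm_nonneg (op (M 0).toBlocks₁₁)
  have p2 := norm_nonneg (op (M 0).toBlocks₁₂)
  have p3 := norm_nonneg (op (M 0).toBlocks₂₂)
  refine ⟨by linarith, by linarith, by linarith, ?_, by linarith⟩
  have e : op (M 0).toBlocks₂₁ = 0 := by
    rw [h0]
    ext1 v
    simp [op, act]
  rw [e, sub_zero] at a5
  refine a5.trans ?_
  have := norm_nonneg ζ
  gcongr
  linarith

end Entries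

/-- Products of a matrix and a vector depending on a variable are differentiated by the product
rule. -/
theorem hasDerivWithinAt_act {α β : Type*} [Fintype α] [DecidableEq α] [Fintype β]
    {M : ℝ → Matrix β α ℂ} {M' : Matrix β α ℂ} {y : ℝ → EuclideanSpace ℂ α}
    {y' : EuclideanSpace ℂ α} {s : Set ℝ} {z : ℝ}
    (hM : ∀ i j, HasDerivWithinAt (fun z => M z i j) (M' i j) s z)
    (hy : HasDerivWithinAt y y' s z) :
    HasDerivWithinAt (fun z => act (M z) (y z)) (act M' (y z) + act (M z) y') s z := by
  have hyj : ∀ j, HasDerivWithinAt (fun z => y z j) (y' j) s z := fun j =>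
    ((EuclideanSpace.proj (𝕜 := ℂ) j).restrictScalars ℝ).hasFDerivAt.comp_hasDerivWithinAt z hy
  have h : HasDerivWithinAt (fun z => (act (M z) (y z)).ofLp)
      (act M' (y z) + act (M z) y').ofLp s z := by
    rw [hasDerivWithinAt_pi]
    intro i
    have h1 := HasDerivWithinAt.fun_sum (u := Finset.univ) fun j _ => (hM i j).mul (hyj j)
    rw [Finset.sum_add_distrib] at h1
    exact h1
  exact ((PiLp.continuousLinearEquiv 2 ℝ fun _ : β => ℂ).symm.toContinuousLinearMap).hasFDerivAt
    |>.comp_hasDerivWithinAt z h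

section BlockAction

variable {α β : Type*} [Fintype α] [DecidableEq α] [Fintype β] [DecidableEq β]

theorem op_cols_incl₂ {κ : Type*} [Fintype κ] [DecidableEq κ] (M : Matrix κ (α ⊕ β) ℂ)
    (v : EuclideanSpace ℂ β) : op M (incl₂ v) = op M.toCols₂ v := by
  rw [op_cols, ← zero_add (incl₂ v), ← map_zero incl₁, comp₁_incl, comp₂_incl]
  simp

theorem op_injective {M : Matrix α α ℂ} (hM : M.det ≠ 0) {v : EuclideanSpace ℂ α}
    (h : op M v = 0) : v = 0 := by
  rw [← op_one v, ← Matrix.nonsing_inv_mul M (isUnit_iff_ne_zero.2 hM), op_mul, h, map_zero]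

theorem incl₂_eq_zero {v : EuclideanSpace ℂ β}
    (h : (incl₂ v : EuclideanSpace ℂ (α ⊕ β)) = 0) : v = 0 := by
  have h1 := comp₂_incl (0 : EuclideanSpace ℂ α) v
  rw [map_zero, zero_add, h] at h1
  exact h1.symm

theorem tendsto_act_zero {M : ℝ → Matrix α α ℂ} {N : Matrix α α ℂ}
    {y : ℝ → EuclideanSpace ℂ α} {l : Filter ℝ}
    (hM : ∀ i j, Tendsto (fun z => M z i j) l (𝓝 (N i j))) (hy : Tendsto y l (𝓝 0)) :
    Tendsto (fun z => act (M z) (y z)) l (𝓝 0) := by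
  have hyj : ∀ j, Tendsto (fun z => y z j) l (𝓝 0) := fun j =>
    ((EuclideanSpace.proj (𝕜 := ℂ) j).continuous.tendsto (0 : EuclideanSpace ℂ α)).comp hy
  have h : Tendsto (fun z => (act (M z) (y z)).ofLp) l (𝓝 0) := by
    rw [tendsto_pi_nhds]
    intro i
    have h1 := tendsto_finsetSum Finset.univ fun j _ => (hM i j).mul (hyj j)
    simp only [mul_zero, Finset.sum_const_zero] at h1
    exact h1
  exact ((PiLp.continuousLinearEquiv 2 ℝ fun _ : α => ℂ).symm.continuous.tendsto 0).comp h

theorem WeightBound.mono {φ K K' : ℝ} {M : Matrix (α ⊕ β) (α ⊕ β) ℂ} (h : WeightBound φ K M)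
    (hK : K ≤ K') (hφ : 0 ≤ φ) : WeightBound φ K' M :=
  ⟨h.b.trans hK, h.b₁₁.trans hK, h.b₁₂.trans hK,
    h.b₂₁.trans (mul_le_mul_of_nonneg_right hK hφ), h.b₂₂.trans hK⟩

end BlockAction

/-! ### Consequences of transversality and uniform control for small frequencies. -/

namespace BVP

variable {n₁ n₂ m p q r : ℕ} {S : BVP n₁ n₂ m p q r} {w : ℝ → State n₁ n₂}
  {uinf : State n₁ n₂} {Φ : ℝ → Freq m → Matrix (FOIdx n₁ n₂) (FOIdx n₁ n₂) ℂ}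
  {V : Freq m → Matrix (FOIdx n₁ n₂) (FOIdx n₁ n₂) ℂ}
  {FH : Submodule ℂ (EuclideanSpace ℂ (BdIdx p q r))}

theorem entryDiff_bdry (S : BVP n₁ n₂ m p q r) (w : ℝ → State n₁ n₂) :
    EntryDiff (S.bdry w) := by
  have hsum : SepMatrix 1 (fun _ ζ => ∑ j : Fin m, (Complex.I * (Freq.eta ζ j : ℂ)) • cx (S.K j (w 0)))
      fun ζ => ∑ j : Fin m, (Complex.I * (Freq.eta ζ j : ℂ)) • cx (S.K j (w 0)) :=
    SepMatrix.sum _ fun j => (sepMatrix_const (cx (S.K j (w 0)))).smul one_pos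
      (contDiff_const.mul (contDiff_freq_coord (Sum.inl j)))
  have h : SepMatrix 1 (fun _ => S.bdry w) (S.bdry w) :=
    ((sepMatrix_const _).fromCols (sepMatrix_const _)).fromBlocks (sepMatrix_const _)
      ((sepMatrix_const _).fromBlocks (sepMatrix_const _) (sepMatrix_const _) hsum)
      ((sepMatrix_const _).fromRows (sepMatrix_const _))
  exact fun i j => (h i j).contDiff.contDiffAt.differentiableAt (by simp)

theorem IsConjugator.entryDiff (hΦ : S.IsConjugator w uinf Φ) : EntryDiff (Φ 0) := by
  obtain ⟨ρ, hρ, h, -⟩ := hΦ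
  refine EntryDiff.of_contDiffOn hρ fun i j => ?_
  exact (h i j).comp (contDiff_const.prodMk contDiff_id).contDiffOn fun ζ hζ => ⟨self_mem_Ici, hζ⟩

theorem Admissible.entryDiff_endG (hS : S.Admissible) (hw : S.IsProfile w uinf) :
    EntryDiff (S.endG uinf) := by
  obtain ⟨δ, -, h⟩ := hS.sepMatrix_calG hw
  exact fun i j => (h i j).contDiff.contDiffAt.differentiableAt (by simp)

theorem IsBlockReduction.entryDiff (hV : S.IsBlockReduction uinf V) : EntryDiff V := by
  obtain ⟨⟨ρ, hρ, h, -⟩, -⟩ := hV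
  exact EntryDiff.of_contDiffOn hρ h

theorem IsBlockReduction.entryDiff_inv (hV : S.IsBlockReduction uinf V) :
    EntryDiff fun ζ => (V ζ)⁻¹ := by
  obtain ⟨⟨ρ, hρ, h, hd⟩, -⟩ := hV
  exact EntryDiff.of_contDiffOn hρ (contDiffOn_inv_apply h fun ζ hζ => (hd ζ hζ).1)

theorem IsBlockReduction.blockP_zero (hV : S.IsBlockReduction uinf V) :
    S.blockP uinf V 0 = S.endP uinf := by
  obtain ⟨-, W, hW⟩ := hV
  rw [blockP, hW, conj_endG_zero, Matrix.toBlocks_fromBlocks₂₂]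

/-- A layer solution built from a decaying solution of the parabolic block. -/
theorem injective_bdryP (htrans : S.IsTransversal w) (hΦ : S.IsConjugator w uinf Φ)
    (hV : S.IsBlockReduction uinf V) {a : EuclideanSpace ℂ (Fin n₂)}
    (ha : a ∈ specNeg (op (S.blockP uinf V 0) : _ →ₗ[ℂ] EuclideanSpace ℂ (Fin n₂)))
    (h0 : op (S.bdryP w Φ V 0) a = 0) : a = 0 := by
  obtain ⟨⟨ρV, hρV, -, hVd⟩, -⟩ := hV
  obtain ⟨ρ, hρ, -, hdet, hder, θ, hθ, C, hC⟩ := hΦ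
  obtain ⟨hVdet, h₁₂, -⟩ := hVd 0 (Metric.mem_ball_self hρV)
  have hz0 : (0 : Freq m) ∈ Metric.ball (0 : Freq m) ρ := Metric.mem_ball_self hρ
  have hcs : CompleteSpace (EuclideanSpace ℂ (Fin n₂)) := FiniteDimensional.complete ℂ _
  set P := op (S.blockP uinf V 0) with hP
  set D := (V 0)⁻¹ * S.endG uinf 0 * V 0 with hD
  have hVD : V 0 * D = S.endG uinf 0 * V 0 := by
    rw [hD, ← Matrix.mul_assoc, Matrix.mul_nonsing_inv_cancel_left _ _ (isUnit_iff_ne_zero.2 hVdet)]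
  let T : EuclideanSpace ℂ (Fin n₂) →L[ℂ] EuclideanSpace ℂ (FOIdx n₁ n₂) := (op (V 0)).comp incl₂
  have hT : ∀ v, op (S.endG uinf 0) (T v) = T (P v) := fun v => by
    change op (S.endG uinf 0) (op (V 0) (incl₂ v)) = op (V 0) (incl₂ (P v))
    rw [← op_mul, ← hVD, op_mul, op_incl₂ h₁₂]
    rfl
  have hy : ∀ z, HasDerivAt (fun z => T (flow P z a)) (T (P (flow P z a))) z := fun z =>
    (T.restrictScalars ℝ).hasFDerivAt.comp_hasDerivAt z (hasDerivAt_flow_apply P a z)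
  -- The decaying solution e^{zP}a is carried by V(0) to the constant coefficient system and by the
  -- conjugator to the linearized profile equation. It still decays because Φ → 1, and its boundary
  -- value is Γ_P(0)a = 0.
  let U : ℝ → EuclideanSpace ℂ (FOIdx n₁ n₂) := fun z => act (Φ z 0) (T (flow P z a))
  have hU : S.IsLayerSolution w U := fun z hz => by
    have h1 := hasDerivWithinAt_act (hder z hz 0 hz0) (hy z).hasDerivWithinAt
    rw [← hT] at h1
    convert! h1 using 1
    change act (S.calG w z 0) (act (Φ z 0) (T (flow P z a))) =
      act (S.calG w z 0 * Φ z 0 - Φ z 0 * S.endG uinf 0) (T (flow P z a)) +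
      act (Φ z 0) (act (S.endG uinf 0) (T (flow P z a)))
    rw [← act_mul, ← act_mul]
    apply (WithLp.equiv 2 _).injective
    change _ = Matrix.mulVec (S.calG w z 0 * Φ z 0 - Φ z 0 * S.endG uinf 0) (T (flow P z a)).ofLp +
      Matrix.mulVec (Φ z 0 * S.endG uinf 0) (T (flow P z a)).ofLp
    rw [← Matrix.add_mulVec, sub_add_cancel]
    rfl
  have hexp : ∀ {κ : ℝ}, 0 < κ → Tendsto (fun z : ℝ => Real.exp (-(κ * z))) atTop (𝓝 0) :=
    fun hκ => Real.tendsto_exp_neg_atTop_nhds_zero.comp (tendsto_id.const_mul_atTop hκ)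
  have hflow : Tendsto (fun z => T (flow P z a)) atTop (𝓝 0) := by
    obtain ⟨κ, hκ, c, hc, h⟩ := exists_norm_flow_le_of_mem_specNeg ha
    have h1 : Tendsto (fun z => flow P z a) atTop (𝓝 0) := by
      refine squeeze_zero_norm' (eventually_atTop.2 ⟨0, fun z hz => h z hz⟩) ?_
      simpa using (hexp hκ).const_mul c
    have h2 := (T.continuous.tendsto 0).comp h1
    rwa [map_zero] at h2
  have hlim : Tendsto U atTop (𝓝 0) := by
    refine tendsto_act_zero (N := 1) (fun i j => ?_) hflow
    rw [← tendsto_sub_nhds_zero_iff]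
    refine squeeze_zero_norm' (eventually_atTop.2 ⟨0, fun z hz => (hC z hz 0 hz0 i j).1⟩) ?_
    simpa using (hexp hθ).const_mul C
  have hlim₁ : Tendsto (fun z => comp₁ (U z)) atTop (𝓝 0) := by
    have := ((comp₁L : EuclideanSpace ℂ (FOIdx n₁ n₂) →L[ℂ]
      EuclideanSpace ℂ (Fin n₁ ⊕ Fin n₂)).continuous.tendsto 0).comp hlim
    rwa [map_zero] at this
  have e0 : T (flow P 0 a) = op (V 0) (incl₂ a) := by
    rw [flow_zero]
    rfl
  have hb : act (S.bdry w 0) (U 0) = 0 := by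
    change op (S.bdry w 0) (op (Φ 0 0) (T (flow P 0 a))) = 0
    rw [e0, ← op_mul, ← op_mul, op_cols_incl₂]
    exact h0
  -- Condition (i) of transversality makes U vanish, and a is recovered since Φ(0, 0) and V(0) are
  -- invertible.
  have h1 : op (Φ 0 0) (T (flow P 0 a)) = 0 := htrans.injective U hU hlim₁ hb 0 le_rfl
  have h2 := op_injective (hdet 0 le_rfl 0 hz0) h1
  rw [e0] at h2
  exact incl₂_eq_zero (op_injective hVdet h2)

/-- The properties, uniform for small frequencies, by which the two problems are compared. -/
structure IsControlled (S : BVP n₁ n₂ m p q r) (w : ℝ → State n₁ n₂) (uinf : State n₁ n₂)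
    (Φ : ℝ → Freq m → Matrix (FOIdx n₁ n₂) (FOIdx n₁ n₂) ℂ)
    (V : Freq m → Matrix (FOIdx n₁ n₂) (FOIdx n₁ n₂) ℂ)
    (FH : Submodule ℂ (EuclideanSpace ℂ (BdIdx p q r))) (C K : ℝ) (ζ : Freq m) : Prop where
  det : (V ζ).det ≠ 0
  b₁₂ : ((V ζ)⁻¹ * S.endG uinf ζ * V ζ).toBlocks₁₂ = 0
  b₂₁ : ((V ζ)⁻¹ * S.endG uinf ζ * V ζ).toBlocks₂₁ = 0
  bd : BoundaryEstimate C (op (S.blockP uinf V ζ)) (op (S.bdryP w Φ V ζ)) FH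
  bdH : ‖op (S.bdryH w Φ V ζ)‖ ≤ K
  bdP : ‖op (S.bdryP w Φ V ζ)‖ ≤ K
  bV : ∀ φ, ‖ζ‖ ≤ φ → WeightBound φ K (V ζ)
  bVinv : ∀ φ, ‖ζ‖ ≤ φ → WeightBound φ K (V ζ)⁻¹

/-- At ζ = 0 the hypotheses of `exists_boundary_estimate` are the spectral property of `endP`, the
injectivity supplied by transversality and the choice of 𝔽_H. Continuity and differentiability of
the entries at ζ = 0 extend the conclusions, with fixed constants, to small ζ. -/
theorem Admissible.eventually_isControlled (hS : S.Admissible) (hw : S.IsProfile w uinf)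
    (htrans : S.IsTransversal w) (hΦ : S.IsConjugator w uinf Φ)
    (hV : S.IsBlockReduction uinf V) (hFH : IsCompl FH (S.spaceFP w uinf Φ V 0)) :
    ∃ C > 0, ∃ K > 0, ∀ᶠ ζ in 𝓝 0, S.IsControlled w uinf Φ V FH C K ζ := by
  have dV := hV.entryDiff
  have dVi := hV.entryDiff_inv
  have dΓ : EntryDiff fun ζ => S.bdryTilde w Φ ζ * V ζ :=
    ((entryDiff_bdry S w).mul hΦ.entryDiff).mul dV
  have dH : EntryDiff (S.bdryH w Φ V) := fun i j => dΓ _ _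
  have dP : EntryDiff (S.bdryP w Φ V) := fun i j => dΓ _ _
  have dD : EntryDiff fun ζ => (V ζ)⁻¹ * S.endG uinf ζ * V ζ :=
    (dVi.mul (hS.entryDiff_endG hw)).mul dV
  have dB : EntryDiff (S.blockP uinf V) := fun i j => dD _ _
  have hno : NoImagEigenvalue
      (op (S.blockP uinf V 0) : _ →ₗ[ℂ] EuclideanSpace ℂ (Fin n₂)) := by
    rw [hV.blockP_zero]
    exact hS.noImagEigenvalue_endP hw.end_mem
  obtain ⟨ε, hε, C, hC, hest⟩ := exists_boundary_estimate hno (op (S.bdryP w Φ V 0))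
    (fun a ha h0 => injective_bdryP htrans hΦ hV ha h0) hFH
  obtain ⟨W, hW⟩ := hV.2
  obtain ⟨K₁, hK₁⟩ := exists_weightBound dV (by rw [hW]; rfl)
  obtain ⟨K₂, hK₂⟩ := exists_weightBound dVi (by rw [hW, inv_fromBlocks_one]; rfl)
  obtain ⟨ρ, hρ, -, hd⟩ := hV.1
  refine ⟨C, hC, max 1 (max (max K₁ K₂) (max (‖op (S.bdryH w Φ V 0)‖ + 1)
    (‖op (S.bdryP w Φ V 0)‖ + 1))), by positivity, ?_⟩
  filter_upwards [dP.tendsto hε, dB.tendsto hε, hK₁, hK₂, dH.eventually_norm_le,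
    dP.eventually_norm_le, Metric.ball_mem_nhds (0 : Freq m) hρ] with ζ a1 a2 a3 a4 a5 a6 a7
  obtain ⟨h1, h2, h3⟩ := hest _ _ a2 a1
  exact
    { det := (hd ζ a7).1
      b₁₂ := (hd ζ a7).2.1
      b₂₁ := (hd ζ a7).2.2
      bd := ⟨h1, h2, h3⟩
      bdH := a5.trans (by simp)
      bdP := a6.trans (by simp)
      bV := fun φ hφ => (a3 φ hφ).mono (by simp) ((norm_nonneg _).trans hφ)
      bVinv := fun φ hφ => (a4 φ hφ).mono (by simp) ((norm_nonneg _).trans hφ) }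

end BVP

/-! ### The low-frequency weight and the equivalence of the two estimates. -/

namespace BVP

variable {n₁ n₂ m p q r : ℕ} {S : BVP n₁ n₂ m p q r} {w : ℝ → State n₁ n₂}
  {uinf : State n₁ n₂} {Φ : ℝ → Freq m → Matrix (FOIdx n₁ n₂) (FOIdx n₁ n₂) ℂ}
  {V : Freq m → Matrix (FOIdx n₁ n₂) (FOIdx n₁ n₂) ℂ}
  {FH : Submodule ℂ (EuclideanSpace ℂ (BdIdx p q r))}

/-- This comparison turns the O(|ζ|) bounds on the lower left blocks of V and V⁻¹ into the factor φ
required by `WeightBound`. -/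
theorem norm_le_weight {ζ : Freq m} (hγ : 0 ≤ ζ.gamma) : ‖ζ‖ ≤ weight ζ :=
  Real.le_sqrt_of_sq_le (by linarith)

theorem gamma_le_norm (ζ : Freq m) : ζ.gamma ≤ ‖ζ‖ :=
  (le_abs_self _).trans (PiLp.norm_apply_le ζ (Sum.inr 1))

theorem weight_le_one {ζ : Freq m} (h : ‖ζ‖ ≤ 1 / 2) : weight ζ ≤ 1 := by
  rw [weight, Real.sqrt_le_one]
  nlinarith [gamma_le_norm ζ, norm_nonneg ζ]

/-- The weight in polar coordinates. -/
theorem weight_smul {ζ : Freq m} (hζ : ‖ζ‖ = 1) {ρ : ℝ} (hρ : 0 < ρ) :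
    weight (ρ • ζ) = Real.sqrt (ζ.gamma + ρ) * Real.sqrt ρ := by
  have h : (ρ • ζ).gamma = ρ * ζ.gamma := rfl
  rw [weight, h, norm_smul, hζ, mul_one, Real.norm_of_nonneg hρ.le, ← Real.sqrt_mul' _ hρ.le]
  congr 1
  ring

theorem IsControlled.reduced {C K C₁ : ℝ} {ζ : Freq m} (h : S.IsControlled w uinf Φ V FH C K ζ)
    (hK : 0 < K) (hC₁ : 0 < C₁) (hγ : 0 ≤ ζ.gamma) (hζ0 : 0 < ‖ζ‖) (hζ : ‖ζ‖ ≤ 1 / 2)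
    (hest : ∀ F U, IsSol (op (S.endG uinf ζ)) F U → wnorm (weight ζ) U ≤
      C₁ * ((weight ζ)⁻¹ * hnorm F + ‖op (S.bdryTilde w Φ ζ) (U 0)‖)) :
    ReducedEstimate (4 * K * C₁ * (K + 1)) (weight ζ) (S.blockH uinf V ζ)
      (S.bdryRed w uinf Φ V FH ζ) := by
  have hw := norm_le_weight hγ
  have hfull := fullEstimate_of_conj h.det h.b₁₂ h.b₂₁ (h.bV _ hw).b (h.bVinv _ hw)
    (hζ0.trans_le hw) (weight_le_one hζ) hK.le hC₁.le hest
  exact fun f u hu => h.bd.reduced_of_full hfull hu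

theorem exists_full_of_reduced {C K C₁ : ℝ} (hC : 0 < C) (hK : 0 < K) (hC₁ : 0 < C₁) :
    ∃ C₂ > 0, ∀ ζ : Freq m, S.IsControlled w uinf Φ V FH C K ζ → 0 ≤ ζ.gamma → 0 < ‖ζ‖ →
      ‖ζ‖ ≤ 1 / 2 → ReducedEstimate C₁ (weight ζ) (S.blockH uinf V ζ)
        (S.bdryRed w uinf Φ V FH ζ) →
      ∀ F U, IsSol (op (S.endG uinf ζ)) F U → wnorm (weight ζ) U ≤
        C₂ * ((weight ζ)⁻¹ * hnorm F + ‖op (S.bdryTilde w Φ ζ) (U 0)‖) := by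
  obtain ⟨C₂, hC₂, h2⟩ := BoundaryEstimate.full_of_reduced
    (E₁ := EuclideanSpace ℂ (Fin n₁ ⊕ Fin n₂)) (E₂ := EuclideanSpace ℂ (Fin n₂))
    (β := BdIdx p q r) hC hK hC₁
  refine ⟨4 * K * C₂ * (K + 1), by positivity, fun ζ h hγ hζ0 hζ hred F U hU => ?_⟩
  have hw := norm_le_weight hγ
  have hfull : FullEstimate C₂ (weight ζ) (S.blockH uinf V ζ) (S.blockP uinf V ζ)
      (S.bdryH w Φ V ζ) (S.bdryP w Φ V ζ) :=
    h2 _ _ _ _ FH _ h.bd h.bdH h.bdP (hζ0.trans_le hw) (weight_le_one hζ) hred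
  exact FullEstimate.conj h.det h.b₁₂ h.b₂₁ (h.bV _ hw) (h.bVinv _ hw).b (hζ0.trans_le hw)
    (weight_le_one hζ) hK.le hC₂.le hfull hU

theorem Admissible.maximalEstimates_iff (hS : S.Admissible) (hw : S.IsProfile w uinf)
    (htrans : S.IsTransversal w) (hΦ : S.IsConjugator w uinf Φ)
    (hV : S.IsBlockReduction uinf V) (hFH : IsCompl FH (S.spaceFP w uinf Φ V 0)) :
    S.MaximalEstimates w uinf Φ ↔ S.ReducedMaximalEstimates w uinf Φ V FH := by
  obtain ⟨C, hC, K, hK, hev⟩ := hS.eventually_isControlled hw htrans hΦ hV hFH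
  obtain ⟨ε, hε, hball⟩ := Metric.eventually_nhds_iff_ball.1 hev
  have hctrl : ∀ ζ : Freq m, ‖ζ‖ ≤ ε / 2 → S.IsControlled w uinf Φ V FH C K ζ := fun ζ hζ =>
    hball ζ (by rw [mem_ball_zero_iff]; linarith)
  constructor
  · rintro ⟨C₁, hC₁, ρ₀, hρ₀, hest⟩
    -- The radius respects three constraints: the range of the given estimate, the ball of uniform
    -- control, and |ζ| ≤ 1/2, which ensures φ ≤ 1.
    refine ⟨4 * K * C₁ * (K + 1), by positivity, min ρ₀ (min (ε / 2) (1 / 2)), by positivity,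
      fun ζ hζ hγ ρ hρ hρm f u h hu hh => ?_⟩
    obtain ⟨r1, r2, r3⟩ : ρ ≤ ρ₀ ∧ ρ ≤ ε / 2 ∧ ρ ≤ 1 / 2 := by simpa using hρm
    have hn : ‖ρ • ζ‖ = ρ := by rw [norm_smul, hζ, mul_one, Real.norm_of_nonneg hρ.le]
    have hγ' : 0 ≤ (ρ • ζ).gamma := mul_nonneg hρ.le hγ
    have hred := (hctrl (ρ • ζ) (hn.trans_le r2)).reduced hK hC₁ hγ' (hρ.trans_eq hn.symm)
      (hn.trans_le r3) fun F U hU => hest _ hγ' (hρ.trans_eq hn.symm) (hn.trans_le r1) F U _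
        (isL2Solution_iff.2 hU) rfl
    -- Dilation by 1/ρ multiplies H by ρ⁻¹ and strips the factor √ρ from the weight φ(ρζ̌).
    have hs := hred.scale (inv_pos.2 hρ)
    rw [weight_smul hζ hρ, Real.sqrt_inv, mul_inv_cancel_right₀ (Real.sqrt_pos.2 hρ).ne',
      Complex.ofReal_inv] at hs
    rw [← hh]
    exact hs f u (isL2Solution_iff.1 hu)
  · rintro ⟨C₁, hC₁, ρ₀, hρ₀, hest⟩
    obtain ⟨C₂, hC₂, h2⟩ := exists_full_of_reduced (S := S) (w := w) (uinf := uinf) (Φ := Φ)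
      (V := V) (FH := FH) hC hK hC₁
    refine ⟨C₂, hC₂, min ρ₀ (min (ε / 2) (1 / 2)), by positivity,
      fun ζ hγ hζ0 hζm F U g hU hg => ?_⟩
    obtain ⟨r1, r2, r3⟩ : ‖ζ‖ ≤ ρ₀ ∧ ‖ζ‖ ≤ ε / 2 ∧ ‖ζ‖ ≤ 1 / 2 := by simpa using hζm
    set ρ := ‖ζ‖ with hρ
    have hζ' : ρ • (ρ⁻¹ • ζ) = ζ := smul_inv_smul₀ hζ0.ne' ζ
    have hn : ‖ρ⁻¹ • ζ‖ = 1 := by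
      rw [norm_smul, norm_inv, Real.norm_of_nonneg hζ0.le, ← hρ, inv_mul_cancel₀ hζ0.ne']
    have hγ' : 0 ≤ (ρ⁻¹ • ζ).gamma := mul_nonneg (inv_nonneg.2 hζ0.le) hγ
    have hred : ReducedEstimate C₁ (Real.sqrt ((ρ⁻¹ • ζ).gamma + ρ))
        ((ρ⁻¹ : ℂ) • S.blockH uinf V ζ) (S.bdryRed w uinf Φ V FH ζ) := fun f u hu => by
      have h1 := hest (ρ⁻¹ • ζ) hn hγ' ρ hζ0 r1 f u (S.bdryRed w uinf Φ V FH ζ (u 0))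
      rw [hζ'] at h1
      exact h1 (isL2Solution_iff.2 hu) rfl
    -- The inverse dilation: with ρ = |ζ| it restores H and the weight φ(ζ).
    have hs := hred.scale hζ0
    rw [← weight_smul hn hζ0, hζ', smul_smul,
      mul_inv_cancel₀ (by exact_mod_cast hζ0.ne'), one_smul] at hs
    rw [← hg]
    exact h2 ζ (hctrl ζ r2) hγ hζ0 r3 hs F U (isL2Solution_iff.1 hU)

end BVP

end ViscousBoundary

end

theorem mainTheorem5 {n₁ n₂ m p q r : ℕ} (S : ViscousBoundary.BVP n₁ n₂ m p q r)
    (hS : S.Admissible)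
    (w : ℝ → ViscousBoundary.State n₁ n₂) (uinf : ViscousBoundary.State n₁ n₂)
    (hw : S.IsProfile w uinf) (htrans : S.IsTransversal w) :
    (∃ Φ, S.IsConjugator w uinf Φ) ∧ (∃ V, S.IsBlockReduction uinf V) ∧
    ∀ Φ, S.IsConjugator w uinf Φ → ∀ V, S.IsBlockReduction uinf V →
      ∀ FH, IsCompl FH (S.spaceFP w uinf Φ V 0) →
        (S.MaximalEstimates w uinf Φ ↔ S.ReducedMaximalEstimates w uinf Φ V FH) :=
  ⟨hS.exists_isConjugator hw, hS.exists_isBlockReduction hw,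
    fun _ hΦ _ hV _ hFH => hS.maximalEstimates_iff hw htrans hΦ hV hFH⟩
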